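/- \textbf{Conventions.} For a language $L\subseteq\Sigma^*$ and $w\in\Sigma^*$ let $w^{-1}L=\{x\mid wx\in L\}$ be the quotient of $L$ by $w$; a quotient is \emph{final} if it contains the empty word $\varepsilon$. The \emph{complexity} $\kappa(L)$ is the number of distinct quotients of $L$. The \emph{syntactic semigroup} of $L$ is the quotient of $\Sigma^+$ by the congruence $x\approx_L y\iff(\forall w,z\in\Sigma^*:\ wxz\in L\Leftrightarrow wyz\in L)$. For a set $S$ of quotients of $L$ let $A_S$ be the intersection of the quotients in $S$ and of the complements of the quotients not in $S$; the \emph{atoms} of $L$ are the non-empty $A_S$. A language $L$ is \emph{prefix-convex} if $u,w\in L$, $u$ a prefix of $v$ and $v$ a prefix of $w$ imply $v\in L$; it is \emph{proper} if moreover it is not a right ideal, not prefix-closed and not prefix-free; it is \emph{$k$-proper} if it is proper prefix-convex and has exactly $k$ final quotients. A DFA is \emph{minimal} if all its states are reachable and no two of them are equivalent. For a language $L=L(a,b,c_1,c_2,d_1,d_2,e)$ over seven letters and a list $(x_1,\dots,x_7)$ of letters or dashes, the \emph{dialect} $L(x_1,\dots,x_7)$ is obtained by replacing in each word of $L$ the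 $i$-th letter by $x_i$, and deleting the words with a letter whose entry is a dash; it is a language over the set of the $x_i$ that are letters. A binary boolean function is \emph{proper} if it depends on both of its arguments. \textbf{The automata.} Let $n\ge3$ and $1\le k\le n-2$. Let $\mathcal D_{n,k}$ be the DFA with states $Q_n=\{0,\dots,n-1\}$, initial state $0$, final states $F_{n,k}=\{n-1-k,\dots,n-2\}$, alphabet $\Sigma=\{a,b,c_1,c_2,d_1,d_2,e\}$ and the following transformations (states not mentioned are fixed, and a cycle of length one is the identity). Put $p=n-1-k$ and $E_{n,k}=\{0,\dots,p-1\}$. \begin{itemize} \item $a$ is the cycle $(1,\dots,p-1)$ if $p$ is even and $(0,\dots,p-1)$ if $p$ is odd, together with the transposition $(p,p+1)$ if $k\ge2$. \item $b$ is the cycle $(p+1,\dots,n-2)$ if $k$ is even and $(p,\dots,n-2)$ if $k$ is odd, together with the transposition $(0,1)$ if $p\ge2$. \item $c_1$ sends $1$ to $0$ if $p\ge2$ and is the identity if $p=1$; $c_2$ sends $p+1$ to $p$ if $k\ge2$ and is the identity if $k=1$. \item $d_1$ sends $q$ to $q+1$ for $0\le q\le p-2$, and $p-1$ to $n-1$;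 $d_2$ sends $q$ to $q+1$ for $p\le q\le n-2$; $e$ sends $0$ to $p$. \end{itemize} Let $L_{n,k}=L_{n,k}(a,b,c_1,c_2,d_1,d_2,e)$ be the language accepted by $\mathcal D_{n,k}$. \textbf{Theorem.} Let $n\ge3$ and $1\le k\le n-2$. The DFA $\mathcal D_{n,k}$ is minimal and $L_{n,k}$ is a $k$-proper language of complexity $n$. The bounds below are maximal: the dialects of $L_{n,k}$ that meet them are $k$-proper of complexity $n$ ($j$-proper of complexity $m$ for $L_{m,j}$), and no bound is exceeded by any $k$-proper language of complexity $n$ over any alphabet (in 6 and 7: by any two languages over the same alphabet, the first $j$-proper of complexity $m$ and the second $k$-proper of complexity $n$). If $2\le k\le n-3$, then every $k$-proper language of complexity $n$ that meets the bound in 1 has an alphabet of at least seven letters. \begin{enumerate} \item The syntactic semigroup of $L_{n,k}$ has cardinality $n^{n-1-k}(k+1)^k$; the maximal value (over $k$) is $n(n-1)^{n-2}$ and is reached only when $k=n-2$. \item The non-empty non-final quotients of $L_{n,k}(a,b,-,-,-,d_2,e)$ have complexity $n$, the final quotients have complexity $k+1$, and $\emptyset$ is a quotient and has complexity $1$. \item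 The reverse of $L_{n,k}(a,b,-,-,-,d_2,e)$ has complexity $2^{n-1}$, and this language has $2^{n-1}$ atoms. \item Identify each state of $\mathcal D_{n,k}$ with the quotient it accepts. Each atom $A_S$ of $L_{n,k}$ has $S=X_1\cup X_2$ with $X_1\subseteq E_{n,k}$ and $X_2\subseteq F_{n,k}$; put $\overline{X_1}=E_{n,k}\setminus X_1$ and $\overline{X_2}=F_{n,k}\setminus X_2$. If $X_2\ne\emptyset$, then $$\kappa(A_S)=1+\sum_{x_1=0}^{|X_1|}\sum_{x_2=1}^{|X_1|+|X_2|-x_1}\sum_{y_1=0}^{|\overline{X_1}|}\sum_{y_2=0}^{|\overline{X_1}|+|\overline{X_2}|-y_1}\binom{n-1-k}{x_1}\binom{k}{x_2}\binom{n-1-k-x_1}{y_1}\binom{k-x_2}{y_2}.$$ If $X_1\neq\emptyset$ and $X_2=\emptyset$, then $$\kappa(A_S)=1+\sum_{x_1=0}^{|X_1|}\sum_{x_2=0}^{|X_1|-x_1}\sum_{y_1=0}^{|\overline{X_1}|}\sum_{y_2=0}^{k}\binom{n-1-k}{x_1}\binom{k}{x_2}\binom{n-1-k-x_1}{y_1}\binom{k-x_2}{y_2}-2^k\sum_{y=0}^{|\overline{X_1}|}\binom{n-1-k}{y}.$$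 Otherwise $S=\emptyset$ and $\kappa(A_S)=2^{n-1}$. (Terms with $x_2>k$ are zero. For an arbitrary $k$-proper language of complexity $n$, the same expressions bound $\kappa(A_S)$ from above, with $X_1$ and $X_2$ the sets of non-final and of final quotients in $S$, and complements taken in the sets of non-empty non-final and of final quotients.) \item The star of $L_{n,k}(a,b,-,-,d_1,d_2,e)$ has complexity $2^{n-2}+2^{n-2-k}+1$; the maximal value (over $k$) is $2^{n-2}+2^{n-3}+1$ and is reached only when $k=1$. \item For $m\ge3$ and $1\le j\le m-2$, the product $L_{m,j}(a,b,c_1,-,d_1,d_2,e)\,L_{n,k}(a,d_2,c_1,-,d_1,b,e)$ has complexity $m-1-j+j2^{n-2}+2^{n-1}$; the maximal value (over $j$) is $m2^{n-2}+1$ and is reached only when $j=m-2$. \item For $m\ge3$ and $1\le j\le m-2$, let $K=L_{m,j}(a,b,c_1,-,d_1,d_2,e)$ and $L=L_{n,k}(a,b,e,-,d_2,d_1,c_1)$. For every proper binary boolean function $\circ$, the complexity of $K\circ L$ is maximal. In particular $K\cup L$ and $K\oplus L$ have complexity $mn$, $K\setminus L$ has complexity $mn-(n-1)$, and $K\cap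 L$ has complexity $mn-(m+n-2)$. \end{enumerate} -/

import Mathlib

universe u

open scoped Computability

namespace PrefixConvex

/-! Quotient complexity of languages. -/

section General

variable {α β : Type u}

/-- The set of (left) quotients `w⁻¹L` of a language. -/
def quotients (L : Language α) : Set (Language α) := Set.range L.leftQuotient

/-- Quotient complexity: the number of distinct quotients (`⊤` if there are infinitely many,
that is, if the language is not regular). -/
noncomputable def complexity (L : Language α) : ℕ∞ := (quotients L).encard

/-- A language is prefix-convex if a word between two words of the language, in the prefix
order, is in the language. -/
def IsPrefixConvex (L : Language α) : Prop :=
  ∀ u v w : List α, u <+: v → v <+: w → u ∈ L → w ∈ L → v ∈ L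

/-- Prefix-converse-closed languages, that is, right ideals. -/
def IsRightIdeal (L : Language α) : Prop :=
  ∀ v w : List α, v <+: w → v ∈ L → w ∈ L

def IsPrefixClosed (L : Language α) : Prop :=
  ∀ v w : List α, v <+: w → w ∈ L → v ∈ L

def IsPrefixFree (L : Language α) : Prop :=
  ∀ v w : List α, v <+: w → v ≠ w → w ∈ L → v ∉ L

/-- Proper prefix-convex languages. -/
def IsProperPrefixConvex (L : Language α) : Prop :=
  IsPrefixConvex L ∧ ¬ IsRightIdeal L ∧ ¬ IsPrefixClosed L ∧ ¬ IsPrefixFree L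

/-- A proper prefix-convex language is `k`-proper if exactly `k` of its quotients are final
(contain the empty word), that is, if its minimal DFA has `k` final states. -/
def IsKProper (k : ℕ) (L : Language α) : Prop :=
  IsProperPrefixConvex L ∧ {K ∈ quotients L | [] ∈ K}.encard = k

/-- The `k`-proper languages of complexity `n`. -/
def KProperOfComplexity (n k : ℕ) (L : Language α) : Prop :=
  IsKProper k L ∧ complexity L = n

/-- The Myhill (syntactic) congruence on non-empty words. -/
def syntacticSetoid (L : Language α) : Setoid {x : List α // x ≠ []} where
  r x y := ∀ w z : List α, w ++ x.1 ++ z ∈ L ↔ w ++ y.1 ++ z ∈ L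
  iseqv :=
    ⟨fun _ _ _ => Iff.rfl, fun h w z => (h w z).symm, fun h h' w z => (h w z).trans (h' w z)⟩

/-- The syntactic semigroup of a language. -/
def SyntacticSemigroup (L : Language α) : Type u := Quotient (syntacticSetoid L)

/-- Multiplication of classes is induced by concatenation of words. -/
instance (L : Language α) : Semigroup (SyntacticSemigroup L) where
  mul := Quotient.map₂ (fun x y => ⟨x.1 ++ y.1, by simp [x.2]⟩) (by
    intro x x' hx y y' hy w z
    have h1 := hx w (y.1 ++ z)
    have h2 := hy (w ++ x'.1) z
    simp only [List.append_assoc] at h1 h2 ⊢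
    exact h1.trans h2)
  mul_assoc := by
    rintro ⟨x⟩ ⟨y⟩ ⟨z⟩
    exact congrArg (Quotient.mk (syntacticSetoid L)) (Subtype.ext (List.append_assoc _ _ _))

/-- The intersection of the quotients of `L` that are in `S` with the complements of the
quotients of `L` that are not in `S`. -/
def atomicIntersection (L : Language α) (S : Set (Language α)) : Language α :=
  {x | ∀ K ∈ quotients L, x ∈ K ↔ K ∈ S}

/-- The atoms of `L`: its non-empty atomic intersections. -/
def atoms (L : Language α) : Set (Language α) :=
  {A | A ≠ ⊥ ∧ ∃ S, S ⊆ quotients L ∧ A = atomicIntersection L S}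

/-- The dialect of `L` given by a partial map `π` of letters: each letter `a` is replaced by
`π a`, and words with a letter at which `π` is undefined are deleted. -/
def dialect (π : α → Option β) (L : Language α) : Language β :=
  {w | ∃ v ∈ L, v.map π = w.map some}

/-- The words of `L` over a sub-alphabet `A`, as a language over `A`. -/
def onAlphabet (A : Set α) (L : Language α) : Language A :=
  {w | w.map Subtype.val ∈ L}

open Classical in
/-- The language `K ∘ L` for a binary boolean function `∘`. -/
noncomputable def boolOp (f : Bool → Bool → Bool) (K L : Language α) : Language α :=
  {w | f (decide (w ∈ K)) (decide (w ∈ L)) = true}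

/-- A binary boolean function is proper if it depends on both of its arguments. -/
def IsProperBool (f : Bool → Bool → Bool) : Prop :=
  (∃ y, f true y ≠ f false y) ∧ (∃ x, f x true ≠ f x false)

/-- A DFA is minimal if all its states are reachable and no two states are equivalent. -/
def IsMinimalDFA {σ : Type} (M : DFA α σ) : Prop :=
  (∀ q, ∃ w, M.eval w = q) ∧ ∀ p q, M.acceptsFrom p = M.acceptsFrom q → p = q

end General

/-! The witness automata. -/

/-- The alphabet `{a, b, c₁, c₂, d₁, d₂, e}`. -/
inductive Letter : Type
  | a | b | c₁ | c₂ | d₁ | d₂ | e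

/-- The cycle `(i, i + 1, …, j)`; it is the identity for `i = j`. -/
def cyc (i j q : ℕ) : ℕ :=
  if i ≤ q ∧ q < j then q + 1 else if i ≤ j ∧ q = j then i else q

/-- The transformation `(p → r)`, which moves only `p`. -/
def send (p r q : ℕ) : ℕ := if q = p then r else q

/-- The transformations induced by the letters, on natural numbers. For `1 ≤ k ≤ n - 2` they map
`{0, …, n - 1}` to itself. -/
def action (n k : ℕ) : Letter → ℕ → ℕ
  | .a => fun q =>
      let s := cyc (if Even (n - 1 - k) then 1 else 0) (n - 2 - k) q
      if 2 ≤ k then cyc (n - 1 - k) (n - k) s else s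
  | .b => fun q =>
      let s := cyc (if Even k then n - k else n - 1 - k) (n - 2) q
      if 2 ≤ n - 1 - k then cyc 0 1 s else s
  | .c₁ => fun q => if 2 ≤ n - 1 - k then send 1 0 q else q
  | .c₂ => fun q => if 2 ≤ k then send (n - k) (n - 1 - k) q else q
  | .d₁ => fun q => if q < n - 2 - k then q + 1 else if q = n - 2 - k then n - 1 else q
  | .d₂ => fun q => if n - 1 - k ≤ q ∧ q ≤ n - 2 then q + 1 else q
  | .e => fun q => send 0 (n - 1 - k) q

/-- `E_{n,k} = {0, …, n - 2 - k}`. -/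
def E (n k : ℕ) : Finset (Fin n) := Finset.univ.filter fun q => q.val < n - 1 - k

/-- `F_{n,k} = {n - 1 - k, …, n - 2}`. -/
def F (n k : ℕ) : Finset (Fin n) := Finset.univ.filter fun q => n - 1 - k ≤ q.val ∧ q.val < n - 1

/-- The DFA `𝒟_{n,k}(a, b, c₁, c₂, d₁, d₂, e)`. (The `else` branch is never used for
`1 ≤ k ≤ n - 2`.) -/
def D (n k : ℕ) (hn : 3 ≤ n) : DFA Letter (Fin n) where
  step q x := if h : action n k x q.val < n then ⟨action n k x q.val, h⟩ else q
  start := ⟨0, by omega⟩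
  accept := F n k

/-- The language `L_{n,k}(a, b, c₁, c₂, d₁, d₂, e)`. -/
def L (n k : ℕ) (hn : 3 ≤ n) : Language Letter := (D n k hn).accepts

/-- The partial map that sends the seven letters, in order, to the given values. -/
def assign (xa xb xc₁ xc₂ xd₁ xd₂ xe : Option Letter) : Letter → Option Letter
  | .a => xa
  | .b => xb
  | .c₁ => xc₁
  | .c₂ => xc₂
  | .d₁ => xd₁
  | .d₂ => xd₂
  | .e => xe

/-- `L_{n,k}(a, b, -, -, -, d₂, e)`, over its four-letter alphabet. -/
def L₄ (n k : ℕ) (hn : 3 ≤ n) : Language ({.a, .b, .d₂, .e} : Set Letter) :=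
  onAlphabet _ (dialect
    (assign (some .a) (some .b) none none none (some .d₂) (some .e)) (L n k hn))

/-- `L_{n,k}(a, b, -, -, d₁, d₂, e)`, over its five-letter alphabet. -/
def L₅ (n k : ℕ) (hn : 3 ≤ n) : Language ({.a, .b, .d₁, .d₂, .e} : Set Letter) :=
  onAlphabet _ (dialect
    (assign (some .a) (some .b) none none (some .d₁) (some .d₂) (some .e)) (L n k hn))

/-- The alphabet of the following three dialects. -/
def sixLetters : Set Letter := {.a, .b, .c₁, .d₁, .d₂, .e}

/-- `L_{n,k}(a, b, c₁, -, d₁, d₂, e)`. -/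
def L₆ (n k : ℕ) (hn : 3 ≤ n) : Language sixLetters :=
  onAlphabet _ (dialect
    (assign (some .a) (some .b) (some .c₁) none (some .d₁) (some .d₂) (some .e)) (L n k hn))

/-- `L_{n,k}(a, d₂, c₁, -, d₁, b, e)`. -/
def L₆prod (n k : ℕ) (hn : 3 ≤ n) : Language sixLetters :=
  onAlphabet _ (dialect
    (assign (some .a) (some .d₂) (some .c₁) none (some .d₁) (some .b) (some .e)) (L n k hn))

/-- `L_{n,k}(a, b, e, -, d₂, d₁, c₁)`. -/
def L₆bool (n k : ℕ) (hn : 3 ≤ n) : Language sixLetters :=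
  onAlphabet _ (dialect
    (assign (some .a) (some .b) (some .e) none (some .d₂) (some .d₁) (some .c₁)) (L n k hn))

/-! The numerical bounds. -/

def semigroupBound (n k : ℕ) : ℕ := n ^ (n - 1 - k) * (k + 1) ^ k

def starBound (n k : ℕ) : ℕ := 2 ^ (n - 2) + 2 ^ (n - 2 - k) + 1

def productBound (m j n : ℕ) : ℕ := m - 1 - j + j * 2 ^ (n - 2) + 2 ^ (n - 1)

/-- The bound for the complexity of an atom `A_S`, where `S` has `s₁ ≤ n - 1 - k` non-final and
`s₂ ≤ k` final elements. In the second case the number subtracted is the part `x₁ = x₂ = 0` of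
the sum, so that the subtraction is never truncated. -/
def atomBound (n k s₁ s₂ : ℕ) : ℕ :=
  let t₁ := n - 1 - k - s₁
  let t₂ := k - s₂
  if s₂ ≠ 0 then
    1 + ∑ x₁ ∈ Finset.Icc 0 s₁, ∑ x₂ ∈ Finset.Icc 1 (s₁ + s₂ - x₁),
      ∑ y₁ ∈ Finset.Icc 0 t₁, ∑ y₂ ∈ Finset.Icc 0 (t₁ + t₂ - y₁),
        (n - 1 - k).choose x₁ * k.choose x₂ * (n - 1 - k - x₁).choose y₁ * (k - x₂).choose y₂
  else if s₁ ≠ 0 then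
    1 + ∑ x₁ ∈ Finset.Icc 0 s₁, ∑ x₂ ∈ Finset.Icc 0 (s₁ - x₁),
      ∑ y₁ ∈ Finset.Icc 0 t₁, ∑ y₂ ∈ Finset.Icc 0 k,
        (n - 1 - k).choose x₁ * k.choose x₂ * (n - 1 - k - x₁).choose y₁ * (k - x₂).choose y₂
      - 2 ^ k * ∑ y ∈ Finset.Icc 0 t₁, (n - 1 - k).choose y
  else 2 ^ (n - 1)

end PrefixConvex

namespace PrefixConvex

/-! ### Counting quotients -/

/-! A proper prefix-convex language K has an accepted word with a rejected extension, and by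
convexity no further extension is accepted; so ∅ is a quotient. For the same reason a quotient
reached from a final quotient is final or empty. Hence the minimal DFA of a k-proper language of
complexity n = p + k + 1 consists of a sink, p other non-final states, one of them initial, and k
final states from which only final states and the sink can be reached (`exists_convexDFA`). Every
upper bound is a count on this shape: attach to each word a datum that determines the quotient by it
(a transformation, a set of states, a pair of images) and count the values that the shape allows.

The witness realizes all that the shape allows. The letters a and b act on the two blocks of states
by a cycle of odd length and a transposition, with opposite roles in the two blocks. An odd power
removes the cycle and keeps the transposition, so a and b generate the product of both symmetric
groups (`exists_permOf`). Conjugating the one-point moves that the other letters provide gives all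
moves of the same kind, and with all seven letters every transformation that fixes the sink and
never leads from a final state to another kind of non-final state than the sink
(`realizes_of_isConvexMap`). The letters a, b, d₂, e alone make every set of states other than the
sink the exact set from which some word is accepted (`exists_fourLetters_word_final`); this yields
minimality, the complexity of the reverse and the number of atoms. Seven letters are needed because
each of five kinds of one-point move forces a letter of its own (`mapKind_eq_of_comp_eq`), and
because a single block permutation cannot have both an odd permutation in one block with the
identity in the other and vice versa among its powers.

The quotient of an atom A_S by w consists of the words accepted from all of the image of S under w
and from nothing in the image of the complement. It is thus empty or given by two pairs of disjoint
sets of states; the cardinalities that can occur are those in `validQuads`, and different data give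
different quotients for the witness (`complexity_atom_W`).

For star, product and boolean operations the data are states of a subset, product or pair automaton.
In the star a final state forces the initial one to be present; in the product the set is empty
until a word of the first factor has been read, and contains the second initial state whenever the
first component is final; in a pair, a component at the sink may make the boolean function constant.
In the dialects one component can be steered while the other stands still or moves in a controlled
way, so that all admissible states are reached and told apart. -/

theorem encard_range_le_of_factors {ι : Type*} {S T : Type*} {f : ι → S} {g : ι → T}
    (h : ∀ w w', g w = g w' → f w = f w') : (Set.range f).encard ≤ (Set.range g).encard := by
  rcases isEmpty_or_nonempty ι with hι | ⟨⟨i⟩⟩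
  · simp [Set.range_eq_empty]
  have : Nonempty S := ⟨f i⟩
  obtain ⟨φ, rfl⟩ := (Function.factorsThrough_iff (f := g) f).1 fun w w' => h w w'
  rw [Set.range_comp]
  exact Set.encard_image_le _ _

theorem encard_range_eq_of_ker {ι : Type*} {S T : Type*} {f : ι → S} {g : ι → T}
    (h : ∀ w w', f w = f w' ↔ g w = g w') : (Set.range f).encard = (Set.range g).encard :=
  le_antisymm (encard_range_le_of_factors fun w w' => (h w w').2)
    (encard_range_le_of_factors fun w w' => (h w w').1)

/-- Each exact complexity is obtained from this by choosing a g whose fibres are the classes of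
words with equal quotients; the next lemma needs only one direction and gives the upper bounds. -/
theorem complexity_eq_of_ker {α : Type u} {T : Type*} {L : Language α} (g : List α → T)
    (h : ∀ w w', L.leftQuotient w = L.leftQuotient w' ↔ g w = g w') :
    complexity L = (Set.range g).encard :=
  encard_range_eq_of_ker h

theorem complexity_le_of_ker {α : Type u} {T : Type*} {L : Language α} (g : List α → T)
    (V : Set T) (hV : ∀ w, g w ∈ V)
    (h : ∀ w w', g w = g w' → L.leftQuotient w = L.leftQuotient w') :
    complexity L ≤ V.encard :=
  (encard_range_le_of_factors h).trans (Set.encard_le_encard (Set.range_subset_iff.2 hV))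

theorem quotients_accepts {α : Type u} {σ : Type*} (M : DFA α σ) (h : ∀ q, ∃ w, M.eval w = q) :
    quotients M.accepts = Set.range M.acceptsFrom := by
  rw [quotients, Language.leftQuotient_accepts, Set.range_comp, Set.range_eq_univ.2 h,
    Set.image_univ]

theorem leftQuotient_acceptsFrom {α : Type u} {σ : Type*} (M : DFA α σ) (q : σ) (w : List α) :
    (M.acceptsFrom q).leftQuotient w = M.acceptsFrom (M.evalFrom q w) := by
  ext y
  simp [DFA.mem_acceptsFrom, DFA.evalFrom_of_append]

theorem quotients_bot {α : Type u} : quotients (⊥ : Language α) = {⊥} := by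
  ext Q
  constructor
  · rintro ⟨w, rfl⟩
    exact Set.mem_singleton_iff.2 (by ext; exact Iff.rfl)
  · rintro rfl
    exact ⟨[], rfl⟩

theorem complexity_bot {α : Type u} : complexity (⊥ : Language α) = 1 := by
  rw [complexity, quotients_bot, Set.encard_singleton]

/-! ### Automata with a sink and an absorbing block of final states -/

/-- States: `none` is the sink, `inl` the other non-final states, `inr` the final states. -/
abbrev St (p k : ℕ) := Option (Fin p ⊕ Fin k)

/-- The shape of the minimal automata of proper prefix-convex languages. -/
structure ConvexDFA {α : Type u} {p k : ℕ} (M : DFA α (St p k)) : Prop where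
  start : ∃ i, M.start = some (.inl i)
  accept : ∀ q, q ∈ M.accept ↔ ∃ f, q = some (.inr f)
  step_none : ∀ x, M.step none x = none
  step_inr : ∀ f x i, M.step (some (.inr f)) x ≠ some (.inl i)

namespace ConvexDFA

variable {α : Type u} {p k : ℕ} {M : DFA α (St p k)}

theorem evalFrom_none (hM : ConvexDFA M) (w : List α) : M.evalFrom none w = none := by
  induction w with
  | nil => rfl
  | cons x w ih => rw [DFA.evalFrom_cons, hM.step_none, ih]

theorem evalFrom_inr (hM : ConvexDFA M) (f : Fin k) (w : List α) (i : Fin p) :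
    M.evalFrom (some (.inr f)) w ≠ some (.inl i) := by
  induction w generalizing f with
  | nil => simp
  | cons x w ih =>
    rw [DFA.evalFrom_cons]
    rcases h : M.step (some (.inr f)) x with _ | i' | f'
    · simp [hM.evalFrom_none]
    · exact absurd h (hM.step_inr f x i')
    · exact ih f'

theorem acceptsFrom_none (hM : ConvexDFA M) : M.acceptsFrom none = ⊥ := by
  ext w
  rw [DFA.mem_acceptsFrom, hM.evalFrom_none, hM.accept]
  simp only [reduceCtorEq, exists_false, false_iff]
  exact fun h => h

theorem nil_mem_acceptsFrom (hM : ConvexDFA M) (q : St p k) :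
    [] ∈ M.acceptsFrom q ↔ ∃ f, q = some (.inr f) := by
  rw [DFA.mem_acceptsFrom, DFA.evalFrom_nil, hM.accept]

theorem encard_accept (hM : ConvexDFA M) : M.accept.encard = k := by
  have : M.accept = Set.range fun f : Fin k => (some (Sum.inr f) : St p k) := by
    ext q
    rw [hM.accept]
    simp [eq_comm]
  rw [this, ← Set.image_univ, Function.Injective.encard_image (by intro a b; simp)]
  simp

/-- Convexity holds because between two final states a run can pass neither the sink nor another
non-final state. The hypotheses `h1` and `h2` refute prefix-freeness and the right ideal property;
prefix-closure fails since the initial state is not final but some final state is reachable. -/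
theorem kProperOfComplexity (hM : ConvexDFA M) (hmin : IsMinimalDFA M)
    (h1 : ∃ f x f', M.step (some (.inr f)) x = some (.inr f'))
    (h2 : ∃ f x, M.step (some (.inr f)) x = none) :
    KProperOfComplexity (p + k + 1) k M.accepts := by
  have mem : ∀ {w q}, M.eval w = q → (w ∈ M.accepts ↔ ∃ f, q = some (.inr f)) := by
    rintro w q rfl
    rw [DFA.mem_accepts, hM.accept]
  refine ⟨⟨⟨?_, ?_, ?_, ?_⟩, ?_⟩, ?_⟩
  · rintro u v w ⟨x, rfl⟩ ⟨y, rfl⟩ hu hw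
    obtain ⟨f, hf⟩ := (mem rfl).1 hu
    obtain ⟨g, hg⟩ := (mem rfl).1 hw
    rw [DFA.eval, DFA.evalFrom_of_append] at hg
    rw [mem rfl]
    rcases h : M.eval (u ++ x) with _ | i | f'
    · rw [DFA.eval] at h
      rw [h, hM.evalFrom_none] at hg
      exact absurd hg (by simp)
    · rw [DFA.eval] at h hf
      rw [DFA.evalFrom_of_append, hf] at h
      exact absurd h (hM.evalFrom_inr f x i)
    · exact ⟨f', rfl⟩
  · intro hR
    obtain ⟨f, x, hf⟩ := h2
    obtain ⟨w, hw⟩ := hmin.1 (some (.inr f))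
    have h := hR w (w ++ [x]) ⟨[x], rfl⟩ ((mem hw).2 ⟨f, rfl⟩)
    rw [mem (by rw [DFA.eval_append_singleton, hw, hf])] at h
    simp at h
  · intro hP
    obtain ⟨f, x, -⟩ := h2
    obtain ⟨w, hw⟩ := hmin.1 (some (.inr f))
    have h := hP [] w (List.nil_prefix) ((mem hw).2 ⟨f, rfl⟩)
    obtain ⟨i, hi⟩ := hM.start
    rw [mem (by rw [DFA.eval_nil, hi])] at h
    simp at h
  · intro hF
    obtain ⟨f, x, f', hf⟩ := h1
    obtain ⟨w, hw⟩ := hmin.1 (some (.inr f))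
    refine hF w (w ++ [x]) ⟨[x], rfl⟩ (by simp) ?_ ((mem hw).2 ⟨f, rfl⟩)
    rw [mem (by rw [DFA.eval_append_singleton, hw, hf])]
    exact ⟨f', rfl⟩
  · rw [← hM.encard_accept, ← Function.Injective.encard_image (fun a b => hmin.2 a b),
      quotients_accepts M hmin.1]
    congr 1
    ext Q
    constructor
    · rintro ⟨⟨q, rfl⟩, h⟩
      exact ⟨q, h, rfl⟩
    · rintro ⟨q, h, rfl⟩
      exact ⟨⟨q, rfl⟩, h⟩
  · rw [complexity, quotients_accepts M hmin.1, ← Set.image_univ,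
      Function.Injective.encard_image (fun a b => hmin.2 a b)]
    simp

end ConvexDFA

/-- If v ∈ K is a prefix of w ∉ K, an accepted extension of w would put w between two words of K. -/
theorem bot_mem_quotients {α : Type u} {K : Language α} (h : IsProperPrefixConvex K) :
    ⊥ ∈ quotients K := by
  obtain ⟨hc, hR, -, -⟩ := h
  rw [IsRightIdeal] at hR
  push Not at hR
  obtain ⟨v, w, hvw, hv, hw⟩ := hR
  refine ⟨w, ?_⟩
  ext x
  exact ⟨fun hx => hw (hc v w (w ++ x) hvw ⟨x, rfl⟩ hv hx), fun hx => hx.elim⟩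

/-- Reduces every upper bound to automata of one shape. The states are the quotients, split into ∅,
the final ones and the rest, and enumerated by `Fin`. -/
theorem exists_convexDFA {α : Type u} {p k : ℕ} {K : Language α}
    (hK : KProperOfComplexity (p + k + 1) k K) :
    ∃ M : DFA α (St p k), ConvexDFA M ∧ IsMinimalDFA M ∧ M.accepts = K := by
  obtain ⟨⟨hP, hF⟩, hn⟩ := hK
  have hbot := bot_mem_quotients hP
  obtain ⟨hc, hR, hcl, -⟩ := hP
  set Fs := {Q ∈ quotients K | [] ∈ Q} with hFs
  set Es := {Q ∈ quotients K | [] ∉ Q ∧ Q ≠ ⊥} with hEs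
  have hun : quotients K = insert ⊥ (Es ∪ Fs) := by
    ext Q
    simp only [hFs, hEs, Set.mem_insert_iff, Set.mem_union, Set.mem_ofPred_eq]
    constructor
    · intro h
      tauto
    · rintro (rfl | h | h)
      · exact hbot
      · exact h.1
      · exact h.1
  have hnb : (⊥ : Language α) ∉ Es ∪ Fs := by
    rintro (h | h)
    · exact h.2.2 rfl
    · exact h.2
  have hdis : Disjoint Es Fs := Set.disjoint_left.2 fun Q h h' => h.2.1 h'.2
  -- The remaining class has p elements: p + k + 1 minus ∅ and the k final quotients. Cancellation
  -- in `ℕ∞` is legitimate because the cancelled terms are finite.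
  have hE : Es.encard = p := by
    rw [complexity, hun, Set.encard_insert_of_notMem hnb, Set.encard_union_eq hdis, hF] at hn
    push_cast at hn
    have := ENat.add_left_injective_of_ne_top (n := 1) (by simp) hn
    exact ENat.add_left_injective_of_ne_top (ENat.natCast_ne_top k) this
  have fin : ∀ {S : Set (Language α)} {m : ℕ}, S.encard = m → Nonempty (Fin m ≃ S) := by
    intro S m h
    have hf : S.Finite := Set.finite_of_encard_eq_coe h
    have := hf.to_subtype
    exact ⟨(Finite.equivFinOfCardEq (by
      rw [Nat.card_coe_set_eq, Set.ncard, h]; rfl)).symm⟩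
  obtain ⟨eE⟩ := fin hE
  obtain ⟨eF⟩ := fin hF
  let ψ : St p k → Set.range K.leftQuotient := fun q => match q with
    | none => ⟨⊥, hbot⟩
    | some (.inl i) => ⟨(eE i).1, (eE i).2.1⟩
    | some (.inr f) => ⟨(eF f).1, (eF f).2.1⟩
  have hψ : Function.Bijective ψ := by
    constructor
    · rintro (_ | i | f) (_ | i' | f') h
      · rfl
      · exact absurd (congrArg Subtype.val h).symm (eE i').2.2.2
      · exact absurd (Set.mem_union_right _ (eF f').2) (by
          have := congrArg Subtype.val h
          simp only [ψ] at this
          rwa [← this])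
      · exact absurd (congrArg Subtype.val h) (eE i).2.2.2
      · have := congrArg Subtype.val h
        simp only [ψ] at this
        rw [eE.injective (Subtype.ext this)]
      · have := congrArg Subtype.val h
        simp only [ψ] at this
        exact absurd (this ▸ (eF f').2) (Set.disjoint_left.1 hdis (eE i).2)
      · exact absurd (Set.mem_union_right _ (eF f).2) (by
          have := congrArg Subtype.val h
          simp only [ψ] at this
          rwa [this])
      · have := congrArg Subtype.val h
        simp only [ψ] at this
        exact absurd (this ▸ (eF f).2) (Set.disjoint_left.1 hdis (eE i').2)
      · have := congrArg Subtype.val h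
        simp only [ψ] at this
        rw [eF.injective (Subtype.ext this)]
    · rintro ⟨Q, hQ⟩
      have hQ' : Q ∈ quotients K := hQ
      rw [hun] at hQ'
      rcases hQ' with rfl | h | h
      · exact ⟨none, rfl⟩
      · refine ⟨some (.inl (eE.symm ⟨Q, h⟩)), Subtype.ext ?_⟩
        simp [ψ]
      · refine ⟨some (.inr (eF.symm ⟨Q, h⟩)), Subtype.ext ?_⟩
        simp [ψ]
  let e := Equiv.ofBijective ψ hψ
  have he : ∀ q, e q = ψ q := fun _ => rfl
  have hfin : ∀ q, [] ∈ (ψ q).1 ↔ ∃ f, q = some (.inr f) := by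
    rintro (_ | i | f)
    · simp only [reduceCtorEq, exists_false, iff_false]
      exact fun h => h
    · simpa [ψ] using (eE i).2.2.1
    · simpa [ψ] using (eF f).2.2
  have hsink : ∀ q, (ψ q).1 = ⊥ ↔ q = none := by
    intro q
    rw [← hψ.1.eq_iff (b := none)]
    exact (Subtype.ext_iff (a2 := ψ none)).symm
  refine ⟨DFA.reindex e.symm K.toDFA, ⟨?_, ?_, ?_, ?_⟩, ⟨?_, ?_⟩, ?_⟩
  -- An initial sink would make K empty, and an initial final state would put the empty word in K,
  -- so that convexity makes K prefix-closed; both contradict `hcl`.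
  · rcases h : e.symm K.toDFA.start with _ | i | f
    · have h' : ψ none = K.toDFA.start := by rw [← h, ← he, e.apply_symm_apply]
      have h0 : K = ⊥ := (congrArg Subtype.val h').symm
      exact (hcl fun v w _ hw => by rw [h0] at hw; exact hw.elim).elim
    · exact ⟨i, h⟩
    · have h' : ψ (some (.inr f)) = K.toDFA.start := by rw [← h, ← he, e.apply_symm_apply]
      have h0 : [] ∈ K := by
        have : [] ∈ (ψ (some (.inr f))).1 := (hfin _).2 ⟨f, rfl⟩
        rwa [h'] at this
      exact (hcl fun v w hvw hw => hc [] v w List.nil_prefix hvw h0 hw).elim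
  · intro q
    rw [← hfin, ← he]
    simp [DFA.reindex]
  · intro x
    change e.symm (K.toDFA.step (e none) x) = none
    rw [Equiv.symm_apply_eq]
    apply Subtype.ext
    rw [Language.step_toDFA]
    change (⊥ : Language α).leftQuotient [x] = ⊥
    ext y
    exact Iff.rfl
  -- Such a transition would give w ∈ K, wx ∉ K and wxy ∈ K for some y, against convexity.
  · intro f x i h
    change e.symm (K.toDFA.step (e (some (.inr f))) x) = _ at h
    rw [Equiv.symm_apply_eq] at h
    have h2 := congrArg Subtype.val h
    rw [Language.step_toDFA] at h2
    obtain ⟨w, hw⟩ := (ψ (some (.inr f))).2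
    have hw2 : w ∈ K := by
      have := (hfin (some (.inr f))).2 ⟨f, rfl⟩
      rw [← hw, Language.mem_leftQuotient, List.append_nil] at this
      exact this
    rw [he, he, ← hw, ← Language.leftQuotient_append] at h2
    have hne : (ψ (some (.inl i))).1 ≠ ⊥ := fun hh => by simpa using (hsink (some (.inl i))).1 hh
    have hne2 : [] ∉ (ψ (some (.inl i))).1 := fun hh => by simpa using (hfin (some (.inl i))).1 hh
    rw [← h2] at hne hne2
    apply hne
    ext y
    refine ⟨fun hy => hne2 ?_, fun hy => hy.elim⟩
    rw [Language.mem_leftQuotient] at hy ⊢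
    rw [List.append_nil]
    exact hc w _ _ ⟨[x], rfl⟩ ⟨y, rfl⟩ hw2 hy
  · intro q
    obtain ⟨w, hw⟩ := (e q).2
    refine ⟨w, ?_⟩
    rw [DFA.eval_reindex, Equiv.symm_apply_eq]
    apply Subtype.ext
    rw [← hw]
    clear hw
    induction w using List.reverseRecOn with
    | nil => simp
    | append_singleton x a ih => simp [ih, Language.leftQuotient_append]
  · intro q r h
    apply e.injective
    apply Subtype.ext
    have key : ∀ q, (DFA.reindex e.symm K.toDFA).acceptsFrom q = (e q).1 := by
      intro q
      ext w
      rw [DFA.mem_acceptsFrom, DFA.evalFrom_reindex]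
      have : ∀ (s : Set.range K.leftQuotient), (K.toDFA.evalFrom s w).1 = s.1.leftQuotient w := by
        intro s
        induction w using List.reverseRecOn with
        | nil => simp
        | append_singleton x a ih => simp [ih, Language.leftQuotient_append]
      change [] ∈ (e (e.symm _)).1 ↔ _
      rw [e.apply_symm_apply, Equiv.symm_symm, this, Language.mem_leftQuotient, List.append_nil]
    rw [← key, ← key, h]
  · rw [DFA.accepts_reindex, Language.accepts_toDFA]

end PrefixConvex

namespace PrefixConvex

/-! ### The two permutations and their generation of the symmetric groups -/

/-- The fixed point of the long cycle of odd length on `Fin p`, if there is one, is `0`. -/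
def cycleStart (p : ℕ) : ℕ := if Even p then 1 else 0

/-- The cycle of odd length on `Fin p`. -/
def rot (p : ℕ) (i : Fin p) : Fin p :=
  ⟨cyc (cycleStart p) (p - 1) i, by have := i.2; unfold cyc; split_ifs <;> omega⟩

/-- The transposition of `0` and `1`, if these exist. -/
def tw (p : ℕ) (i : Fin p) : Fin p :=
  ⟨if 2 ≤ p then cyc 0 1 i else i, by have := i.2; unfold cyc; split_ifs <;> omega⟩

theorem rot_injective (p : ℕ) : Function.Injective (rot p) := by
  intro i j h
  have h := congrArg Fin.val h
  have hi := i.2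
  have hj := j.2
  apply Fin.ext
  simp only [rot, cyc] at h
  split_ifs at h <;> omega

theorem tw_tw (p : ℕ) (i : Fin p) : tw p (tw p i) = i := by
  have hi := i.2
  apply Fin.ext
  simp only [tw, cyc]
  split_ifs <;> omega

/-- `rot` as a permutation. -/
noncomputable def rotPerm (p : ℕ) : Equiv.Perm (Fin p) :=
  Equiv.ofBijective (rot p) (Finite.injective_iff_bijective.1 (rot_injective p))

/-- `tw` as a permutation. -/
def twPerm (p : ℕ) : Equiv.Perm (Fin p) := ⟨tw p, tw p, tw_tw p, tw_tw p⟩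

@[simp] theorem rotPerm_apply (p : ℕ) (i : Fin p) : rotPerm p i = rot p i := rfl

@[simp] theorem twPerm_apply (p : ℕ) (i : Fin p) : twPerm p i = tw p i := rfl

theorem twPerm_mul_self (p : ℕ) : twPerm p * twPerm p = 1 := by
  ext i
  simp [tw_tw]

theorem twPerm_pow_odd (p : ℕ) {l : ℕ} (hl : Odd l) : twPerm p ^ l = twPerm p := by
  obtain ⟨m, rfl⟩ := hl
  rw [pow_succ, pow_mul, pow_two, twPerm_mul_self, one_pow, one_mul]

/-- The exponent is the length p - `cycleStart p` of the cycle. Its oddness is the reason for the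
parity distinction in the letters: the corresponding power of the pair (cycle, transposition) is
(identity, transposition). -/
theorem exists_odd_rotPerm_pow (p : ℕ) [NeZero p] : ∃ l, Odd l ∧ rotPerm p ^ l = 1 := by
  have hp := NeZero.pos p
  have hodd : Odd (p - cycleStart p) := by
    unfold cycleStart
    split_ifs with h
    · exact Nat.Even.sub_odd hp h odd_one
    · simpa using h
  refine ⟨p - cycleStart p, hodd, ?_⟩
  have hl := hodd.pos
  -- The t-th power adds t modulo the length on the support of the cycle.
  have key : ∀ t (i : Fin p), ((rotPerm p ^ t) i).val =
      if cycleStart p ≤ i then cycleStart p + (i - cycleStart p + t) % (p - cycleStart p)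
      else i := by
    intro t i
    have hi := i.2
    induction t with
    | zero =>
      split_ifs with h
      · rw [add_zero, Nat.mod_eq_of_lt (by omega)]
        simp
        omega
      · simp
    | succ t ih =>
      rw [pow_succ', Equiv.Perm.mul_apply, rotPerm_apply]
      simp only [rot]
      rw [ih]
      split_ifs with h
      · have h1 := Nat.mod_lt (i - cycleStart p + t) hl
        rw [← add_assoc, Nat.add_mod (i - cycleStart p + t) 1]
        generalize (i.val - cycleStart p + t) % (p - cycleStart p) = r at h1 ⊢
        by_cases h2 : r + 1 = p - cycleStart p
        · have : (r + 1 % (p - cycleStart p)) % (p - cycleStart p) = 0 := by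
            rw [Nat.add_mod_mod, h2, Nat.mod_self]
          rw [this]
          simp only [cyc]
          split_ifs <;> omega
        · have : (r + 1 % (p - cycleStart p)) % (p - cycleStart p) = r + 1 := by
            rw [Nat.add_mod_mod, Nat.mod_eq_of_lt (by omega)]
          rw [this]
          simp only [cyc]
          split_ifs <;> omega
      · simp only [cyc]
        split_ifs <;> omega
  ext i
  rw [key]
  simp only [Equiv.Perm.coe_one, id_eq]
  split_ifs with h
  · rw [Nat.add_mod_right, Nat.mod_eq_of_lt (by omega)]
    omega
  · rfl

/-- Conjugating (0 1) repeatedly by an element that fixes 0 and shifts the other points gives all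
transpositions (0 i), and these generate all transpositions. -/
theorem submonoid_eq_top_of_rot_tw {p : ℕ} (S : Submonoid (Equiv.Perm (Fin p)))
    (hr : rotPerm p ∈ S) (ht : twPerm p ∈ S) : S = ⊤ := by
  rcases lt_or_ge p 2 with hp | hp
  · have : Subsingleton (Fin p) := Fin.subsingleton_iff_le_one.2 (by omega)
    rw [eq_top_iff]
    intro x _
    rw [Subsingleton.elim x 1]
    exact S.one_mem
  -- In a finite group inverses are powers, so words without inverse letters suffice.
  have hinv : ∀ x ∈ S, x⁻¹ ∈ S := by
    intro x hx
    have : x⁻¹ = x ^ (orderOf x - 1) := by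
      rw [inv_eq_iff_mul_eq_one, ← pow_succ', Nat.sub_add_cancel (orderOf_pos x), pow_orderOf_eq_one]
    rw [this]
    exact S.pow_mem hx _
  let z : Fin p := ⟨0, by omega⟩
  -- For even p the cycle already fixes 0; for odd p it sends 0 to 1, and the transposition applied
  -- afterwards corrects this without touching the points above 1.
  obtain ⟨σ, hσ, hσ0, hσi⟩ : ∃ σ ∈ S, σ z = z ∧
      ∀ (i : ℕ) (h : i + 1 < p), 1 ≤ i → σ ⟨i, by omega⟩ = ⟨i + 1, h⟩ := by
    by_cases he : Even p
    · refine ⟨rotPerm p, hr, ?_, ?_⟩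
      · apply Fin.ext
        simp [rot, cyc, cycleStart, he, z]
        omega
      · intro i h hi
        apply Fin.ext
        simp only [rotPerm_apply, rot, cyc, cycleStart, he, if_true]
        split_ifs <;> omega
    · refine ⟨twPerm p * rotPerm p, S.mul_mem ht hr, ?_, ?_⟩
      · apply Fin.ext
        simp only [Equiv.Perm.mul_apply, rotPerm_apply, twPerm_apply, rot, tw, cyc, cycleStart, he,
          if_false, z]
        split_ifs <;> omega
      · intro i h hi
        apply Fin.ext
        simp only [Equiv.Perm.mul_apply, rotPerm_apply, twPerm_apply, rot, tw, cyc, cycleStart, he,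
          if_false]
        split_ifs <;> omega
  have h0 : ∀ (i : ℕ) (h : i + 1 < p), Equiv.swap z ⟨i + 1, h⟩ ∈ S := by
    intro i
    induction i with
    | zero =>
      intro h
      convert ht using 1
      ext j
      rw [Equiv.swap_apply_def, twPerm_apply]
      simp only [tw, cyc, hp, if_true, z, Fin.ext_iff]
      split_ifs <;> (try dsimp only) <;> omega
    | succ i ih =>
      intro h
      have h1 := ih (by omega)
      have h2 := Equiv.swap_apply_apply σ z ⟨i + 1, by omega⟩
      rw [hσ0, hσi (i + 1) h (by omega)] at h2
      rw [h2]
      exact S.mul_mem (S.mul_mem hσ h1) (hinv _ hσ)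
  have h1 : ∀ i : Fin p, Equiv.swap z i ∈ S := by
    rintro ⟨i, hi⟩
    rcases i with _ | i
    · rw [show (⟨0, hi⟩ : Fin p) = z from rfl, Equiv.swap_self]
      exact S.one_mem
    · exact h0 i hi
  rw [eq_top_iff, ← Equiv.Perm.mclosure_isSwap, Submonoid.closure_le]
  rintro _ ⟨x, y, hxy, rfl⟩
  by_cases hx : x = z
  · rw [hx]
    exact h1 y
  by_cases hy : y = z
  · rw [hy, Equiv.swap_comm]
    exact h1 x
  have h3 := Equiv.swap_mul_swap_mul_swap (x := y) (y := z) (z := x) hy (Ne.symm hxy)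
  rw [SetLike.mem_coe, ← h3]
  exact S.mul_mem (S.mul_mem (h1 x) (by rw [Equiv.swap_comm]; exact h1 y)) (h1 x)

/-- `true` stands for the long cycle and `false` for the transposition. -/
noncomputable def gen (p : ℕ) (b : Bool) : Equiv.Perm (Fin p) := if b then rotPerm p else twPerm p

/-- The permutation of a word in the two generators, read from left to right. -/
noncomputable def permOf (p : ℕ) (w : List Bool) : Equiv.Perm (Fin p) :=
  w.foldl (fun π b => gen p b * π) 1

theorem foldl_gen (p : ℕ) (w : List Bool) (π : Equiv.Perm (Fin p)) :
    w.foldl (fun π b => gen p b * π) π = permOf p w * π := by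
  induction w using List.reverseRecOn with
  | nil => simp [permOf]
  | append_singleton w b ih => simp [permOf, mul_assoc] at ih ⊢; rw [ih]

theorem permOf_append (p : ℕ) (u v : List Bool) : permOf p (u ++ v) = permOf p v * permOf p u := by
  rw [permOf, List.foldl_append, foldl_gen]
  rfl

theorem permOf_cons (p : ℕ) (b : Bool) (v : List Bool) :
    permOf p (b :: v) = permOf p v * gen p b := by
  rw [permOf, List.foldl_cons, foldl_gen, mul_one]

/-- The two permutations `(rot, tw)` and `(tw, rot)` generate the product of two symmetric
groups. -/
theorem exists_permOf (p k : ℕ) [NeZero p] [NeZero k] (π : Equiv.Perm (Fin p))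
    (ρ : Equiv.Perm (Fin k)) : ∃ w, permOf p w = π ∧ permOf k (w.map not) = ρ := by
  let S : Submonoid (Equiv.Perm (Fin p) × Equiv.Perm (Fin k)) :=
    { carrier := {x | ∃ w, permOf p w = x.1 ∧ permOf k (w.map not) = x.2}
      one_mem' := ⟨[], rfl, rfl⟩
      mul_mem' := by
        rintro x y ⟨u, hu1, hu2⟩ ⟨v, hv1, hv2⟩
        refine ⟨v ++ u, ?_, ?_⟩
        · rw [permOf_append, hu1, hv1]; rfl
        · rw [List.map_append, permOf_append, hu2, hv2]; rfl }
  have hA : (rotPerm p, twPerm k) ∈ S := ⟨[true], by simp [permOf, gen], by simp [permOf, gen]⟩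
  have hB : (twPerm p, rotPerm k) ∈ S := ⟨[false], by simp [permOf, gen], by simp [permOf, gen]⟩
  -- Odd powers separate the blocks: they turn (cycle, transposition) into (1, transposition), and
  -- multiplying by this again leaves (cycle, 1).
  obtain ⟨l, hl, hl1⟩ := exists_odd_rotPerm_pow p
  obtain ⟨m, hm, hm1⟩ := exists_odd_rotPerm_pow k
  have hA1 : (1, twPerm k) ∈ S := by
    simpa [hl1, twPerm_pow_odd k hl] using S.pow_mem hA l
  have hB1 : (twPerm p, 1) ∈ S := by
    simpa [hm1, twPerm_pow_odd p hm] using S.pow_mem hB m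
  have hA2 : (rotPerm p, 1) ∈ S := by
    simpa [twPerm_mul_self] using S.mul_mem hA hA1
  have hB2 : (1, rotPerm k) ∈ S := by
    simpa [twPerm_mul_self] using S.mul_mem hB hB1
  have h1 := submonoid_eq_top_of_rot_tw (S.comap (MonoidHom.inl _ _)) hA2 hB1
  have h2 := submonoid_eq_top_of_rot_tw (S.comap (MonoidHom.inr _ _)) hB2 hA1
  have h3 : (π, ρ) ∈ S := by
    have e1 : π ∈ S.comap (MonoidHom.inl _ _) := by rw [h1]; trivial
    have e2 : ρ ∈ S.comap (MonoidHom.inr _ _) := by rw [h2]; trivial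
    simpa using S.mul_mem (Submonoid.mem_comap.1 e1) (Submonoid.mem_comap.1 e2)
  exact h3

end PrefixConvex

namespace PrefixConvex

/-! ### The witness automata on `Option (Fin p ⊕ Fin k)` -/

/-- The transformation `1 → 0`. -/
def mergeFin (p : ℕ) (i : Fin p) : Fin p :=
  ⟨if 2 ≤ p then send 1 0 i else i, by have := i.2; unfold send; split_ifs <;> omega⟩

/-- The transformation `i → i + 1`, undefined for the last element. -/
def shiftFin (p : ℕ) (i : Fin p) : Option (Fin p) :=
  if h : i.val + 1 < p then some ⟨i + 1, h⟩ else none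

/-- The transformations of the letters. -/
def stepW (p k : ℕ) [NeZero p] [NeZero k] : St p k → Letter → St p k
  | none, _ => none
  | some (.inl i), .a => some (.inl (rot p i))
  | some (.inl i), .b => some (.inl (tw p i))
  | some (.inl i), .c₁ => some (.inl (mergeFin p i))
  | some (.inl i), .c₂ => some (.inl i)
  | some (.inl i), .d₁ => (shiftFin p i).map .inl
  | some (.inl i), .d₂ => some (.inl i)
  | some (.inl i), .e => some (if i = 0 then .inr 0 else .inl i)
  | some (.inr f), .a => some (.inr (tw k f))
  | some (.inr f), .b => some (.inr (rot k f))
  | some (.inr f), .c₁ => some (.inr f)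
  | some (.inr f), .c₂ => some (.inr (mergeFin k f))
  | some (.inr f), .d₁ => some (.inr f)
  | some (.inr f), .d₂ => (shiftFin k f).map .inr
  | some (.inr f), .e => some (.inr f)

/-- The automaton `𝒟_{p + k + 1, k}`, with the states arranged in blocks. -/
def W (p k : ℕ) [NeZero p] [NeZero k] : DFA Letter (St p k) where
  step := stepW p k
  start := some (.inl 0)
  accept := {q | ∃ f, q = some (.inr f)}

/-- The states of the two arrangements correspond. -/
def toFin (p k : ℕ) : St p k → Fin (p + k + 1)
  | none => ⟨p + k, by omega⟩
  | some (.inl i) => ⟨i, by omega⟩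
  | some (.inr f) => ⟨p + f, by omega⟩

theorem toFin_bijective (p k : ℕ) : Function.Bijective (toFin p k) := by
  rw [Fintype.bijective_iff_injective_and_card]
  refine ⟨?_, by simp⟩
  rintro (_ | i | f) (_ | i' | f') h <;> have h := congrArg Fin.val h <;>
    simp only [toFin] at h
  · rfl
  · omega
  · omega
  · omega
  · rw [Fin.ext h]
  · omega
  · omega
  · omega
  · rw [Fin.ext (by omega : f.val = f'.val)]

/-- The two arrangements of the states. -/
noncomputable def stEquiv (p k : ℕ) : St p k ≃ Fin (p + k + 1) :=
  Equiv.ofBijective _ (toFin_bijective p k)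

@[simp] theorem stEquiv_apply (p k : ℕ) (q : St p k) : stEquiv p k q = toFin p k q := rfl

theorem action_toFin (p k : ℕ) [NeZero p] [NeZero k] (q : St p k) (x : Letter) :
    action (p + k + 1) k x (toFin p k q) = toFin p k (stepW p k q x) := by
  have hp := NeZero.pos p
  have hk := NeZero.pos k
  have e1 : p + k + 1 - 1 - k = p := by omega
  rcases q with _ | i | f
  -- The number of the state is replaced by a variable with a linear description, so that the cases
  -- of `action` reduce to linear arithmetic.
  · obtain ⟨v, hv⟩ : ∃ v, v = (toFin p k none).val := ⟨_, rfl⟩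
    have hv' : v = p + k := hv
    rw [← hv]
    cases x <;> simp only [action, stepW, cyc, send] <;> rw [← hv] <;>
      (repeat' split) <;> omega
  · have hi := i.2
    obtain ⟨v, hv⟩ : ∃ v, v = (toFin p k (some (.inl i))).val := ⟨_, rfl⟩
    have hv' : v = i := hv
    rw [← hv]
    clear hv
    cases x <;> simp only [action, stepW]
    · simp only [toFin, rot, cycleStart, cyc, e1]; (repeat' split) <;> omega
    · simp only [toFin, tw, cyc]; (repeat' split) <;> omega
    · simp only [toFin, mergeFin, send]; (repeat' split) <;> omega
    · simp only [toFin, send]; (repeat' split) <;> omega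
    · by_cases h : i.val + 1 < p
      · simp only [toFin, shiftFin, h, dite_true, Option.map_some]
        (repeat' split) <;> omega
      · simp only [toFin, shiftFin, h, dite_false, Option.map_none]
        (repeat' split) <;> omega
    · simp only [toFin]; (repeat' split) <;> omega
    · by_cases h : i = 0
      · subst h; simp [toFin, send, hv']
      · have : i.val ≠ 0 := fun h' => h (Fin.ext h')
        simp [h, toFin, send, hv', this]
  · have hf := f.2
    obtain ⟨v, hv⟩ : ∃ v, v = (toFin p k (some (.inr f))).val := ⟨_, rfl⟩
    have hv' : v = p + f := hv
    rw [← hv]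
    clear hv
    cases x <;> simp only [action, stepW]
    · simp only [toFin, tw, cyc]; (repeat' split) <;> omega
    · simp only [toFin, rot, cycleStart, cyc, e1]; (repeat' split) <;> omega
    · simp only [toFin, send]; (repeat' split) <;> omega
    · simp only [toFin, mergeFin, send]; (repeat' split) <;> omega
    · simp only [toFin]; (repeat' split) <;> omega
    · by_cases h : f.val + 1 < k
      · simp only [toFin, shiftFin, h, dite_true, Option.map_some]
        (repeat' split) <;> omega
      · simp only [toFin, shiftFin, h, dite_false, Option.map_none]
        (repeat' split) <;> omega
    · simp only [toFin, send]; (repeat' split) <;> omega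

/-- Lets all arguments be made on the block arrangement `W`, where sink, non-final and final states
are constructors. -/
theorem D_eq_reindex (p k : ℕ) [NeZero p] [NeZero k] (hn : 3 ≤ p + k + 1) :
    D (p + k + 1) k hn = DFA.reindex (stEquiv p k) (W p k) := by
  have hstep : (D (p + k + 1) k hn).step = (DFA.reindex (stEquiv p k) (W p k)).step := by
    funext q x
    obtain ⟨s, rfl⟩ := (stEquiv p k).surjective q
    change dite _ _ _ = stEquiv p k ((W p k).step ((stEquiv p k).symm (stEquiv p k s)) x)
    rw [Equiv.symm_apply_apply]
    simp only [stEquiv_apply, action_toFin, Fin.is_lt, dite_true]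
    rfl
  have hstart : (D (p + k + 1) k hn).start = (DFA.reindex (stEquiv p k) (W p k)).start := by
    apply Fin.ext
    change 0 = (toFin p k (some (.inl 0))).val
    simp [toFin]
  have hacc : (D (p + k + 1) k hn).accept = (DFA.reindex (stEquiv p k) (W p k)).accept := by
    ext q
    obtain ⟨s, rfl⟩ := (stEquiv p k).surjective q
    change toFin p k s ∈ (F (p + k + 1) k : Set _) ↔
      (stEquiv p k).symm (stEquiv p k s) ∈ (W p k).accept
    rw [Equiv.symm_apply_apply]
    rcases s with _ | i | f
    · simp [F, toFin, W]
    · simp [F, toFin, W]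
    · simp [F, toFin, W]
  cases h1 : D (p + k + 1) k hn
  cases h2 : DFA.reindex (stEquiv p k) (W p k)
  rw [h1, h2] at hstep hstart hacc
  simp only at hstep hstart hacc
  rw [hstep, hstart, hacc]

theorem W_convex (p k : ℕ) [NeZero p] [NeZero k] : ConvexDFA (W p k) where
  start := ⟨0, rfl⟩
  accept _ := Iff.rfl
  step_none _ := rfl
  step_inr f x i := by
    cases x <;> simp only [W, stepW, shiftFin] <;> (try split_ifs) <;> simp

theorem ConvexDFA.comap {α β : Type u} {p k : ℕ} {M : DFA α (St p k)} (hM : ConvexDFA M)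
    (ρ : β → α) : ConvexDFA (M.comap ρ) where
  start := hM.start
  accept := hM.accept
  step_none x := hM.step_none (ρ x)
  step_inr f x := hM.step_inr f (ρ x)

/-! ### Transformations realized by words -/

/-- Some word over `A` induces the transformation `t`. -/
def Realizes {α σ : Type*} (M : DFA α σ) (A : Set α) (t : σ → σ) : Prop :=
  ∃ w, (∀ x ∈ w, x ∈ A) ∧ ∀ q, M.evalFrom q w = t q

namespace Realizes

variable {α σ : Type*} {M : DFA α σ} {A : Set α} {s t : σ → σ}

theorem id : Realizes M A id := ⟨[], by simp, fun _ => rfl⟩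

theorem comp (hs : Realizes M A s) (ht : Realizes M A t) : Realizes M A (s ∘ t) := by
  obtain ⟨u, hu, hu'⟩ := hs
  obtain ⟨v, hv, hv'⟩ := ht
  refine ⟨v ++ u, fun x hx => (List.mem_append.1 hx).elim (hv x) (hu x), fun q => ?_⟩
  rw [DFA.evalFrom_of_append, hv', hu', Function.comp_apply]

theorem letter {x : α} (hx : x ∈ A) : Realizes M A (fun q => M.step q x) :=
  ⟨[x], by simpa using hx, fun _ => rfl⟩

/-- The word is lifted letter by letter; its letters are in A and hence in the range of ρ. -/
theorem comap {β : Type*} {ρ : β → α} (hs : Realizes M A s) (h : A ⊆ Set.range ρ) :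
    Realizes (M.comap ρ) (ρ ⁻¹' A) s := by
  obtain ⟨u, hu, hu'⟩ := hs
  choose g hg using fun x : A => h x.2
  refine ⟨u.attach.map fun x => g ⟨x.1, hu x.1 x.2⟩, ?_, fun q => ?_⟩
  · simp only [List.mem_map, List.mem_attach, true_and]
    rintro _ ⟨x, rfl⟩
    rw [Set.mem_preimage, hg]
    exact hu x.1 x.2
  · rw [DFA.evalFrom_comap, List.map_map]
    convert hu' q
    conv_rhs => rw [← List.attach_map_subtype_val u]
    exact List.map_congr_left fun x _ => hg _

variable [DecidableEq σ]

/-- A transformation is a product of transformations that move one point each if no moved point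
is moved to another one. -/
theorem of_sends (X : Finset σ)
    (h : ∀ x ∈ X, t x ≠ x → t x ∉ X ∧ Realizes M A (Function.update _root_.id x (t x)))
    (hX : ∀ x ∉ X, t x = x) : Realizes M A t := by
  induction X using Finset.induction_on generalizing t with
  | empty =>
    rw [show t = _root_.id from funext fun x => hX x (by simp)]
    exact Realizes.id
  | insert a X ha ih =>
    by_cases hta : t a = a
    · refine ih (fun x hx hxt => ?_) fun x hx => ?_
      · obtain ⟨h1, h2⟩ := h x (by simp [hx]) hxt
        exact ⟨fun h' => h1 (by simp [h']), h2⟩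
      · by_cases hxa : x = a
        · rw [hxa, hta]
        · exact hX x (by simp [hx, hxa])
    · obtain ⟨h1, h2⟩ := h a (by simp) hta
      -- The point a is moved first. Its image lies outside the set of points to be moved, so the
      -- other moves do not disturb it.
      have h3 : Realizes M A (Function.update t a a) := by
        refine ih (fun x hx hxt => ?_) fun x hx => ?_
        · have hxa : x ≠ a := fun h => ha (h ▸ hx)
          rw [Function.update_of_ne hxa] at hxt ⊢
          obtain ⟨h1, h2⟩ := h x (by simp [hx]) hxt
          exact ⟨fun h' => h1 (by simp [h']), h2⟩
        · by_cases hxa : x = a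
          · simp [hxa]
          · rw [Function.update_of_ne hxa]
            exact hX x (by simp [hx, hxa])
      convert h3.comp h2 using 1
      funext x
      by_cases hxa : x = a
      · subst hxa
        rw [Function.comp_apply, Function.update_self, Function.update_of_ne hta, hX _ h1]
      · simp [Function.update_of_ne hxa]

/-- Permutations of `X` and the transformations that move one point of `X` generate all
transformations that move only points of `X`. -/
theorem of_perms_of_sends [Finite σ] (X : Finset σ) (V : Set σ) (hXV : ∀ x ∈ X, x ∈ V)
    (h1 : ∀ e : Equiv.Perm σ, (∀ x ∉ X, e x = x) → Realizes M A e)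
    (h2 : ∀ x ∈ X, ∀ y ∈ V, Realizes M A (Function.update _root_.id x y))
    (hX : ∀ x ∉ X, t x = x) (hV : ∀ x ∈ X, t x ∈ V) : Realizes M A t := by
  -- The induction is on the number of points of X that t misses; if there are none, t is a
  -- permutation.
  induction hc : (X \ X.image t).card using Nat.strong_induction_on generalizing t with
  | _ c ih =>
    by_cases hsub : X ⊆ X.image t
    · have hs : Function.Surjective t := by
        intro y
        by_cases hy : y ∈ X
        · obtain ⟨x, -, hx⟩ := Finset.mem_image.1 (hsub hy)
          exact ⟨x, hx⟩
        · exact ⟨y, hX y hy⟩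
      exact h1 (Equiv.ofBijective t (Finite.surjective_iff_bijective.1 hs)) hX
    · obtain ⟨z, hz, hzt⟩ := Finset.not_subset.1 hsub
      -- Pigeonhole: t cannot map X injectively into X without z, so some value leaves X or is taken
      -- twice.
      obtain ⟨x, hx, hx'⟩ : ∃ x ∈ X, t x ∉ X ∨ ∃ x' ∈ X, x' ≠ x ∧ t x' = t x := by
        by_contra! hcon
        obtain ⟨x, hx, y, hy, hxy, hxy'⟩ :=
          Finset.exists_ne_map_eq_of_card_lt_of_maps_to (s := X) (t := X.erase z) (f := t)
            (Finset.card_erase_lt_of_mem hz) (fun x hx =>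
              Finset.mem_erase.2 ⟨fun h => hzt (Finset.mem_image.2 ⟨x, hx, h⟩), (hcon x hx).1⟩)
        exact (hcon y hy).2 x hx hxy hxy'
      -- Redirecting x to the missed point z loses no value in X and gains z. Moving z to t x
      -- afterwards restores t, since only x was sent to z.
      have h3 : Realizes M A (Function.update t x z) := by
        refine ih _ ?_ ?_ ?_ rfl
        · rw [← hc]
          refine Finset.card_lt_card ((Finset.ssubset_iff_of_subset ?_).2 ⟨z, ?_, ?_⟩)
          · intro y hy
            rw [Finset.mem_sdiff, Finset.mem_image] at hy ⊢
            refine ⟨hy.1, ?_⟩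
            rintro ⟨v, hv, rfl⟩
            by_cases hvx : v = x
            · subst hvx
              rcases hx' with h | ⟨x', hx1, hx2, hx3⟩
              · exact h hy.1
              · exact hy.2 ⟨x', hx1, by rw [Function.update_of_ne hx2, hx3]⟩
            · exact hy.2 ⟨v, hv, Function.update_of_ne hvx _ _⟩
          · exact Finset.mem_sdiff.2 ⟨hz, hzt⟩
          · intro h
            exact (Finset.mem_sdiff.1 h).2 (Finset.mem_image.2 ⟨x, hx, Function.update_self _ _ _⟩)
        · intro y hy
          rw [Function.update_of_ne (by rintro rfl; exact hy hx), hX y hy]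
        · intro y hy
          by_cases hyx : y = x
          · rw [hyx, Function.update_self]
            exact hXV z hz
          · rw [Function.update_of_ne hyx]
            exact hV y hy
      convert (h2 z hz (t x) (hV x hx)).comp h3 using 1
      funext y
      by_cases hyx : y = x
      · rw [hyx, Function.comp_apply, Function.update_self, Function.update_self]
      · have : t y ≠ z := by
          by_cases hy : y ∈ X
          · exact fun h => hzt (Finset.mem_image.2 ⟨y, hy, h⟩)
          · rw [hX y hy]
            exact fun h => hy (h ▸ hz)
        rw [Function.comp_apply, Function.update_of_ne hyx, Function.update_of_ne this]
        rfl

theorem update_conj {x y : σ} {e : Equiv.Perm σ}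
    (hs : Realizes M A (Function.update _root_.id x y))
    (he : Realizes M A e) (he' : Realizes M A e.symm) :
    Realizes M A (Function.update _root_.id (e x) (e y)) := by
  convert (he.comp hs).comp he' using 1
  funext z
  by_cases hz : z = e x
  · simp [hz]
  · have : e.symm z ≠ x := fun h => hz (by rw [← h, e.apply_symm_apply])
    simp [hz, this]

end Realizes

end PrefixConvex

namespace PrefixConvex

/-- The permutation of the states that acts on the two blocks by `π` and `ρ`. -/
def blockPerm {p k : ℕ} (π : Equiv.Perm (Fin p)) (ρ : Equiv.Perm (Fin k)) : Equiv.Perm (St p k) :=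
  Equiv.optionCongr (Equiv.sumCongr π ρ)

section blockPerm

variable {p k : ℕ} (π : Equiv.Perm (Fin p)) (ρ : Equiv.Perm (Fin k))

@[simp] theorem blockPerm_none : blockPerm π ρ none = none := rfl

@[simp] theorem blockPerm_inl (i : Fin p) : blockPerm π ρ (some (.inl i)) = some (.inl (π i)) := rfl

@[simp] theorem blockPerm_inr (f : Fin k) : blockPerm π ρ (some (.inr f)) = some (.inr (ρ f)) := rfl

theorem blockPerm_symm : (blockPerm π ρ).symm = blockPerm π⁻¹ ρ⁻¹ := by
  ext1 q
  rcases q with _ | i | f <;> rfl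

end blockPerm

/-- A letter that acts by `gen` on both blocks is a generator of their permutations. -/
theorem evalFrom_blockPerm {α : Type*} {p k : ℕ} {M : DFA α (St p k)} {g : Bool → α}
    (h : ∀ b q, M.step q (g b) = blockPerm (gen p b) (gen k (!b)) q) (w : List Bool) (q : St p k) :
    M.evalFrom q (w.map g) = blockPerm (permOf p w) (permOf k (w.map not)) q := by
  induction w generalizing q with
  | nil => rcases q with _ | i | f <;> simp [permOf]
  | cons b w ih =>
    rw [List.map_cons, DFA.evalFrom_cons, ih, h]
    rcases q with _ | i | f <;> simp [permOf_cons]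

/-- The two letters that act by permutations. -/
def ab (b : Bool) : Letter := if b then .a else .b

/-! ### One-point moves available over subalphabets -/

section W

variable {p k : ℕ} [NeZero p] [NeZero k]

theorem W_step_ab (b : Bool) (q : St p k) :
    (W p k).step q (ab b) = blockPerm (gen p b) (gen k (!b)) q := by
  cases b <;> rcases q with _ | i | f <;> simp [ab, gen, W, stepW]

theorem realizes_blockPerm {A : Set Letter} (ha : Letter.a ∈ A) (hb : Letter.b ∈ A)
    (π : Equiv.Perm (Fin p)) (ρ : Equiv.Perm (Fin k)) : Realizes (W p k) A (blockPerm π ρ) := by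
  obtain ⟨w, rfl, rfl⟩ := exists_permOf p k π ρ
  refine ⟨w.map ab, ?_, fun q => evalFrom_blockPerm W_step_ab w q⟩
  simp only [List.mem_map]
  rintro _ ⟨b, -, rfl⟩
  cases b
  · exact hb
  · exact ha

/-- The shift is a cyclic rotation except that the last point is lost. Undoing the rotation by a
word over a and b turns the letters d₁ and d₂ into moves of one point to the sink. -/
theorem exists_perm_shiftFin (p : ℕ) [NeZero p] : ∃ (γ : Equiv.Perm (Fin p)) (l : Fin p),
    ∀ i, shiftFin p i = if i = l then none else some (γ i) := by
  obtain ⟨p, rfl⟩ : ∃ r, p = r + 1 := ⟨p - 1, (Nat.succ_pred_eq_of_pos (NeZero.pos p)).symm⟩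
  refine ⟨finRotate (p + 1), Fin.last p, fun i => ?_⟩
  unfold shiftFin
  have hi := i.2
  by_cases h : i = Fin.last p
  · simp [h]
  · have h' : i.val + 1 < p + 1 := by
      have : i.val ≠ p := fun hh => h (Fin.ext hh)
      omega
    rw [dif_pos h', if_neg h]
    congr 1
    apply Fin.ext
    rw [coe_finRotate_of_ne_last h]

variable {A : Set Letter} (ha : Letter.a ∈ A) (hb : Letter.b ∈ A)

include ha hb

/-- By conjugation one letter supplies its whole orbit of one-point moves under block permutations.
-/
theorem realizes_send_of_send {x y : St p k} (h : Realizes (W p k) A (Function.update id x y))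
    (π : Equiv.Perm (Fin p)) (ρ : Equiv.Perm (Fin k)) :
    Realizes (W p k) A (Function.update id (blockPerm π ρ x) (blockPerm π ρ y)) :=
  h.update_conj (realizes_blockPerm ha hb π ρ)
    (by rw [blockPerm_symm]; exact realizes_blockPerm ha hb _ _)

theorem realizes_inr_none (hd : Letter.d₂ ∈ A) (f : Fin k) :
    Realizes (W p k) A (Function.update id (some (.inr f)) none) := by
  obtain ⟨γ, l, hγ⟩ := exists_perm_shiftFin k
  have h : Realizes (W p k) A (Function.update id (some (.inr l)) none) := by
    convert (realizes_blockPerm ha hb 1 γ⁻¹).comp (Realizes.letter hd) using 1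
    funext q
    rcases q with _ | i | g
    · simp [W, stepW]
    · simp [W, stepW]
    · by_cases hg : g = l <;> simp [W, stepW, hγ, hg]
  simpa using realizes_send_of_send ha hb h 1 (Equiv.swap l f)

theorem realizes_inl_none (hd : Letter.d₁ ∈ A) (i : Fin p) :
    Realizes (W p k) A (Function.update id (some (.inl i)) none) := by
  obtain ⟨γ, l, hγ⟩ := exists_perm_shiftFin p
  have h : Realizes (W p k) A (Function.update id (some (.inl l)) none) := by
    convert (realizes_blockPerm ha hb γ⁻¹ 1).comp (Realizes.letter hd) using 1
    funext q
    rcases q with _ | i | g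
    · simp [W, stepW]
    · by_cases hg : i = l <;> simp [W, stepW, hγ, hg]
    · simp [W, stepW]
  simpa using realizes_send_of_send ha hb h (Equiv.swap l i) 1

theorem realizes_inl_inr (he : Letter.e ∈ A) (i : Fin p) (f : Fin k) :
    Realizes (W p k) A (Function.update id (some (.inl i)) (some (.inr f))) := by
  have h : Realizes (W p k) A (Function.update id (some (.inl 0)) (some (.inr 0))) := by
    convert Realizes.letter (M := W p k) he using 1
    funext q
    rcases q with _ | i | g
    · simp [W, stepW]
    · by_cases hg : i = 0 <;> simp [W, stepW, hg]
    · simp [W, stepW]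
  simpa using realizes_send_of_send ha hb h (Equiv.swap 0 i) (Equiv.swap 0 f)

omit ha hb in
theorem exists_perm_pair {p : ℕ} {x y i j : Fin p} (hxy : x ≠ y) (hij : i ≠ j) :
    ∃ π : Equiv.Perm (Fin p), π x = i ∧ π y = j := by
  refine ⟨Equiv.swap (Equiv.swap x i y) j * Equiv.swap x i, ?_, ?_⟩
  · rw [Equiv.Perm.mul_apply, Equiv.swap_apply_left, Equiv.swap_apply_of_ne_of_ne _ hij]
    intro h
    exact hxy ((Equiv.swap x i).injective (by rw [Equiv.swap_apply_left]; exact h))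
  · simp

theorem realizes_inl_inl (hc : Letter.c₁ ∈ A) (i j : Fin p) :
    Realizes (W p k) A (Function.update id (some (.inl i)) (some (.inl j))) := by
  by_cases hij : i = j
  · subst hij
    convert Realizes.id using 1
    exact Function.update_eq_self _ _
  have hp : 2 ≤ p := by
    have := Fin.val_ne_of_ne hij
    omega
  have h : Realizes (W p k) A
      (Function.update id (some (.inl ⟨1, hp⟩)) (some (.inl ⟨0, by omega⟩))) := by
    convert Realizes.letter (M := W p k) hc using 1
    funext q
    rcases q with _ | i | g
    · simp [W, stepW]
    · by_cases hg : i = ⟨1, hp⟩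
      · simp [W, stepW, hg, mergeFin, hp, send]
      · have : i.val ≠ 1 := fun h => hg (Fin.ext h)
        simp [W, stepW, hg, mergeFin, send, this]
    · simp [W, stepW]
  obtain ⟨π, h1, h2⟩ := exists_perm_pair (x := ⟨1, hp⟩) (y := ⟨0, by omega⟩) (by simp) hij
  have h3 := realizes_send_of_send ha hb h π 1
  rwa [blockPerm_inl, blockPerm_inl, h1, h2] at h3

theorem realizes_inr_inr (hc : Letter.c₂ ∈ A) (i j : Fin k) :
    Realizes (W p k) A (Function.update id (some (.inr i)) (some (.inr j))) := by
  by_cases hij : i = j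
  · subst hij
    convert Realizes.id using 1
    exact Function.update_eq_self _ _
  have hk : 2 ≤ k := by
    have := Fin.val_ne_of_ne hij
    omega
  have h : Realizes (W p k) A
      (Function.update id (some (.inr ⟨1, hk⟩)) (some (.inr ⟨0, by omega⟩))) := by
    convert Realizes.letter (M := W p k) hc using 1
    funext q
    rcases q with _ | i | g
    · simp [W, stepW]
    · simp [W, stepW]
    · by_cases hg : g = ⟨1, hk⟩
      · simp [W, stepW, hg, mergeFin, hk, send]
      · have : g.val ≠ 1 := fun h => hg (Fin.ext h)
        simp [W, stepW, hg, mergeFin, send, this]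
  obtain ⟨π, h1, h2⟩ := exists_perm_pair (x := ⟨1, hk⟩) (y := ⟨0, by omega⟩) (by simp) hij
  have h3 := realizes_send_of_send ha hb h 1 π
  rwa [blockPerm_inr, blockPerm_inr, h1, h2] at h3

end W

/-! ### All transformations of the right shape -/

/-- The transformations that fix the sink and map final states to final states or the sink. -/
def IsConvexMap {p k : ℕ} (t : St p k → St p k) : Prop :=
  t none = none ∧ ∀ f i, t (some (.inr f)) ≠ some (.inl i)

theorem ConvexDFA.isConvexMap {α : Type u} {p k : ℕ} {M : DFA α (St p k)} (hM : ConvexDFA M)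
    (w : List α) : IsConvexMap fun q => M.evalFrom q w :=
  ⟨hM.evalFrom_none w, fun f i => hM.evalFrom_inr f w i⟩

theorem exists_perm_of_inj {ι σ : Type*} [Finite ι] {φ : ι → σ} (hφ : Function.Injective φ)
    (e : Equiv.Perm σ) (he : ∀ i, ∃ j, e (φ i) = φ j) : ∃ π : Equiv.Perm ι, ∀ i, e (φ i) = φ (π i) := by
  choose g hg using he
  have : Function.Injective g := fun i j h => hφ (e.injective (by rw [hg, hg, h]))
  exact ⟨Equiv.ofBijective g (Finite.injective_iff_bijective.1 this), hg⟩

/-- Over the seven letters, all transformations of the right shape are realized. -/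
theorem realizes_of_isConvexMap {p k : ℕ} [NeZero p] [NeZero k] {t : St p k → St p k}
    (ht : IsConvexMap t) : Realizes (W p k) Set.univ t := by
  -- The final block is transformed first: its images are final states or the sink, which the second
  -- map `tE` fixes. In the other order, non-final states sent to final ones would be moved again.
  let tF : St p k → St p k := fun q => match q with
    | some (.inr f) => t (some (.inr f))
    | q => q
  let tE : St p k → St p k := fun q => match q with
    | some (.inl i) => t (some (.inl i))
    | q => q
  have h1 : Realizes (W p k) Set.univ tF := by
    refine Realizes.of_perms_of_sends (Finset.univ.image fun f : Fin k => some (Sum.inr f))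
      {q | ∀ i, q ≠ some (.inl i)} ?_ ?_ ?_ ?_ ?_
    · simp
    · intro e he
      obtain ⟨ρ, hρ⟩ := exists_perm_of_inj (φ := fun f : Fin k => (some (Sum.inr f) : St p k))
        (fun a b h => by simpa using h) e (by
          intro f
          by_contra! hcon
          have : e (e (some (.inr f))) = e (some (.inr f)) := by
            apply he
            simpa [eq_comm] using hcon
          exact hcon f (e.injective this))
      convert realizes_blockPerm (A := Set.univ) trivial trivial 1 ρ using 1
      funext q
      rcases q with _ | i | f
      · rw [he _ (by simp)]; rfl
      · rw [he _ (by simp)]; rfl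
      · exact hρ f
    · intro x hx y hy
      obtain ⟨f, -, rfl⟩ := Finset.mem_image.1 hx
      rcases y with _ | i | g
      · exact realizes_inr_none (Set.mem_univ _) (Set.mem_univ _) (Set.mem_univ _) f
      · exact absurd rfl (hy i)
      · exact realizes_inr_inr (Set.mem_univ _) (Set.mem_univ _) (Set.mem_univ _) f g
    · rintro (_ | i | f) hx
      · rfl
      · rfl
      · simp at hx
    · intro x hx
      obtain ⟨f, -, rfl⟩ := Finset.mem_image.1 hx
      exact ht.2 f
  have h2 : Realizes (W p k) Set.univ tE := by
    refine Realizes.of_perms_of_sends (Finset.univ.image fun i : Fin p => some (Sum.inl i))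
      Set.univ ?_ ?_ ?_ ?_ ?_
    · simp
    · intro e he
      obtain ⟨ρ, hρ⟩ := exists_perm_of_inj (φ := fun f : Fin p => (some (Sum.inl f) : St p k))
        (fun a b h => by simpa using h) e (by
          intro f
          by_contra! hcon
          have : e (e (some (.inl f))) = e (some (.inl f)) := by
            apply he
            simpa [eq_comm] using hcon
          exact hcon f (e.injective this))
      convert realizes_blockPerm (A := Set.univ) trivial trivial ρ 1 using 1
      funext q
      rcases q with _ | i | f
      · rw [he _ (by simp)]; rfl
      · exact hρ i
      · rw [he _ (by simp)]; rfl
    · intro x hx y hy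
      obtain ⟨f, -, rfl⟩ := Finset.mem_image.1 hx
      rcases y with _ | i | g
      · exact realizes_inl_none (Set.mem_univ _) (Set.mem_univ _) (Set.mem_univ _) f
      · exact realizes_inl_inl (Set.mem_univ _) (Set.mem_univ _) (Set.mem_univ _) f i
      · exact realizes_inl_inr (Set.mem_univ _) (Set.mem_univ _) (Set.mem_univ _) f g
    · rintro (_ | i | f) hx
      · rfl
      · simp at hx
      · rfl
    · simp
  convert h2.comp h1 using 1
  funext q
  rcases q with _ | i | f
  · exact ht.1
  · rfl
  · rcases h : t (some (.inr f)) with _ | i | g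
    · simp [tE, tF, h]
    · exact absurd h (ht.2 f i)
    · simp [tE, tF, h]

/-! ### Dialects -/

/-- The letters `a, b, d₂, e`. -/
def fourLetters : Set Letter := {.a, .b, .d₂, .e}

section dialects

variable {β : Type} {p k : ℕ} [NeZero p] [NeZero k] {ρ : β → Letter}

/-- Every set of states other than the sink is the set of states from which some word is
accepted. -/
theorem exists_fourLetters_word_final (hρ : fourLetters ⊆ Set.range ρ) (S : Set (Fin p ⊕ Fin k)) :
    ∃ w, (∀ x ∈ w, ρ x ∈ fourLetters) ∧
      ∀ z, (∃ f, ((W p k).comap ρ).evalFrom (some z) w = some (.inr f)) ↔ z ∈ S := by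
  classical
  have ha : Letter.a ∈ fourLetters := by simp [fourLetters]
  have hb : Letter.b ∈ fourLetters := by simp [fourLetters]
  have hd : Letter.d₂ ∈ fourLetters := by simp [fourLetters]
  have he : Letter.e ∈ fourLetters := by simp [fourLetters]
  -- Final states outside S are first sent to the sink, then non-final states in S are sent to a
  -- final state; both maps are products of moves given by d₂ and e, so no letter merging two states
  -- of one block is needed.
  let tF : St p k → St p k := fun q => match q with
    | some (.inr f) => if .inr f ∈ S then some (.inr f) else none
    | q => q
  let tE : St p k → St p k := fun q => match q with
    | some (.inl i) => if .inl i ∈ S then some (.inr 0) else some (.inl i)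
    | q => q
  have h1 : Realizes (W p k) fourLetters tF := by
    refine Realizes.of_sends (Finset.univ.image fun f : Fin k => some (Sum.inr f)) ?_ ?_
    · intro x hx hxt
      obtain ⟨f, -, rfl⟩ := Finset.mem_image.1 hx
      have : tF (some (.inr f)) = none := by
        by_contra h
        simp only [tF] at hxt h
        split_ifs at hxt h <;> simp_all
      rw [this]
      exact ⟨by simp, realizes_inr_none ha hb hd f⟩
    · rintro (_ | i | f) hx
      · rfl
      · rfl
      · simp at hx
  have h2 : Realizes (W p k) fourLetters tE := by
    refine Realizes.of_sends (Finset.univ.image fun f : Fin p => some (Sum.inl f)) ?_ ?_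
    · intro x hx hxt
      obtain ⟨f, -, rfl⟩ := Finset.mem_image.1 hx
      have : tE (some (.inl f)) = some (.inr 0) := by
        by_contra h
        simp only [tE] at hxt h
        split_ifs at hxt h <;> simp_all
      rw [this]
      exact ⟨by simp, realizes_inl_inr ha hb he f 0⟩
    · rintro (_ | i | f) hx
      · rfl
      · simp at hx
      · rfl
  obtain ⟨w, hwA, hw⟩ := (h2.comp h1).comap hρ
  refine ⟨w, hwA, ?_⟩
  rintro (i | f)
  · rw [hw]
    by_cases h : .inl i ∈ S <;> simp [tE, tF, h]
  · rw [hw]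
    by_cases h : .inr f ∈ S <;> simp [tE, tF, h]

theorem exists_word_final (hρ : fourLetters ⊆ Set.range ρ) (S : Set (Fin p ⊕ Fin k)) :
    ∃ w, ∀ z, (∃ f, ((W p k).comap ρ).evalFrom (some z) w = some (.inr f)) ↔ z ∈ S := by
  obtain ⟨w, -, hw⟩ := exists_fourLetters_word_final hρ S
  exact ⟨w, hw⟩

theorem exists_evalFrom_inl (hρ : fourLetters ⊆ Set.range ρ) (i : Fin p) (q : St p k) :
    ∃ w, ((W p k).comap ρ).evalFrom (some (.inl i)) w = q := by
  have ha : Letter.a ∈ fourLetters := by simp [fourLetters]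
  have hb : Letter.b ∈ fourLetters := by simp [fourLetters]
  have hd : Letter.d₂ ∈ fourLetters := by simp [fourLetters]
  have he : Letter.e ∈ fourLetters := by simp [fourLetters]
  rcases q with _ | j | f
  · obtain ⟨w, -, hw⟩ := ((realizes_inr_none ha hb hd 0).comp
      (realizes_inl_inr (p := p) (k := k) ha hb he i 0)).comap hρ
    exact ⟨w, by simp [hw]⟩
  · obtain ⟨w, -, hw⟩ :=
      (realizes_blockPerm (p := p) (k := k) ha hb (Equiv.swap i j) 1).comap hρ
    exact ⟨w, by simp [hw]⟩
  · obtain ⟨w, -, hw⟩ := (realizes_inl_inr (p := p) (k := k) ha hb he i f).comap hρ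
    exact ⟨w, by simp [hw]⟩

/-- A word accepted from exactly one state z separates z from every other state; the initial state
reaches everything. -/
theorem isMinimalDFA_comap (hρ : fourLetters ⊆ Set.range ρ) :
    IsMinimalDFA ((W p k).comap ρ) := by
  have hM := (W_convex p k).comap ρ
  refine ⟨fun q => exists_evalFrom_inl hρ 0 q, fun q r h => ?_⟩
  by_contra hne
  wlog hq : q ≠ none generalizing q r
  · exact this r q h.symm (Ne.symm hne) (by
      rintro rfl
      exact hne (by simpa using hq))
  obtain ⟨z, rfl⟩ := Option.ne_none_iff_exists'.1 hq
  obtain ⟨w, hw⟩ := exists_word_final (p := p) (k := k) hρ {z}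
  have h1 : w ∈ ((W p k).comap ρ).acceptsFrom (some z) := by
    rw [DFA.mem_acceptsFrom, hM.accept]
    exact (hw z).2 rfl
  rw [h, DFA.mem_acceptsFrom, hM.accept] at h1
  rcases r with _ | z'
  · rw [hM.evalFrom_none] at h1
    simp at h1
  · exact hne (by rw [(hw z').1 h1])

theorem kProperOfComplexity_comap (hρ : fourLetters ⊆ Set.range ρ) :
    KProperOfComplexity (p + k + 1) k ((W p k).comap ρ).accepts := by
  obtain ⟨xa, ha⟩ := hρ (show Letter.a ∈ fourLetters by simp [fourLetters])
  obtain ⟨xd, hd⟩ := hρ (show Letter.d₂ ∈ fourLetters by simp [fourLetters])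
  have hk := NeZero.pos k
  -- The letter a permutes the final states, and d₂ sends the last final state to the sink.
  refine ((W_convex p k).comap ρ).kProperOfComplexity (isMinimalDFA_comap hρ)
    ⟨0, xa, tw k 0, ?_⟩ ⟨⟨k - 1, by omega⟩, xd, ?_⟩
  · simp [DFA.comap, ha, W, stepW]
  · simp [DFA.comap, hd, W, stepW, shiftFin]
    omega

end dialects

theorem accepts_D {p k : ℕ} [NeZero p] [NeZero k] (hn : 3 ≤ p + k + 1) :
    L (p + k + 1) k hn = (W p k).accepts := by
  rw [L, D_eq_reindex, DFA.accepts_reindex]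

/-- A dialect is accepted by the automaton with the letters renamed. -/
theorem onAlphabet_dialect {A : Set Letter} {π : Letter → Option Letter} {ρ : Letter → Letter}
    (h : ∀ x ∈ A, ∀ y, π y = some x ↔ y = ρ x) {σ : Type} (M : DFA Letter σ) :
    onAlphabet A (dialect π M.accepts) = (M.comap fun x : A => ρ x.1).accepts := by
  ext w
  rw [DFA.accepts_comap]
  -- Each letter of w has exactly one preimage under π, so the original word is determined by w.
  have key : ∀ v : List Letter, v.map π = (w.map Subtype.val).map some ↔
      v = w.map fun x : A => ρ x.1 := by
    induction w with
    | nil => simp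
    | cons x w ih =>
      intro v
      rcases v with _ | ⟨y, v⟩
      · simp
      · simp only [List.map_cons, List.cons.injEq, h x.1 x.2, ih]
  change (∃ v ∈ M.accepts, v.map π = (w.map Subtype.val).map some) ↔ _ ∈ M.accepts
  simp only [key]
  constructor
  · rintro ⟨v, hv, rfl⟩
    exact hv
  · intro h
    exact ⟨_, h, rfl⟩

/-- The letter renaming of the second factor of the product. -/
def prodLetter : Letter → Letter
  | .b => .d₂
  | .d₂ => .b
  | x => x

/-- The letter renaming of the second argument of a boolean operation. -/
def boolLetter : Letter → Letter
  | .c₁ => .e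
  | .e => .c₁
  | .d₁ => .d₂
  | .d₂ => .d₁
  | x => x

section

variable {p k : ℕ} [NeZero p] [NeZero k] (hn : 3 ≤ p + k + 1)

theorem L₄_eq : L₄ (p + k + 1) k hn =
    ((W p k).comap fun x : ({.a, .b, .d₂, .e} : Set Letter) => x.1).accepts := by
  rw [L₄, accepts_D]
  refine onAlphabet_dialect (ρ := id) ?_ _
  rintro x hx y
  rcases hx with rfl | rfl | rfl | rfl <;> cases y <;> simp [assign]

theorem L₅_eq : L₅ (p + k + 1) k hn =
    ((W p k).comap fun x : ({.a, .b, .d₁, .d₂, .e} : Set Letter) => x.1).accepts := by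
  rw [L₅, accepts_D]
  refine onAlphabet_dialect (ρ := id) ?_ _
  rintro x hx y
  rcases hx with rfl | rfl | rfl | rfl | rfl <;> cases y <;> simp [assign]

theorem L₆_eq : L₆ (p + k + 1) k hn = ((W p k).comap fun x : sixLetters => x.1).accepts := by
  rw [L₆, accepts_D]
  refine onAlphabet_dialect (ρ := id) ?_ _
  rintro x hx y
  rcases hx with rfl | rfl | rfl | rfl | rfl | rfl <;> cases y <;> simp [assign]

theorem L₆prod_eq : L₆prod (p + k + 1) k hn =
    ((W p k).comap fun x : sixLetters => prodLetter x.1).accepts := by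
  rw [L₆prod, accepts_D]
  refine onAlphabet_dialect ?_ _
  rintro x hx y
  rcases hx with rfl | rfl | rfl | rfl | rfl | rfl <;> cases y <;> simp [assign, prodLetter]

theorem L₆bool_eq : L₆bool (p + k + 1) k hn =
    ((W p k).comap fun x : sixLetters => boolLetter x.1).accepts := by
  rw [L₆bool, accepts_D]
  refine onAlphabet_dialect ?_ _
  rintro x hx y
  rcases hx with rfl | rfl | rfl | rfl | rfl | rfl <;> cases y <;> simp [assign, boolLetter]

end

end PrefixConvex

namespace PrefixConvex

/-! ### The syntactic semigroup -/

theorem card_syntacticSemigroup {α : Type u} (K : Language α) :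
    ENat.card (SyntacticSemigroup K) =
      (Set.range fun x : {x : List α // x ≠ []} => (Quotient.mk (syntacticSetoid K) x)).encard := by
  rw [Set.range_eq_univ.2 Quotient.mk_surjective, Set.encard_univ]
  rfl

/-- The transformation induced by a non-empty word. -/
def wordMap {α σ : Type*} (M : DFA α σ) (x : {x : List α // x ≠ []}) (q : σ) : σ :=
  M.evalFrom q x.1

theorem syntacticSetoid_of_wordMap_eq {α : Type u} {σ : Type*} (M : DFA α σ)
    {x y : {x : List α // x ≠ []}} (h : wordMap M x = wordMap M y) :
    (syntacticSetoid M.accepts) x y := by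
  intro w z
  have := congrFun h (M.eval w)
  simp only [wordMap, DFA.eval] at this
  simp only [DFA.mem_accepts, DFA.eval, DFA.evalFrom_of_append, this]

theorem wordMap_eq_of_syntacticSetoid {α : Type u} {σ : Type} {M : DFA α σ} (hM : IsMinimalDFA M)
    {x y : {x : List α // x ≠ []}} (h : (syntacticSetoid M.accepts) x y) :
    wordMap M x = wordMap M y := by
  funext q
  obtain ⟨w, rfl⟩ := hM.1 q
  apply hM.2
  ext z
  have := h w z
  simp only [DFA.mem_accepts, DFA.eval, DFA.evalFrom_of_append] at this
  exact this

/-- The p non-final states may go to any of n states, each final state to one of the k final states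
or the sink. -/
theorem encard_isConvexMap (p k : ℕ) :
    {t : St p k → St p k | IsConvexMap t}.encard = (semigroupBound (p + k + 1) k : ℕ∞) := by
  let g : (Fin p → St p k) × (Fin k → Option (Fin k)) → (St p k → St p k) := fun u q => match q with
    | none => none
    | some (.inl i) => u.1 i
    | some (.inr f) => (u.2 f).map .inr
  have hg : Function.Injective g := by
    rintro ⟨u, v⟩ ⟨u', v'⟩ h
    refine Prod.ext (funext fun i => congrFun h (some (.inl i))) (funext fun f => ?_)
    exact Option.map_injective Sum.inr_injective (congrFun h (some (.inr f)))
  have hr : {t : St p k → St p k | IsConvexMap t} = Set.range g := by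
    ext t
    constructor
    · rintro ⟨h1, h2⟩
      refine ⟨⟨fun i => t (some (.inl i)), fun f => (t (some (.inr f))).bind Sum.getRight?⟩, ?_⟩
      funext q
      rcases q with _ | i | f
      · exact h1.symm
      · rfl
      · rcases h : t (some (.inr f)) with _ | i | f'
        · simp [g, h]
        · exact absurd h (h2 f i)
        · simp [g, h]
    · rintro ⟨⟨u, v⟩, rfl⟩
      refine ⟨rfl, fun f i h => ?_⟩
      simp only [g] at h
      rcases v f with _ | f' <;> simp at h
  have e : p + k + 1 - 1 - k = p := by omega
  rw [hr, ← Set.image_univ, hg.encard_image, Set.encard_univ, ENat.card_eq_coe_fintype_card,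
    semigroupBound, e]
  simp

theorem card_syntacticSemigroup_le {α : Type u} {p k : ℕ} {M : DFA α (St p k)}
    (hM : ConvexDFA M) :
    ENat.card (SyntacticSemigroup M.accepts) ≤ (Set.range (wordMap M)).encard ∧
      Set.range (wordMap M) ⊆ {t | IsConvexMap t} := by
  refine ⟨?_, ?_⟩
  · rw [card_syntacticSemigroup]
    exact encard_range_le_of_factors fun w w' h => Quotient.sound (syntacticSetoid_of_wordMap_eq M h)
  · rintro _ ⟨x, rfl⟩
    exact hM.isConvexMap x.1

/-- The semigroup is built from non-empty words. Prefixing a positive power of a permutation letter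
that acts as the identity makes any word non-empty. -/
theorem exists_ne_nil_of_realizes {α σ : Type*} [Finite σ] {M : DFA α σ} {t : σ → σ} {x : α}
    (hx : Function.Bijective fun q => M.step q x) (ht : Realizes M Set.univ t) :
    ∃ w, wordMap M w = t := by
  obtain ⟨w, -, hw⟩ := ht
  let e : Equiv.Perm σ := Equiv.ofBijective _ hx
  have he : ∀ m q, M.evalFrom q (List.replicate m x) = (e ^ m) q := by
    intro m
    induction m with
    | zero => simp
    | succ m ih =>
      intro q
      rw [List.replicate_succ, DFA.evalFrom_cons, ih, pow_succ]
      rfl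
  refine ⟨⟨List.replicate (orderOf e) x ++ w, ?_⟩, ?_⟩
  · have := (orderOf_pos e).ne'
    simp [this]
  · funext q
    simp only [wordMap]
    rw [DFA.evalFrom_of_append, he, pow_orderOf_eq_one, hw]
    rfl

theorem card_syntacticSemigroup_W (p k : ℕ) [NeZero p] [NeZero k] :
    ENat.card (SyntacticSemigroup (W p k).accepts) = (semigroupBound (p + k + 1) k : ℕ∞) := by
  have hmin : IsMinimalDFA (W p k) :=
    isMinimalDFA_comap (p := p) (k := k) (ρ := id) (fun x _ => ⟨x, rfl⟩)
  rw [card_syntacticSemigroup, ← encard_isConvexMap]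
  have : {t : St p k → St p k | IsConvexMap t} = Set.range (wordMap (W p k)) := by
    ext t
    constructor
    · intro ht
      refine exists_ne_nil_of_realizes (x := Letter.a) ?_ (realizes_of_isConvexMap ht)
      convert (blockPerm (gen p true) (gen k false)).bijective using 1
      funext q
      exact W_step_ab true q
    · rintro ⟨x, rfl⟩
      exact (W_convex p k).isConvexMap x.1
  rw [this]
  exact encard_range_eq_of_ker fun w w' =>
    ⟨fun h => wordMap_eq_of_syntacticSetoid hmin (Quotient.exact h),
      fun h => Quotient.sound (syntacticSetoid_of_wordMap_eq _ h)⟩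

/-- Divide by the right side and take logarithms. Applying log x ≤ x - 1 to the p - 1 factors
(p+k+1)/(p+k) and the k factors (k+1)/(p+k) gives at most -(p-1)(k-1)/(p+k) ≤ 0; strictness comes
from the first factors, which differ from 1. -/
theorem pow_mul_pow_lt {p k : ℕ} (hp : 2 ≤ p) (hk : 1 ≤ k) :
    (p + k + 1) ^ (p - 1) * (k + 1) ^ k < (p + k) ^ (p - 1 + k) := by
  have hN : (0 : ℝ) < p + k := by positivity
  have hp1 : (1 : ℝ) ≤ (p - 1 : ℕ) := by exact_mod_cast (by omega : 1 ≤ p - 1)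
  have hcast : ((p - 1 : ℕ) : ℝ) = p - 1 := by push_cast [show 1 ≤ p by omega]; ring
  have hk1 : (1 : ℝ) ≤ k := by exact_mod_cast hk
  have h1 : Real.log ((p + k + 1) / (p + k)) < (p + k + 1) / (p + k) - 1 := by
    refine Real.log_lt_sub_one_of_pos (by positivity) ?_
    rw [ne_eq, div_eq_one_iff_eq hN.ne']
    linarith
  have h2 : Real.log ((k + 1) / (p + k)) ≤ (k + 1) / (p + k) - 1 :=
    Real.log_le_sub_one_of_pos (by positivity)
  rw [Real.log_div (by positivity) hN.ne'] at h1 h2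
  have h3 : ((p - 1 : ℕ) : ℝ) * ((p + k + 1) / (p + k) - 1) + k * ((k + 1) / (p + k) - 1) ≤ 0 := by
    have : ((p - 1 : ℕ) : ℝ) * ((p + k + 1) / (p + k) - 1) + k * ((k + 1) / (p + k) - 1) =
        -((p - 1) * (k - 1)) / (p + k) := by
      rw [hcast]
      field_simp
      ring
    rw [this]
    apply div_nonpos_of_nonpos_of_nonneg _ hN.le
    have : (0 : ℝ) ≤ (p - 1) * (k - 1) := mul_nonneg (by linarith) (by linarith)
    linarith
  have h4 : Real.log (((p : ℝ) + k + 1) ^ (p - 1) * ((k : ℝ) + 1) ^ k) <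
      Real.log (((p : ℝ) + k) ^ (p - 1 + k)) := by
    rw [Real.log_mul (by positivity) (by positivity), Real.log_pow, Real.log_pow, Real.log_pow]
    push_cast
    have h5 := mul_lt_mul_of_pos_left h1 (show (0 : ℝ) < (p - 1 : ℕ) by linarith)
    have h6 := mul_le_mul_of_nonneg_left h2 (show (0 : ℝ) ≤ k by linarith)
    linarith
  have h7 := (Real.log_lt_log_iff (by positivity) (by positivity)).1 h4
  exact_mod_cast h7

theorem semigroupBound_le {n k : ℕ} (hn : 3 ≤ n) (hk1 : 1 ≤ k) (hk2 : k ≤ n - 2) :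
    semigroupBound n k ≤ n * (n - 1) ^ (n - 2) ∧
      (semigroupBound n k = n * (n - 1) ^ (n - 2) ↔ k = n - 2) := by
  by_cases h : k = n - 2
  · have : semigroupBound n k = n * (n - 1) ^ (n - 2) := by
      rw [semigroupBound, h, show n - 1 - (n - 2) = 1 by omega, show n - 2 + 1 = n - 1 by omega,
        pow_one]
    exact ⟨this.le, iff_of_true this h⟩
  · obtain ⟨p, rfl⟩ : ∃ p, n = p + k + 1 := ⟨n - 1 - k, by omega⟩
    have hlt : semigroupBound (p + k + 1) k < (p + k + 1) * (p + k + 1 - 1) ^ (p + k + 1 - 2) := by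
      have := pow_mul_pow_lt (p := p) (k := k) (by omega) hk1
      rw [semigroupBound, show p + k + 1 - 1 - k = (p - 1) + 1 by omega, pow_succ',
        show p + k + 1 - 2 = p - 1 + k by omega, mul_assoc, Nat.add_sub_cancel]
      exact Nat.mul_lt_mul_of_pos_left this (by omega)
    exact ⟨hlt.le, iff_of_false hlt.ne h⟩

/-! ### Seven letters are necessary -/

section letters

variable {p k : ℕ}

open Classical in
/-- The kind of a transformation: `0` for permutations of the blocks. -/
noncomputable def mapKind (g : St p k → St p k) : ℕ :=
  if ∃ i, g (some (.inl i)) = none then 1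
  else if ∃ i f, g (some (.inl i)) = some (.inr f) then 2
  else if ∃ f, g (some (.inr f)) = none then 3
  else if ¬ Function.Injective fun i : Fin p => g (some (.inl i)) then 4
  else if ¬ Function.Injective fun f : Fin k => g (some (.inr f)) then 5
  else 0

/-- Each condition in `mapKind` quantifies over a whole block, and a block permutation applied first
only renames the points of a block. -/
theorem mapKind_comp_blockPerm (g : St p k → St p k) (π : Equiv.Perm (Fin p))
    (ρ : Equiv.Perm (Fin k)) : mapKind (g ∘ blockPerm π ρ) = mapKind g := by
  have h1 : (∃ i, (g ∘ blockPerm π ρ) (some (.inl i)) = none) ↔ ∃ i, g (some (.inl i)) = none :=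
    (π.surjective.exists (p := fun i => g (some (.inl i)) = none)).symm
  have h2 : (∃ i f, (g ∘ blockPerm π ρ) (some (.inl i)) = some (.inr f)) ↔
      ∃ i f, g (some (.inl i)) = some (.inr f) :=
    (π.surjective.exists (p := fun i => ∃ f, g (some (.inl i)) = some (.inr f))).symm
  have h3 : (∃ i, (g ∘ blockPerm π ρ) (some (.inr i)) = none) ↔ ∃ i, g (some (.inr i)) = none :=
    (ρ.surjective.exists (p := fun i => g (some (.inr i)) = none)).symm
  have h4 : (Function.Injective fun i : Fin p => (g ∘ blockPerm π ρ) (some (.inl i))) ↔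
      Function.Injective fun i : Fin p => g (some (.inl i)) :=
    (Function.Injective.of_comp_iff' (fun i : Fin p => g (some (.inl i))) π.bijective)
  have h5 : (Function.Injective fun i : Fin k => (g ∘ blockPerm π ρ) (some (.inr i))) ↔
      Function.Injective fun i : Fin k => g (some (.inr i)) :=
    (Function.Injective.of_comp_iff' (fun i : Fin k => g (some (.inr i))) ρ.bijective)
  simp only [mapKind, h1, h2, h3, h4, h5]

theorem mapKind_eq_zero_iff {g : St p k → St p k} (hg : IsConvexMap g) :
    mapKind g = 0 ↔ ∃ π ρ, g = blockPerm π ρ := by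
  constructor
  · intro h
    simp only [mapKind] at h
    split_ifs at h with h1 h2 h3 h4 h5
    push Not at h1 h2 h3
    have hE : ∀ i, ∃ j, g (some (.inl i)) = some (.inl j) := by
      intro i
      rcases h : g (some (.inl i)) with _ | j | f
      · exact absurd h (h1 i)
      · exact ⟨j, rfl⟩
      · exact absurd h (h2 i f)
    have hF : ∀ i, ∃ j, g (some (.inr i)) = some (.inr j) := by
      intro i
      rcases h : g (some (.inr i)) with _ | j | f
      · exact absurd h (h3 i)
      · exact absurd h (hg.2 i j)
      · exact ⟨f, rfl⟩
    choose π hπ using hE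
    choose ρ hρ using hF
    have hπi : Function.Injective π := fun i j h => h4 (by simp only [hπ, h])
    have hρi : Function.Injective ρ := fun i j h => h5 (by simp only [hρ, h])
    refine ⟨Equiv.ofBijective π (Finite.injective_iff_bijective.1 hπi),
      Equiv.ofBijective ρ (Finite.injective_iff_bijective.1 hρi), ?_⟩
    funext q
    rcases q with _ | i | f
    · exact hg.1
    · exact hπ i
    · exact hρ f
  · rintro ⟨π, ρ, rfl⟩
    have h4 : Function.Injective fun i : Fin p => blockPerm π ρ (some (.inl i)) := by
      intro i j h
      simpa using h
    have h5 : Function.Injective fun i : Fin k => blockPerm π ρ (some (.inr i)) := by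
      intro i j h
      simpa using h
    simp only [mapKind]
    rw [if_neg (by simp), if_neg (by simp), if_neg (by simp), if_neg (not_not.2 h4),
      if_neg (not_not.2 h5)]

/-- Isolates the letter responsible for the kind of a word: what is read before it permutes the
blocks and does not affect the kind. -/
theorem exists_first_not_blockPerm {α : Type*} (M : DFA α (St p k)) (w : List α)
    (h : ¬ ∃ π ρ, (fun q => M.evalFrom q w) = blockPerm π ρ) :
    ∃ u x v, w = u ++ x :: v ∧ (∃ π ρ, (fun q => M.evalFrom q u) = blockPerm π ρ) ∧
      ¬ ∃ π ρ, (fun q => M.step q x) = blockPerm π ρ := by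
  induction w with
  | nil =>
    refine absurd ⟨1, 1, ?_⟩ h
    funext q
    rcases q with _ | i | f <;> rfl
  | cons x w ih =>
    by_cases hx : ∃ π ρ, (fun q => M.step q x) = blockPerm π ρ
    · obtain ⟨π, ρ, hx⟩ := hx
      have comp : ∀ w', (∃ π ρ, (fun q => M.evalFrom q w') = blockPerm π ρ) →
          ∃ π ρ, (fun q => M.evalFrom q (x :: w')) = blockPerm π ρ := by
        rintro w' ⟨π', ρ', hw⟩
        refine ⟨π' * π, ρ' * ρ, ?_⟩
        funext q
        rw [DFA.evalFrom_cons, show M.step q x = blockPerm π ρ q from congrFun hx q]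
        refine (congrFun hw _).trans ?_
        rcases q with _ | i | f <;> rfl
      obtain ⟨u, y, v, rfl, hu, hy⟩ := ih (fun hw => h (comp w hw))
      exact ⟨x :: u, y, v, rfl, comp u hu, hy⟩
    · exact ⟨[], x, w, rfl, ⟨1, 1, by funext q; rcases q with _ | i | f <;> rfl⟩, hx⟩

/-- If a transformation that moves one point has a factor that is applied first and is not a
permutation, then this factor is of the same kind. -/
theorem mapKind_eq_of_comp_eq {g h : St p k → St p k} (hg : IsConvexMap g) (hh : IsConvexMap h)
    (hgp : mapKind g ≠ 0) {z : Fin p ⊕ Fin k} {y : St p k} (hs : h ∘ g = Function.update id (some z) y) :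
    mapKind g = mapKind (Function.update id (some z) y) := by
  -- Away from z, h undoes g. So g is injective there, and it keeps the block, since h cannot return
  -- from the sink or from a final state to a non-final one.
  have hfix : ∀ x, x ≠ some z → h (g x) = x := by
    intro x hx
    have := congrFun hs x
    rwa [Function.update_of_ne hx] at this
  have hz : h (g (some z)) = y := by
    have := congrFun hs (some z)
    rwa [Function.update_self] at this
  have hE : ∀ i, some (.inl i) ≠ some z → ∃ j, g (some (.inl i)) = some (.inl j) := by
    intro i hi
    have := hfix _ hi
    rcases hgi : g (some (.inl i)) with _ | j | f
    · rw [hgi, hh.1] at this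
      simp at this
    · exact ⟨j, rfl⟩
    · rw [hgi] at this
      exact absurd this (hh.2 f i)
  have hF : ∀ f, some (.inr f) ≠ some z → ∃ j, g (some (.inr f)) = some (.inr j) := by
    intro f hi
    have := hfix _ hi
    rcases hgi : g (some (.inr f)) with _ | j | f
    · rw [hgi, hh.1] at this
      simp at this
    · exact absurd hgi (hg.2 _ _)
    · exact ⟨f, rfl⟩
  have hinj : ∀ x x', x ≠ some z → x' ≠ some z → g x = g x' → x = x' := by
    intro x x' hx hx' h
    rw [← hfix x hx, ← hfix x' hx', h]
  rcases z with i | f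
  · have hF' : ∀ f, ∃ j, g (some (.inr f)) = some (.inr j) := fun f => hF f (by simp)
    choose ρ hρ using hF'
    have hρi : Function.Injective ρ := fun a b hab => by
      have := hinj (some (.inr a)) (some (.inr b)) (by simp) (by simp) (by rw [hρ, hρ, hab])
      simpa using this
    have hρs := Finite.surjective_of_injective hρi
    have hFn : ¬ ∃ f, g (some (.inr f)) = none := by simp [hρ]
    have hFi : Function.Injective fun f : Fin k => g (some (.inr f)) := by
      intro a b hab
      simp only [hρ] at hab
      exact hρi (by simpa using hab)
    rcases hgz : g (some (.inl i)) with _ | j | f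
    · have h0 : y = none := by rw [← hz, hgz, hh.1]
      subst h0
      simp only [mapKind]
      rw [if_pos ⟨i, hgz⟩, if_pos ⟨i, by simp⟩]
    · have hE' : ∀ i', ∃ j, g (some (.inl i')) = some (.inl j) := by
        intro i'
        by_cases hi : i' = i
        · exact ⟨j, by rw [hi, hgz]⟩
        · exact hE i' (by simpa using hi)
      have hEn : ¬ ∃ i, g (some (.inl i)) = none := by
        rintro ⟨i', hi'⟩
        obtain ⟨j, hj⟩ := hE' i'
        rw [hj] at hi'
        simp at hi'
      have hEf : ¬ ∃ i f, g (some (.inl i)) = some (.inr f) := by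
        rintro ⟨i', f, hi'⟩
        obtain ⟨j, hj⟩ := hE' i'
        rw [hj] at hi'
        simp at hi'
      -- If g were injective here it would be a block permutation. So z collides with another state
      -- i', and then y = i'.
      have hEi : ¬ Function.Injective fun i : Fin p => g (some (.inl i)) := by
        intro hEi
        apply hgp
        simp [mapKind, hEn, hEf, hFn, hEi, hFi]
      have : ∃ i', i' ≠ i ∧ g (some (.inl i')) = g (some (.inl i)) := by
        by_contra! hcon
        apply hEi
        intro a b hab
        simp only at hab
        by_cases ha : a = i
        · by_contra hne
          exact hcon b (fun hb => hne (ha.trans hb.symm)) (by rw [← hab, ha])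
        · by_cases hb : b = i
          · exact absurd (hab.trans (by rw [hb])) (hcon a ha)
          · simpa using hinj _ _ (by simpa using ha) (by simpa using hb) hab
      obtain ⟨i', hi', hgi⟩ := this
      have h0 : y = some (.inl i') := by rw [← hz, ← hgi, hfix _ (by simpa using hi')]
      subst h0
      have e1 : ¬ ∃ x : Fin p, Function.update id (some (Sum.inl i)) (some (Sum.inl i'))
          (some (Sum.inl x)) = (none : St p k) := by
        rintro ⟨x, hx⟩
        by_cases h : x = i <;> simp [h] at hx
      have e2 : ¬ ∃ (x : Fin p) (f : Fin k), Function.update id (some (Sum.inl i))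
          (some (Sum.inl i')) (some (Sum.inl x)) = (some (Sum.inr f) : St p k) := by
        rintro ⟨x, f, hx⟩
        by_cases h : x = i <;> simp [h] at hx
      have e3 : ¬ ∃ x : Fin k, Function.update id (some (Sum.inl i)) (some (Sum.inl i'))
          (some (Sum.inr x)) = (none : St p k) := by simp
      have e4 : ¬ Function.Injective fun x : Fin p => (Function.update id (some (Sum.inl i))
          (some (Sum.inl i')) (some (Sum.inl x)) : St p k) := by
        intro h
        exact hi' (h (by simp [hi']))
      simp only [mapKind]
      rw [if_neg hEn, if_neg hEf, if_neg hFn, if_pos hEi, if_neg e1, if_neg e2, if_neg e3, if_pos e4]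
    -- As g permutes the final block, g z is also the image of some final f', and h takes it back to
    -- f'; so y is final.
    · obtain ⟨f', rfl⟩ := hρs f
      have h0 : y = some (.inr f') := by rw [← hz, hgz, ← hρ, hfix _ (by simp)]
      subst h0
      have hEn : ¬ ∃ i, g (some (.inl i)) = none := by
        rintro ⟨i', hi'⟩
        by_cases h : i' = i
        · rw [h, hgz] at hi'
          simp at hi'
        · obtain ⟨j, hj⟩ := hE i' (by simpa using h)
          rw [hj] at hi'
          simp at hi'
      have e1 : ¬ ∃ x : Fin p, Function.update id (some (Sum.inl i)) (some (Sum.inr f'))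
          (some (Sum.inl x)) = (none : St p k) := by
        rintro ⟨x, hx⟩
        by_cases h : x = i <;> simp [h] at hx
      simp only [mapKind]
      rw [if_neg hEn, if_pos ⟨i, _, hgz⟩, if_neg e1, if_pos ⟨i, f', by simp⟩]
  -- For a final z the non-final block is permuted by g, which leaves only the kinds 3 and 5.
  · have hE' : ∀ f, ∃ j, g (some (.inl f)) = some (.inl j) := fun f => hE f (by simp)
    choose ρ hρ using hE'
    have hEn : ¬ ∃ f, g (some (.inl f)) = none := by simp [hρ]
    have hEf : ¬ ∃ i f, g (some (.inl i)) = some (.inr f) := by simp [hρ]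
    have hEi : Function.Injective fun f : Fin p => g (some (.inl f)) := by
      intro a b hab
      simpa using hinj _ _ (by simp) (by simp) hab
    have e1 : ¬ ∃ x : Fin p, Function.update id (some (Sum.inr f)) y
        (some (Sum.inl x)) = (none : St p k) := by simp
    have e2 : ¬ ∃ (x : Fin p) (f' : Fin k), Function.update id (some (Sum.inr f))
        y (some (Sum.inl x)) = (some (Sum.inr f') : St p k) := by simp
    rcases hgz : g (some (.inr f)) with _ | j | j
    · have h0 : y = none := by rw [← hz, hgz, hh.1]
      subst h0
      simp only [mapKind]
      rw [if_neg hEn, if_neg hEf, if_pos ⟨f, hgz⟩, if_neg e1, if_neg e2, if_pos ⟨f, by simp⟩]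
    · exact absurd hgz (hg.2 _ _)
    · have hFn : ¬ ∃ f, g (some (.inr f)) = none := by
        rintro ⟨i', hi'⟩
        by_cases h : i' = f
        · rw [h, hgz] at hi'
          simp at hi'
        · obtain ⟨j, hj⟩ := hF i' (by simpa using h)
          rw [hj] at hi'
          simp at hi'
      have hFi : ¬ Function.Injective fun i : Fin k => g (some (.inr i)) := by
        intro hFi
        apply hgp
        simp [mapKind, hEn, hEf, hFn, hEi, hFi]
      have : ∃ i', i' ≠ f ∧ g (some (.inr i')) = g (some (.inr f)) := by
        by_contra! hcon
        apply hFi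
        intro a b hab
        simp only at hab
        by_cases ha : a = f
        · by_contra hne
          exact hcon b (fun hb => hne (ha.trans hb.symm)) (by rw [← hab, ha])
        · by_cases hb : b = f
          · exact absurd (hab.trans (by rw [hb])) (hcon a ha)
          · simpa using hinj _ _ (by simpa using ha) (by simpa using hb) hab
      obtain ⟨i', hi', hgi⟩ := this
      have h0 : y = some (.inr i') := by rw [← hz, ← hgi, hfix _ (by simpa using hi')]
      subst h0
      have e3 : ¬ ∃ x : Fin k, Function.update id (some (Sum.inr f)) (some (Sum.inr i'))
          (some (Sum.inr x)) = (none : St p k) := by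
        rintro ⟨x, hx⟩
        by_cases h : x = f <;> simp [h] at hx
      have e4 : ¬ ¬ Function.Injective fun x : Fin p => (Function.update id (some (Sum.inr f))
          (some (Sum.inr i')) (some (Sum.inl x)) : St p k) := by
        rw [not_not]
        intro a b hab
        simpa using hab
      have e5 : ¬ Function.Injective fun x : Fin k => (Function.update id (some (Sum.inr f))
          (some (Sum.inr i')) (some (Sum.inr x)) : St p k) := by
        intro h
        exact hi' (h (by simp [hi']))
      simp only [mapKind]
      rw [if_neg hEn, if_neg hEf, if_neg hFn, if_neg (not_not.2 hEi), if_pos hFi, if_neg e1,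
        if_neg e2, if_neg e3, if_neg e4, if_pos e5]

end letters

end PrefixConvex

namespace PrefixConvex

/-- A semigroup of maximal size contains all maps of the right shape. The moves of one point have
five kinds, and a word inducing one contains a letter of its kind: its first letter that is not a
block permutation. Two further letters must be block permutations. -/
theorem seven_le_card {α : Type u} {p k : ℕ} (hp : 2 ≤ p) (hk : 2 ≤ k) {M : DFA α (St p k)}
    (hM : ConvexDFA M)
    (hc : ENat.card (SyntacticSemigroup M.accepts) = (semigroupBound (p + k + 1) k : ℕ∞)) :
    7 ≤ ENat.card α := by
  obtain ⟨h1, h2⟩ := card_syntacticSemigroup_le hM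
  have hrange : Set.range (wordMap M) = {t | IsConvexMap t} := by
    refine Set.Finite.eq_of_subset_of_encard_le (Set.toFinite _) h2 ?_
    rw [encard_isConvexMap, ← hc]
    exact h1
  have hword : ∀ t, IsConvexMap t → ∃ w, (fun q => M.evalFrom q w) = t := by
    intro t ht
    have : t ∈ Set.range (wordMap M) := by rw [hrange]; exact ht
    obtain ⟨w, hw⟩ := this
    exact ⟨w.1, hw⟩
  have hstep : ∀ x, IsConvexMap fun q => M.step q x := fun x => hM.isConvexMap [x]
  have hkind : ∀ (z : Fin p ⊕ Fin k) (y : St p k), IsConvexMap (Function.update id (some z) y) →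
      mapKind (Function.update id (some z) y) ≠ 0 →
      ∃ x, mapKind (fun q => M.step q x) = mapKind (Function.update id (some z) y) := by
    intro z y ht h0
    obtain ⟨w, hw⟩ := hword _ ht
    obtain ⟨a, x, v, rfl, ⟨π, ρ, ha⟩, hx⟩ := exists_first_not_blockPerm M w (by
      rw [hw]
      exact fun h => h0 ((mapKind_eq_zero_iff ht).2 h))
    have hcomp : (fun q => M.evalFrom q v) ∘ ((fun q => M.step q x) ∘ blockPerm π ρ) =
        Function.update id (some z) y := by
      rw [← hw, ← ha]
      funext q
      simp [DFA.evalFrom_of_append]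
    have hconv : IsConvexMap ((fun q => M.step q x) ∘ blockPerm π ρ) := by
      rw [← ha]
      have := hM.isConvexMap (a ++ [x])
      simp only [DFA.evalFrom_of_append] at this
      exact this
    refine ⟨x, ?_⟩
    rw [← mapKind_comp_blockPerm _ π ρ]
    refine mapKind_eq_of_comp_eq hconv (hM.isConvexMap v) ?_ hcomp
    rw [mapKind_comp_blockPerm]
    exact fun h => hx ((mapKind_eq_zero_iff (hstep x)).1 h)
  let i0 : Fin p := ⟨0, by omega⟩
  let i1 : Fin p := ⟨1, hp⟩
  let f0 : Fin k := ⟨0, by omega⟩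
  let f1 : Fin k := ⟨1, hk⟩
  have hi : i1 ≠ i0 := by simp [i0, i1]
  have hf : f1 ≠ f0 := by simp [f0, f1]
  have k1 : mapKind (Function.update id (some (.inl i0)) none : St p k → St p k) = 1 := by
    simp only [mapKind]
    rw [if_pos ⟨i0, by simp⟩]
  have k2 : mapKind (Function.update id (some (.inl i0)) (some (.inr f0)) : St p k → St p k) = 2 := by
    simp only [mapKind]
    rw [if_neg, if_pos ⟨i0, f0, by simp⟩]
    rintro ⟨x, hx⟩
    by_cases h : x = i0 <;> simp [h] at hx
  have k3 : mapKind (Function.update id (some (.inr f0)) none : St p k → St p k) = 3 := by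
    simp only [mapKind]
    rw [if_neg (by simp), if_neg (by simp), if_pos ⟨f0, by simp⟩]
  have k4 : mapKind (Function.update id (some (.inl i0)) (some (.inl i1)) : St p k → St p k) = 4 := by
    simp only [mapKind]
    rw [if_neg, if_neg, if_neg (by simp), if_pos]
    · intro h
      exact hi (h (by simp [hi]))
    · rintro ⟨x, f, hx⟩
      by_cases h : x = i0 <;> simp [h] at hx
    · rintro ⟨x, hx⟩
      by_cases h : x = i0 <;> simp [h] at hx
  have k5 : mapKind (Function.update id (some (.inr f0)) (some (.inr f1)) : St p k → St p k) = 5 := by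
    simp only [mapKind]
    rw [if_neg (by simp), if_neg (by simp), if_neg, if_neg, if_pos]
    · intro h
      exact hf (h (by simp [hf]))
    · rw [not_not]
      intro a b hab
      simpa using hab
    · rintro ⟨x, hx⟩
      by_cases h : x = f0 <;> simp [h] at hx
  have cE : ∀ i y, IsConvexMap (Function.update id (some (.inl i)) y : St p k → St p k) :=
    fun i y => ⟨by simp, by simp⟩
  have cF : ∀ f y, (∀ i, y ≠ some (.inl i)) →
      IsConvexMap (Function.update id (some (.inr f)) y : St p k → St p k) := by
    refine fun f y hy => ⟨by simp, fun f' i => ?_⟩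
    by_cases h : f' = f
    · simp [h, hy i]
    · simp [h]
  obtain ⟨x1, hx1⟩ := hkind _ _ (cE i0 none) (by simp [k1])
  obtain ⟨x2, hx2⟩ := hkind _ _ (cE i0 (some (.inr f0))) (by simp [k2])
  obtain ⟨x3, hx3⟩ := hkind _ _ (cF f0 none (by simp)) (by simp [k3])
  obtain ⟨x4, hx4⟩ := hkind _ _ (cE i0 (some (.inl i1))) (by simp [k4])
  obtain ⟨x5, hx5⟩ := hkind _ _ (cF f0 (some (.inr f1)) (by simp)) (by simp [k5])
  rw [k1] at hx1
  rw [k2] at hx2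
  rw [k3] at hx3
  rw [k4] at hx4
  rw [k5] at hx5
  obtain ⟨x6, x7, hx6, hx7, h67⟩ : ∃ x y, mapKind (fun q => M.step q x) = 0 ∧
      mapKind (fun q => M.step q y) = 0 ∧ x ≠ y := by
    -- All letters of a word that induces a block permutation are block permutations: the first
    -- letter is injective, and a non-final state that it made final could not become non-final
    -- again. The rest of the word follows after undoing it.
    have hperm : ∀ (π : Equiv.Perm (Fin p)) (ρ : Equiv.Perm (Fin k)) (w : List α),
        (fun q => M.evalFrom q w) = blockPerm π ρ →
        ∀ x ∈ w, mapKind (fun q => M.step q x) = 0 := by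
      intro π ρ w hw x hx
      rw [mapKind_eq_zero_iff (hstep x)]
      induction w generalizing π ρ with
      | nil => simp at hx
      | cons y w ih =>
        have hy : ∃ π ρ, (fun q => M.step q y) = blockPerm π ρ := by
          have hinj : Function.Injective fun q => M.step q y := by
            intro q r h
            apply (blockPerm π ρ).injective
            rw [← hw]
            simp only [DFA.evalFrom_cons]
            simp only at h
            rw [h]
          have hn : ∀ q, M.step q y = none → q = none := fun q hq =>
            hinj (hq.trans (hM.step_none y).symm)
          rw [← mapKind_eq_zero_iff (hstep y)]
          simp only [mapKind]
          rw [if_neg, if_neg, if_neg, if_neg, if_neg]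
          · exact not_not.2 fun a b h => by simpa using hinj h
          · exact not_not.2 fun a b h => by simpa using hinj h
          · rintro ⟨i, h⟩
            simpa using hn _ h
          · rintro ⟨i, f, h⟩
            have := congrFun hw (some (.inl i))
            simp only [DFA.evalFrom_cons, h, blockPerm_inl] at this
            exact hM.evalFrom_inr _ _ _ this
          · rintro ⟨i, h⟩
            simpa using hn _ h
        rcases List.mem_cons.1 hx with rfl | hx
        · exact hy
        · obtain ⟨π', ρ', hy⟩ := hy
          refine ih (π * π'⁻¹) (ρ * ρ'⁻¹) ?_ hx
          funext q
          have h3 := congrFun hw (blockPerm π'⁻¹ ρ'⁻¹ q)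
          simp only [DFA.evalFrom_cons] at h3
          rw [show M.step _ y = blockPerm π' ρ' (blockPerm π'⁻¹ ρ'⁻¹ q) from congrFun hy _] at h3
          rcases q with _ | i | f <;> simpa using h3
    -- With only one letter of kind 0, a swap in either block with the identity in the other would
    -- be a power of one pair (π, ρ).
    by_contra! hcon
    obtain ⟨wE, hwE⟩ := hword (blockPerm (Equiv.swap i0 i1) 1) ⟨rfl, by simp⟩
    obtain ⟨wF, hwF⟩ := hword (blockPerm 1 (Equiv.swap f0 f1)) ⟨rfl, by simp⟩
    have hpE := hperm _ _ _ hwE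
    have hpF := hperm _ _ _ hwF
    have hwE0 : wE ≠ [] := by
      rintro rfl
      have := congrFun hwE (some (.inl i0))
      simp [hi.symm] at this
    obtain ⟨x, hx⟩ := List.exists_mem_of_ne_nil _ hwE0
    have hx0 := hpE x hx
    obtain ⟨π, ρ, hπ⟩ := (mapKind_eq_zero_iff (hstep x)).1 hx0
    have hrep : ∀ w : List α, (∀ y ∈ w, mapKind (fun q => M.step q y) = 0) →
        ∀ q, M.evalFrom q w = blockPerm (π ^ w.length) (ρ ^ w.length) q := by
      intro w hw
      induction w with
      | nil => rintro (_ | i | f) <;> simp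
      | cons y w ih =>
        intro q
        have hyx : y = x := hcon y x (hw y (by simp)) hx0
        rw [DFA.evalFrom_cons, hyx, show M.step q x = blockPerm π ρ q from congrFun hπ q,
          ih fun y hy => hw y (by simp [hy])]
        rcases q with _ | i | f <;> simp [pow_succ]
    have hE1 : π ^ wE.length = Equiv.swap i0 i1 := by
      ext i
      have h3 := hrep wE hpE (some (.inl i))
      rw [show M.evalFrom (some (.inl i)) wE = _ from congrFun hwE _] at h3
      simp only [blockPerm_inl, Option.some.injEq, Sum.inl.injEq] at h3
      rw [h3]
    have hF1 : π ^ wF.length = 1 := by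
      ext i
      have h3 := hrep wF hpF (some (.inl i))
      rw [show M.evalFrom (some (.inl i)) wF = _ from congrFun hwF _] at h3
      simp only [blockPerm_inl, Option.some.injEq, Sum.inl.injEq] at h3
      rw [h3]
    have hF2 : ρ ^ wF.length = Equiv.swap f0 f1 := by
      ext i
      have h3 := hrep wF hpF (some (.inr i))
      rw [show M.evalFrom (some (.inr i)) wF = _ from congrFun hwF _] at h3
      simp only [blockPerm_inr, Option.some.injEq, Sum.inr.injEq] at h3
      rw [h3]
    -- The first equation makes π odd, so the second makes the length of `wF` even; then ρ to that
    -- power is even and cannot be a swap.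
    have s1 := congrArg Equiv.Perm.sign hE1
    have s2 := congrArg Equiv.Perm.sign hF1
    have s3 := congrArg Equiv.Perm.sign hF2
    rw [map_pow, Equiv.Perm.sign_swap hi.symm] at s1
    rw [map_pow, map_one] at s2
    rw [map_pow, Equiv.Perm.sign_swap hf.symm] at s3
    rcases Int.units_eq_one_or (Equiv.Perm.sign π) with h | h
    · rw [h, one_pow] at s1
      exact absurd s1 (by decide)
    · rw [h] at s2
      rcases Int.units_eq_one_or (Equiv.Perm.sign ρ) with h' | h'
      · rw [h', one_pow] at s3
        exact absurd s3 (by decide)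
      · rw [h', s2] at s3
        exact absurd s3 (by decide)
  have hnodup : [x1, x2, x3, x4, x5, x6, x7].Nodup := by
    have hne : ∀ x y, mapKind (fun q => M.step q x) ≠ mapKind (fun q => M.step q y) → x ≠ y := by
      rintro x y h rfl
      exact h rfl
    simp only [List.nodup_cons, List.mem_cons, not_or, List.not_mem_nil, not_false_eq_true,
      and_true, List.nodup_nil]
    refine ⟨⟨?_, ?_, ?_, ?_, ?_, ?_⟩, ⟨?_, ?_, ?_, ?_, ?_⟩, ⟨?_, ?_, ?_, ?_⟩, ⟨?_, ?_, ?_⟩,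
      ⟨?_, ?_⟩, h67⟩ <;> apply hne <;> simp only [hx1, hx2, hx3, hx4, hx5, hx6, hx7] <;> decide
  rcases finite_or_infinite α with h | h
  · have := Fintype.ofFinite α
    rw [ENat.card_eq_coe_fintype_card]
    exact_mod_cast hnodup.length_le_card
  · rw [ENat.card_eq_top_of_infinite]
    exact le_top

/-! ### Quotients -/

/-- From a final state only the k final states and the sink are reachable. -/
theorem complexity_quotient {α : Type u} {p k : ℕ} {M : DFA α (St p k)} (hM : ConvexDFA M)
    (hmin : IsMinimalDFA M) :
    (∀ Q ∈ quotients M.accepts, complexity Q ≤ (p + k + 1 : ℕ)) ∧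
      ∀ Q ∈ quotients M.accepts, [] ∈ Q → complexity Q ≤ (k + 1 : ℕ) := by
  rw [quotients_accepts M hmin.1]
  constructor
  · rintro _ ⟨q, rfl⟩
    refine (complexity_le_of_ker (fun w => M.evalFrom q w) Set.univ (fun _ => trivial) ?_).trans ?_
    · intro w w' h
      rw [leftQuotient_acceptsFrom, leftQuotient_acceptsFrom, h]
    · rw [Set.encard_univ, ENat.card_eq_coe_fintype_card]
      simp
  · rintro _ ⟨q, rfl⟩ hq
    obtain ⟨f, rfl⟩ := (hM.nil_mem_acceptsFrom q).1 hq
    refine (complexity_le_of_ker (fun w => M.evalFrom (some (.inr f)) w)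
      (Set.range (Option.map (Sum.inr : Fin k → Fin p ⊕ Fin k))) ?_ ?_).trans ?_
    · intro w
      rcases h : M.evalFrom (some (.inr f)) w with _ | i | f'
      · exact ⟨none, rfl⟩
      · exact absurd h (hM.evalFrom_inr _ _ _)
      · exact ⟨some f', rfl⟩
    · intro w w' h
      rw [leftQuotient_acceptsFrom, leftQuotient_acceptsFrom, h]
    · rw [← Set.image_univ]
      refine (Set.encard_image_le _ _).trans ?_
      rw [Set.encard_univ, ENat.card_eq_coe_fintype_card]
      simp

theorem complexity_acceptsFrom {α : Type u} {σ : Type} {M : DFA α σ} (hmin : IsMinimalDFA M)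
    (q : σ) : complexity (M.acceptsFrom q) = (Set.range (M.evalFrom q)).encard := by
  refine complexity_eq_of_ker _ fun w w' => ?_
  rw [leftQuotient_acceptsFrom, leftQuotient_acceptsFrom]
  exact ⟨fun h => hmin.2 _ _ h, fun h => by rw [h]⟩

theorem complexity_quotient_comap {β : Type} {p k : ℕ} [NeZero p] [NeZero k] {ρ : β → Letter}
    (hρ : fourLetters ⊆ Set.range ρ) :
    (∀ Q ∈ quotients ((W p k).comap ρ).accepts, Q ≠ ⊥ → [] ∉ Q →
      complexity Q = (p + k + 1 : ℕ)) ∧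
    ∀ Q ∈ quotients ((W p k).comap ρ).accepts, [] ∈ Q → complexity Q = (k + 1 : ℕ) := by
  have hM := (W_convex p k).comap ρ
  have hmin := isMinimalDFA_comap (p := p) (k := k) hρ
  rw [quotients_accepts _ hmin.1]
  constructor
  · rintro _ ⟨q, rfl⟩ hq hq'
    rw [complexity_acceptsFrom hmin]
    rcases q with _ | i | f
    · exact absurd hM.acceptsFrom_none hq
    · rw [Set.range_eq_univ.2 (exists_evalFrom_inl hρ i), Set.encard_univ,
        ENat.card_eq_coe_fintype_card]
      simp
    · exact absurd ((hM.nil_mem_acceptsFrom _).2 ⟨f, rfl⟩) hq'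
  · rintro _ ⟨q, rfl⟩ hq
    rw [complexity_acceptsFrom hmin]
    obtain ⟨f, rfl⟩ := (hM.nil_mem_acceptsFrom q).1 hq
    have : Set.range (((W p k).comap ρ).evalFrom (some (.inr f))) =
        Option.map (Sum.inr : Fin k → Fin p ⊕ Fin k) '' Set.univ := by
      ext q
      constructor
      · rintro ⟨w, rfl⟩
        rcases h : ((W p k).comap ρ).evalFrom (some (.inr f)) w with _ | i | f'
        · exact ⟨none, trivial, rfl⟩
        · exact absurd h (hM.evalFrom_inr _ _ _)
        · exact ⟨some f', trivial, rfl⟩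
      · rintro ⟨r, -, rfl⟩
        have ha : Letter.a ∈ fourLetters := by simp [fourLetters]
        have hb : Letter.b ∈ fourLetters := by simp [fourLetters]
        have hd : Letter.d₂ ∈ fourLetters := by simp [fourLetters]
        rcases r with _ | f'
        · obtain ⟨w, -, hw⟩ := (realizes_inr_none (p := p) (k := k) ha hb hd f).comap hρ
          exact ⟨w, by rw [hw]; simp⟩
        · obtain ⟨w, -, hw⟩ :=
            (realizes_blockPerm (p := p) (k := k) ha hb 1 (Equiv.swap f f')).comap hρ
          exact ⟨w, by rw [hw]; simp⟩
    rw [this, (Option.map_injective Sum.inr_injective).encard_image, Set.encard_univ,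
      ENat.card_eq_coe_fintype_card]
    simp

/-! ### Reversal and atoms -/

/-- The states other than the sink from which a word is accepted. -/
def finalSet {α : Type*} {p k : ℕ} (M : DFA α (St p k)) (w : List α) : Set (Fin p ⊕ Fin k) :=
  {z | M.evalFrom (some z) w ∈ M.accept}

section reverse

variable {α : Type u} {p k : ℕ} {M : DFA α (St p k)}

theorem finalSet_eq_iff (hM : ConvexDFA M) (w w' : List α) :
    finalSet M w = finalSet M w' ↔ ∀ q, M.evalFrom q w ∈ M.accept ↔ M.evalFrom q w' ∈ M.accept := by
  constructor
  · intro h q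
    rcases q with _ | z
    · rw [hM.evalFrom_none, hM.evalFrom_none]
    · exact Set.ext_iff.1 h z
  · intro h
    ext z
    exact h (some z)

/-- The quotient of the reversed language by w is determined by the set of states from which the
reverse of w is accepted, and as all states are reachable it determines this set. The sink never
belongs to it. -/
theorem complexity_reverse (hM : ConvexDFA M) (hmin : IsMinimalDFA M) :
    complexity M.accepts.reverse = (Set.range (finalSet M)).encard := by
  -- Reversal permutes the words, so the range does not change when it is inserted.
  rw [← List.reverse_surjective.range_comp]
  refine complexity_eq_of_ker _ fun w w' => ?_
  rw [Function.comp_apply, Function.comp_apply, finalSet_eq_iff hM]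
  have key : ∀ w x : List α, x ∈ M.accepts.reverse.leftQuotient w ↔
      M.evalFrom (M.eval x.reverse) w.reverse ∈ M.accept := by
    intro w x
    rw [Language.mem_leftQuotient, Language.mem_reverse, List.reverse_append, DFA.mem_accepts,
      DFA.eval, DFA.evalFrom_of_append]
  constructor
  · intro h q
    obtain ⟨x, rfl⟩ := hmin.1 q
    have := Set.ext_iff.1 h x.reverse
    have h2 : x.reverse ∈ M.accepts.reverse.leftQuotient w ↔
      x.reverse ∈ M.accepts.reverse.leftQuotient w' := this
    rwa [key, key, List.reverse_reverse] at h2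
  · intro h
    ext x
    rw [key, key]
    exact h _

/-- Two words lie in the same atom exactly when they are accepted from the same states, so the atoms
are the fibres of `finalSet`. -/
theorem encard_atoms (hM : ConvexDFA M) (hmin : IsMinimalDFA M) :
    (atoms M.accepts).encard = (Set.range (finalSet M)).encard := by
  have hatom : ∀ (S : Set (Language α)) (x y : List α), x ∈ atomicIntersection M.accepts S →
      (y ∈ atomicIntersection M.accepts S ↔ finalSet M y = finalSet M x) := by
    intro S x y hx
    rw [finalSet_eq_iff hM]
    simp only [atomicIntersection, quotients_accepts M hmin.1] at hx ⊢
    constructor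
    · intro hy q
      exact (hy _ ⟨q, rfl⟩).trans (hx _ ⟨q, rfl⟩).symm
    · rintro hy _ ⟨q, rfl⟩
      exact (hy q).trans (hx _ ⟨q, rfl⟩)
  let φ : Set (Fin p ⊕ Fin k) → Language α := fun Z => {y | finalSet M y = Z}
  have hset : atoms M.accepts = φ '' Set.range (finalSet M) := by
    ext A
    constructor
    · rintro ⟨hne, S, -, rfl⟩
      have hne' : ∃ x, x ∈ atomicIntersection M.accepts S := by
        by_contra! h
        exact hne (by ext x; exact ⟨fun hx => (h x hx).elim, fun hx => hx.elim⟩)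
      obtain ⟨x, hx⟩ := hne'
      refine ⟨_, ⟨x, rfl⟩, ?_⟩
      ext y
      exact (hatom S x y hx).symm
    · rintro ⟨_, ⟨x, rfl⟩, rfl⟩
      have hx : x ∈ atomicIntersection M.accepts {Q ∈ quotients M.accepts | x ∈ Q} :=
        fun K hK => ⟨fun h => ⟨hK, h⟩, fun h => h.2⟩
      refine ⟨fun h => ?_, {Q ∈ quotients M.accepts | x ∈ Q}, fun Q hQ => hQ.1, ?_⟩
      · have h1 : x ∈ (⊥ : Language α) := by
          rw [← h]
          exact rfl
        exact h1
      · ext y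
        exact (hatom _ x y hx).symm
  rw [hset, Set.InjOn.encard_image]
  rintro _ ⟨x, rfl⟩ _ ⟨y, rfl⟩ h
  have h1 : x ∈ φ (finalSet M x) := rfl
  rw [h] at h1
  exact h1

theorem encard_range_finalSet_le (M : DFA α (St p k)) :
    (Set.range (finalSet M)).encard ≤ (2 ^ (p + k) : ℕ) := by
  refine (Set.encard_le_encard (Set.subset_univ _)).trans ?_
  rw [Set.encard_univ, ENat.card_eq_coe_fintype_card]
  simp

end reverse

theorem exists_finalSet_eq {β : Type} {p k : ℕ} [NeZero p] [NeZero k] {ρ : β → Letter}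
    (hρ : fourLetters ⊆ Set.range ρ) (S : Set (Fin p ⊕ Fin k)) :
    ∃ w, finalSet ((W p k).comap ρ) w = S := by
  obtain ⟨w, hw⟩ := exists_word_final hρ S
  exact ⟨w, Set.ext fun z => hw z⟩

theorem encard_range_finalSet {β : Type} {p k : ℕ} [NeZero p] [NeZero k] {ρ : β → Letter}
    (hρ : fourLetters ⊆ Set.range ρ) :
    (Set.range (finalSet ((W p k).comap ρ))).encard = (2 ^ (p + k) : ℕ) := by
  rw [Set.range_eq_univ.2 (exists_finalSet_eq hρ), Set.encard_univ, ENat.card_eq_coe_fintype_card]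
  simp

end PrefixConvex

namespace PrefixConvex

/-! ### The complexity of atoms: counting -/

/-- Two pairs of sets of states, one pair in each block. -/
abbrev Quad (p k : ℕ) :=
  (Finset (Fin p) × Finset (Fin p)) × (Finset (Fin k) × Finset (Fin k))

theorem card_disjoint_pairs (n x y : ℕ) :
    (Finset.univ.filter fun P : Finset (Fin n) × Finset (Fin n) =>
      Disjoint P.1 P.2 ∧ P.1.card = x ∧ P.2.card = y).card = n.choose x * (n - x).choose y := by
  have : (Finset.univ.filter fun P : Finset (Fin n) × Finset (Fin n) =>
      Disjoint P.1 P.2 ∧ P.1.card = x ∧ P.2.card = y).card =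
      ((Finset.powersetCard x Finset.univ).sigma fun X : Finset (Fin n) =>
        Finset.powersetCard y Xᶜ).card := by
    refine Finset.card_bij' (fun P _ => ⟨P.1, P.2⟩) (fun P _ => (P.1, P.2)) ?_ ?_ ?_ ?_
    · rintro ⟨X, Y⟩ h
      simp only [Finset.mem_filter, Finset.mem_univ, true_and] at h
      simp only [Finset.mem_sigma, Finset.mem_powersetCard, Finset.subset_univ, true_and]
      exact ⟨h.2.1, Finset.subset_compl_iff_disjoint_left.2 h.1, h.2.2⟩
    · rintro ⟨X, Y⟩ h
      simp only [Finset.mem_sigma, Finset.mem_powersetCard, Finset.subset_univ, true_and] at h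
      simp only [Finset.mem_filter, Finset.mem_univ, true_and]
      exact ⟨Finset.subset_compl_iff_disjoint_left.1 h.2.1, h.1, h.2.2⟩
    · intros; rfl
    · intros; rfl
  rw [this, Finset.card_sigma, Finset.sum_congr rfl (g := fun _ => (n - x).choose y),
    Finset.sum_const, Finset.card_powersetCard, smul_eq_mul, Finset.card_univ, Fintype.card_fin]
  intro X hX
  rw [Finset.card_powersetCard, Finset.card_compl, Fintype.card_fin, (Finset.mem_powersetCard.1 hX).2]

/-- Fibring over the four cardinalities leaves a product of two counts of disjoint pairs, one in
each block. The ranges of x₂ and y₂ may depend on x₁ and y₁, as in the bound for atoms. -/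
theorem card_quads (p k : ℕ) (A : Finset ℕ) (B : ℕ → Finset ℕ) (C : Finset ℕ)
    (D' : ℕ → Finset ℕ) :
    (Finset.univ.filter fun Q : Quad p k =>
      (Disjoint Q.1.1 Q.1.2 ∧ Disjoint Q.2.1 Q.2.2) ∧ Q.1.1.card ∈ A ∧ Q.2.1.card ∈ B Q.1.1.card ∧
        Q.1.2.card ∈ C ∧ Q.2.2.card ∈ D' Q.1.2.card).card =
    ∑ x₁ ∈ A, ∑ x₂ ∈ B x₁, ∑ y₁ ∈ C, ∑ y₂ ∈ D' y₁,
      p.choose x₁ * k.choose x₂ * (p - x₁).choose y₁ * (k - x₂).choose y₂ := by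
  let t : Finset (Σ _ : ℕ, Σ _ : ℕ, Σ _ : ℕ, ℕ) :=
    A.sigma fun x₁ => (B x₁).sigma fun _ => C.sigma fun y₁ => D' y₁
  rw [Finset.card_eq_sum_card_fiberwise (t := t)
    (f := fun Q => ⟨Q.1.1.card, Q.2.1.card, Q.1.2.card, Q.2.2.card⟩)]
  · simp only [t]
    rw [Finset.sum_sigma]
    refine Finset.sum_congr rfl fun x₁ hx₁ => ?_
    rw [Finset.sum_sigma]
    refine Finset.sum_congr rfl fun x₂ hx₂ => ?_
    rw [Finset.sum_sigma]
    refine Finset.sum_congr rfl fun y₁ hy₁ => ?_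
    refine Finset.sum_congr rfl fun y₂ hy₂ => ?_
    have e : p.choose x₁ * k.choose x₂ * (p - x₁).choose y₁ * (k - x₂).choose y₂ =
        (p.choose x₁ * (p - x₁).choose y₁) * (k.choose x₂ * (k - x₂).choose y₂) := by ring
    rw [e, ← card_disjoint_pairs, ← card_disjoint_pairs, ← Finset.card_product]
    congr 1
    ext ⟨⟨X₁, Y₁⟩, ⟨X₂, Y₂⟩⟩
    simp only [Finset.mem_filter, Finset.mem_univ, true_and, Finset.mem_product, Sigma.mk.injEq,
      heq_eq_eq]
    constructor
    · rintro ⟨⟨⟨h1, h2⟩, -⟩, rfl, rfl, rfl, rfl⟩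
      exact ⟨⟨h1, rfl, rfl⟩, h2, rfl, rfl⟩
    · rintro ⟨⟨h1, rfl, rfl⟩, h2, rfl, rfl⟩
      exact ⟨⟨⟨h1, h2⟩, hx₁, hx₂, hy₁, hy₂⟩, rfl, rfl, rfl, rfl⟩
  · intro Q hQ
    have hQ := (Finset.mem_filter.1 hQ).2.2
    simp only [t, Finset.coe_sigma, Set.mem_sigma_iff, Finset.mem_coe]
    exact hQ

/-- The quadruples that arise as images of an atom with `s₁` non-final and `s₂` final elements. -/
def validQuads (p k s₁ s₂ : ℕ) : Finset (Quad p k) :=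
  Finset.univ.filter fun Q =>
    (Disjoint Q.1.1 Q.1.2 ∧ Disjoint Q.2.1 Q.2.2) ∧
      (Q.1.1.card ≤ s₁ ∧ Q.1.1.card + Q.2.1.card ≤ s₁ + s₂) ∧
      (Q.1.2.card ≤ p - s₁ ∧ Q.1.2.card + Q.2.2.card ≤ (p - s₁) + (k - s₂)) ∧
      (s₂ ≠ 0 → Q.2.1.card ≠ 0) ∧ (s₁ ≠ 0 → Q.1.1.card ≠ 0 ∨ Q.2.1.card ≠ 0)

theorem sum_Icc_choose (n : ℕ) : ∑ y ∈ Finset.Icc 0 n, n.choose y = 2 ^ n := by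
  rw [← Nat.range_succ_eq_Icc_zero, Nat.sum_range_choose]

/-- Turns the sums into a count of quadruples. The additional 1 is the empty quotient, which occurs
unless S is empty: then no word can bring S to the sink. -/
theorem atomBound_eq (p k s₁ s₂ : ℕ) (h₁ : s₁ ≤ p) (h₂ : s₂ ≤ k) :
    atomBound (p + k + 1) k s₁ s₂ =
      (validQuads p k s₁ s₂).card + if s₁ = 0 ∧ s₂ = 0 then 0 else 1 := by
  have e : p + k + 1 - 1 - k = p := by omega
  have card_le : ∀ {n} (X : Finset (Fin n)), X.card ≤ n := fun X => by
    simpa using Finset.card_le_univ X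
  simp only [atomBound, e]
  by_cases hs2 : s₂ = 0
  · have hmin : ∀ (Q : Quad p k), Q.2.1.card ≤ k ∧ Q.2.2.card ≤ k ∧ Q.1.1.card ≤ p ∧ Q.1.2.card ≤ p :=
      fun Q => ⟨card_le _, card_le _, card_le _, card_le _⟩
    subst hs2
    -- This counts the quadruples with x₁ = x₂ = 0. They are the whole count for S = ∅ and the
    -- subtracted part when S has only non-final elements.
    have h0 := card_quads p k {0} (fun _ => {0}) (Finset.Icc 0 (p - s₁)) (fun _ => Finset.Icc 0 k)
    simp only [Finset.sum_singleton, Nat.choose_zero_right, mul_one, Nat.sub_zero, one_mul,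
      ← Finset.mul_sum, sum_Icc_choose, ← Finset.sum_mul] at h0
    by_cases hs1 : s₁ = 0
    · subst hs1
      simp only [ne_eq, not_true_eq_false, if_false, and_self, if_true, Nat.sub_zero, add_zero]
        at h0 ⊢
      rw [sum_Icc_choose, ← pow_add] at h0
      rw [show p + k + 1 - 1 = p + k by omega, ← h0]
      congr 1
      ext Q
      have := hmin Q
      simp only [validQuads, Finset.mem_filter, Finset.mem_univ, true_and, Finset.mem_singleton,
        Finset.mem_Icc]
      refine and_congr_right fun _ => ?_
      omega
    · have h1 := card_quads p k (Finset.Icc 0 s₁) (fun x₁ => Finset.Icc 0 (s₁ - x₁))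
        (Finset.Icc 0 (p - s₁)) (fun _ => Finset.Icc 0 k)
      rw [if_neg (by simp), if_pos hs1, ← h1, mul_comm, ← h0, if_neg (by tauto)]
      rw [add_comm 1]
      rw [Nat.sub_eq_iff_eq_add]
      · rw [add_right_comm]
        congr 1
        -- All quadruples in the sum are the valid ones together with those whose first sets are
        -- empty.
        rw [← Finset.card_union_of_disjoint]
        · congr 1
          ext Q
          have := hmin Q
          simp only [validQuads, Finset.mem_filter, Finset.mem_univ, true_and, Finset.mem_singleton,
            Finset.mem_Icc, Finset.mem_union]
          rw [← and_or_left]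
          refine and_congr_right fun _ => ?_
          omega
        · rw [Finset.disjoint_left]
          intro Q h2 h3
          simp only [validQuads, Finset.mem_filter, Finset.mem_univ, true_and,
            Finset.mem_singleton] at h2 h3
          omega
      · refine (Finset.card_le_card ?_).trans (Nat.le_succ _)
        intro Q
        simp only [Finset.mem_filter, Finset.mem_univ, true_and, Finset.mem_singleton,
            Finset.mem_Icc]
        rintro ⟨h1, h2, h3, h4, h5⟩
        exact ⟨h1, by omega⟩
  · have h1 := card_quads p k (Finset.Icc 0 s₁) (fun x₁ => Finset.Icc 1 (s₁ + s₂ - x₁))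
      (Finset.Icc 0 (p - s₁)) (fun y₁ => Finset.Icc 0 (p - s₁ + (k - s₂) - y₁))
    rw [if_pos hs2, ← h1, if_neg (by tauto), add_comm 1]
    congr 2
    ext Q
    simp only [validQuads, Finset.mem_filter, Finset.mem_univ, true_and, Finset.mem_Icc]
    refine and_congr_right fun _ => ?_
    omega

/-! ### Images of sets of states -/

section images

variable {p k : ℕ}

/-- The non-final states in the image of a set of non-final states. -/
def imgL (t : St p k → St p k) (A₁ : Finset (Fin p)) : Finset (Fin p) :=
  Finset.univ.filter fun i => ∃ j ∈ A₁, t (some (.inl j)) = some (.inl i)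

/-- The final states in the image of a set of states. -/
def imgR (t : St p k → St p k) (A₁ : Finset (Fin p)) (A₂ : Finset (Fin k)) : Finset (Fin k) :=
  Finset.univ.filter fun f => (∃ j ∈ A₁, t (some (.inl j)) = some (.inr f)) ∨
    ∃ g ∈ A₂, t (some (.inr g)) = some (.inr f)

theorem mem_imgL {t : St p k → St p k} {A₁ : Finset (Fin p)} {i : Fin p} :
    i ∈ imgL t A₁ ↔ ∃ j ∈ A₁, t (some (.inl j)) = some (.inl i) := by
  simp [imgL]

theorem mem_imgR {t : St p k → St p k} {A₁ : Finset (Fin p)} {A₂ : Finset (Fin k)} {f : Fin k} :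
    f ∈ imgR t A₁ A₂ ↔ (∃ j ∈ A₁, t (some (.inl j)) = some (.inr f)) ∨
      ∃ g ∈ A₂, t (some (.inr g)) = some (.inr f) := by
  simp [imgR]

theorem card_imgL_le (t : St p k → St p k) (A₁ : Finset (Fin p)) :
    (imgL t A₁).card ≤ A₁.card := by
  rw [← Finset.card_image_of_injective (imgL t A₁)
    (f := fun i => (some (.inl i) : St p k)) (fun a b h => by simpa using h)]
  refine (Finset.card_le_card (t := A₁.image fun j => t (some (.inl j))) ?_).trans
    Finset.card_image_le
  intro x hx
  obtain ⟨i, hi, rfl⟩ := Finset.mem_image.1 hx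
  obtain ⟨j, hj, h⟩ := mem_imgL.1 hi
  exact Finset.mem_image.2 ⟨j, hj, h⟩

theorem card_imgL_add_card_imgR_le (t : St p k → St p k) (A₁ : Finset (Fin p))
    (A₂ : Finset (Fin k)) :
    (imgL t A₁).card + (imgR t A₁ A₂).card ≤ A₁.card + A₂.card := by
  rw [← Finset.card_disjSum, ← Finset.card_disjSum,
    ← Finset.card_image_of_injective (Finset.disjSum (imgL t A₁) _)
      (f := fun z => (some z : St p k)) (fun a b h => by simpa using h)]
  refine (Finset.card_le_card (t := (A₁.disjSum A₂).image fun j => t (some j)) ?_).trans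
    Finset.card_image_le
  intro x hx
  obtain ⟨z, hz, rfl⟩ := Finset.mem_image.1 hx
  rcases Finset.mem_disjSum.1 hz with ⟨i, hi, rfl⟩ | ⟨f, hf, rfl⟩
  · obtain ⟨j, hj, h⟩ := mem_imgL.1 hi
    exact Finset.mem_image.2 ⟨.inl j, by simpa using hj, h⟩
  · rcases mem_imgR.1 hf with ⟨j, hj, h⟩ | ⟨j, hj, h⟩
    · exact Finset.mem_image.2 ⟨.inl j, by simpa using hj, h⟩
    · exact Finset.mem_image.2 ⟨.inr j, by simpa using hj, h⟩

/-- A left inverse of an embedding of B into A is onto B. The value `none` is used only outside A.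
-/
theorem exists_map_onto {α β : Type*} (A : Finset α) (B : Finset β) (h : B.card ≤ A.card)
    (h0 : A ≠ ∅ → B ≠ ∅) :
    ∃ f : α → Option β, (∀ a ∈ A, ∃ b ∈ B, f a = some b) ∧ ∀ b ∈ B, ∃ a ∈ A, f a = some b := by
  classical
  by_cases hB : B = ∅
  · have hA : A = ∅ := by
      by_contra hA
      exact h0 hA hB
    subst hA hB
    exact ⟨fun _ => none, by simp, by simp⟩
  · obtain ⟨b0, hb0⟩ := Finset.nonempty_iff_ne_empty.2 hB
    obtain ⟨e⟩ : Nonempty (B ↪ A) := Function.Embedding.nonempty_of_card_le (by simpa using h)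
    have : Nonempty B := ⟨⟨b0, hb0⟩⟩
    have hs := Function.invFun_surjective e.injective
    refine ⟨fun a => if ha : a ∈ A then some (Function.invFun e ⟨a, ha⟩).1 else none, ?_, ?_⟩
    · intro a ha
      exact ⟨_, (Function.invFun e ⟨a, ha⟩).2, by simp [ha]⟩
    · intro b hb
      obtain ⟨⟨a, ha⟩, hab⟩ := hs ⟨b, hb⟩
      exact ⟨a, ha, by simp [ha, hab]⟩

/-- Sets of states with the right cardinalities are images. -/
theorem exists_map_img {A₁ B₁ : Finset (Fin p)} {A₂ B₂ : Finset (Fin k)} (h1 : B₁.card ≤ A₁.card)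
    (h2 : B₁.card + B₂.card ≤ A₁.card + A₂.card) :
    ∃ t : St p k → St p k, (∀ f i, t (some (.inr f)) ≠ some (.inl i)) ∧ imgL t A₁ = B₁ ∧
      imgR t A₁ A₂ = B₂ ∧
      ((A₂.card ≠ 0 → B₂.card ≠ 0) → (A₁.card ≠ 0 → B₁.card ≠ 0 ∨ B₂.card ≠ 0) →
        (∀ i ∈ A₁, t (some (.inl i)) ≠ none) ∧ ∀ f ∈ A₂, t (some (.inr f)) ≠ none) := by
  by_cases hB2 : B₂ = ∅
  · subst hB2
    by_cases hB1 : B₁ = ∅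
    · subst hB1
      refine ⟨fun _ => none, by simp, by ext; simp [mem_imgL], by ext; simp [mem_imgR], ?_⟩
      intro h3 h4
      have hA1 : A₁ = ∅ := by simpa using h4
      have hA2 : A₂ = ∅ := by simpa using h3
      simp [hA1, hA2]
    · obtain ⟨g, hg1, hg2⟩ := exists_map_onto A₁ B₁ h1 fun _ => hB1
      let t : St p k → St p k := fun q => match q with
        | some (.inl i) => (g i).map .inl
        | _ => none
      refine ⟨t, by simp [t], ?_, ?_, ?_⟩
      · ext i
        rw [mem_imgL]
        constructor
        · rintro ⟨j, hj, h⟩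
          obtain ⟨b, hb, hb'⟩ := hg1 j hj
          simp only [t, hb', Option.map_some, Option.some.injEq, Sum.inl.injEq] at h
          rwa [← h]
        · intro hi
          obtain ⟨j, hj, h⟩ := hg2 i hi
          exact ⟨j, hj, by simp [t, h]⟩
      · ext f
        simp [mem_imgR, t]
      · intro h3 h4
        have hA2 : A₂ = ∅ := by simpa using h3
        refine ⟨fun i hi => ?_, by simp [hA2]⟩
        obtain ⟨b, hb, hb'⟩ := hg1 i hi
        simp [t, hb']
  -- Exactly as many elements of A₁ as B₁ has are used to cover B₁; the rest of A₁ together with A₂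
  -- is numerous enough to cover B₂.
  · obtain ⟨A', hA', hA'c⟩ := Finset.exists_subset_card_eq h1
    obtain ⟨g, hg1, hg2⟩ := exists_map_onto A' B₁ hA'c.ge (by
      intro h h'
      rw [h', Finset.card_empty, Finset.card_eq_zero] at hA'c
      exact h hA'c)
    obtain ⟨g', hg1', hg2'⟩ := exists_map_onto ((A₁ \ A').disjSum A₂) B₂ (by
      rw [Finset.card_disjSum, Finset.card_sdiff_of_subset hA', hA'c]
      omega) fun _ => hB2
    let t : St p k → St p k := fun q => match q with
      | some (.inl i) => if i ∈ A' then (g i).map .inl else (g' (.inl i)).map .inr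
      | some (.inr f) => (g' (.inr f)).map .inr
      | none => none
    refine ⟨t, ?_, ?_, ?_, ?_⟩
    · intro f i
      simp [t]
    · ext i
      rw [mem_imgL]
      constructor
      · rintro ⟨j, hj, h⟩
        by_cases hjA : j ∈ A'
        · obtain ⟨b, hb, hb'⟩ := hg1 j hjA
          simp only [t, hjA, if_true, hb', Option.map_some, Option.some.injEq, Sum.inl.injEq] at h
          rwa [← h]
        · simp [t, hjA] at h
      · intro hi
        obtain ⟨j, hj, h⟩ := hg2 i hi
        exact ⟨j, hA' hj, by simp [t, h, hj]⟩
    · ext f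
      rw [mem_imgR]
      constructor
      · rintro (⟨j, hj, h⟩ | ⟨j, hj, h⟩)
        · by_cases hjA : j ∈ A'
          · simp [t, hjA] at h
          · obtain ⟨b, hb, hb'⟩ := hg1' (.inl j) (by simp [hj, hjA])
            simp only [t, hjA, if_false, hb', Option.map_some, Option.some.injEq,
              Sum.inr.injEq] at h
            rwa [← h]
        · obtain ⟨b, hb, hb'⟩ := hg1' (.inr j) (by simp [hj])
          simp only [t, hb', Option.map_some, Option.some.injEq, Sum.inr.injEq] at h
          rwa [← h]
      · intro hf
        obtain ⟨z, hz, h⟩ := hg2' f hf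
        rcases z with j | j
        · simp only [Finset.inl_mem_disjSum, Finset.mem_sdiff] at hz
          exact Or.inl ⟨j, hz.1, by simp [t, hz.2, h]⟩
        · simp only [Finset.inr_mem_disjSum] at hz
          exact Or.inr ⟨j, hz, by simp [t, h]⟩
    · intro _ _
      constructor
      · intro i hi
        by_cases hiA : i ∈ A'
        · obtain ⟨b, hb, hb'⟩ := hg1 i hiA
          simp [t, hiA, hb']
        · obtain ⟨b, hb, hb'⟩ := hg1' (.inl i) (by simp [hi, hiA])
          simp [t, hiA, hb']
      · intro f hf
        obtain ⟨b, hb, hb'⟩ := hg1' (.inr f) (by simp [hf])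
        simp [t, hb']

open Classical in
/-- The images of `Z₁ ∪ Z₂` and of its complement, if they are disjoint. -/
noncomputable def quadOf (Z₁ : Finset (Fin p)) (Z₂ : Finset (Fin k)) (t : St p k → St p k) :
    Option (Quad p k) :=
  if ((∀ i ∈ Z₁, t (some (.inl i)) ≠ none) ∧ ∀ f ∈ Z₂, t (some (.inr f)) ≠ none) ∧
      Disjoint (imgL t Z₁) (imgL t Z₁ᶜ) ∧ Disjoint (imgR t Z₁ Z₂) (imgR t Z₁ᶜ Z₂ᶜ) then
    some ((imgL t Z₁, imgL t Z₁ᶜ), (imgR t Z₁ Z₂, imgR t Z₁ᶜ Z₂ᶜ))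
  else none

/-- Images cannot grow, and non-final states arise only from non-final ones. As no state of Z₁ ∪ Z₂
may go to the sink, a final element leaves a final image and any element leaves some image; no such
demand is made of the complement. -/
theorem quadOf_mem {Z₁ : Finset (Fin p)} {Z₂ : Finset (Fin k)} {t : St p k → St p k}
    (ht : IsConvexMap t) {Q : Quad p k} (h : quadOf Z₁ Z₂ t = some Q) :
    Q ∈ validQuads p k Z₁.card Z₂.card := by
  unfold quadOf at h
  split_ifs at h with hc
  obtain rfl := (Option.some.inj h).symm
  have h1 := card_imgL_le t Z₁
  have h2 := card_imgL_le t Z₁ᶜ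
  have h3 := card_imgL_add_card_imgR_le t Z₁ Z₂
  have h4 := card_imgL_add_card_imgR_le t Z₁ᶜ Z₂ᶜ
  rw [Finset.card_compl, Fintype.card_fin] at h2
  rw [Finset.card_compl, Finset.card_compl, Fintype.card_fin, Fintype.card_fin] at h4
  simp only [validQuads, Finset.mem_filter, Finset.mem_univ, true_and]
  refine ⟨hc.2, ⟨h1, h3⟩, ⟨h2, h4⟩, ?_, ?_⟩
  · intro hZ
    obtain ⟨f, hf⟩ := Finset.card_ne_zero.1 hZ
    apply Finset.card_ne_zero.2
    rcases h : t (some (.inr f)) with _ | i | g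
    · exact absurd h (hc.1.2 f hf)
    · exact absurd h (ht.2 f i)
    · exact ⟨g, mem_imgR.2 (Or.inr ⟨f, hf, h⟩)⟩
  · intro hZ
    obtain ⟨f, hf⟩ := Finset.card_ne_zero.1 hZ
    simp only [Finset.card_ne_zero]
    rcases h : t (some (.inl f)) with _ | i | g
    · exact absurd h (hc.1.1 f hf)
    · exact Or.inl ⟨i, mem_imgL.2 ⟨f, hf, h⟩⟩
    · exact Or.inr ⟨g, mem_imgR.2 (Or.inl ⟨f, hf, h⟩)⟩

/-- The map may be chosen independently on Z₁ ∪ Z₂ and on its complement, and only on the former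
does it have to avoid the sink. -/
theorem exists_quadOf_eq {Z₁ : Finset (Fin p)} {Z₂ : Finset (Fin k)} {Q : Quad p k}
    (hQ : Q ∈ validQuads p k Z₁.card Z₂.card) :
    ∃ t, IsConvexMap t ∧ quadOf Z₁ Z₂ t = some Q := by
  classical
  obtain ⟨⟨X₁, Y₁⟩, ⟨X₂, Y₂⟩⟩ := Q
  simp only [validQuads, Finset.mem_filter, Finset.mem_univ, true_and] at hQ
  obtain ⟨hd, ⟨h1, h2⟩, ⟨h3, h4⟩, h5, h6⟩ := hQ
  obtain ⟨t, ht, ht1, ht2, ht3⟩ := exists_map_img (A₁ := Z₁) (A₂ := Z₂) h1 h2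
  obtain ⟨s, hs, hs1, hs2, -⟩ := exists_map_img (A₁ := Z₁ᶜ) (A₂ := Z₂ᶜ) (B₁ := Y₁) (B₂ := Y₂)
    (by rwa [Finset.card_compl, Fintype.card_fin])
    (by rwa [Finset.card_compl, Finset.card_compl, Fintype.card_fin, Fintype.card_fin])
  have ht3 := ht3 h5 h6
  let r : St p k → St p k := fun q => match q with
    | some (.inl i) => if i ∈ Z₁ then t (some (.inl i)) else s (some (.inl i))
    | some (.inr f) => if f ∈ Z₂ then t (some (.inr f)) else s (some (.inr f))
    | none => none
  have e1 : ∀ i ∈ Z₁, r (some (.inl i)) = t (some (.inl i)) := fun i hi => by simp [r, hi]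
  have e2 : ∀ i ∈ Z₁ᶜ, r (some (.inl i)) = s (some (.inl i)) := fun i hi => by
    rw [Finset.mem_compl] at hi
    simp [r, hi]
  have e3 : ∀ i ∈ Z₂, r (some (.inr i)) = t (some (.inr i)) := fun i hi => by simp [r, hi]
  have e4 : ∀ i ∈ Z₂ᶜ, r (some (.inr i)) = s (some (.inr i)) := fun i hi => by
    rw [Finset.mem_compl] at hi
    simp [r, hi]
  have cL : ∀ {A : Finset (Fin p)} {u v : St p k → St p k},
      (∀ i ∈ A, u (some (.inl i)) = v (some (.inl i))) → imgL u A = imgL v A := by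
    intro A u v h
    ext i
    rw [mem_imgL, mem_imgL]
    exact exists_congr fun j => and_congr_right fun hj => by rw [h j hj]
  have cR : ∀ {A : Finset (Fin p)} {B : Finset (Fin k)} {u v : St p k → St p k},
      (∀ i ∈ A, u (some (.inl i)) = v (some (.inl i))) →
      (∀ i ∈ B, u (some (.inr i)) = v (some (.inr i))) → imgR u A B = imgR v A B := by
    intro A B u v h h'
    ext i
    rw [mem_imgR, mem_imgR]
    exact or_congr (exists_congr fun j => and_congr_right fun hj => by rw [h j hj])
      (exists_congr fun j => and_congr_right fun hj => by rw [h' j hj])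
  refine ⟨r, ⟨rfl, fun f i => ?_⟩, ?_⟩
  · by_cases hf : f ∈ Z₂
    · rw [e3 f hf]
      exact ht f i
    · rw [e4 f (Finset.mem_compl.2 hf)]
      exact hs f i
  · rw [quadOf, cL e1, cL e2, cR e1 e3, cR e2 e4, ht1, ht2, hs1, hs2, if_pos]
    exact ⟨⟨fun i hi => by rw [e1 i hi]; exact ht3.1 i hi,
      fun i hi => by rw [e3 i hi]; exact ht3.2 i hi⟩, hd⟩

theorem quadOf_const_none {Z₁ : Finset (Fin p)} {Z₂ : Finset (Fin k)}
    (h : ¬ (Z₁.card = 0 ∧ Z₂.card = 0)) : quadOf Z₁ Z₂ (fun _ => none) = none := by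
  rw [quadOf, if_neg]
  rintro ⟨⟨h1, h2⟩, -⟩
  apply h
  constructor
  · rw [Finset.card_eq_zero]
    exact Finset.eq_empty_of_forall_notMem fun i hi => h1 i hi rfl
  · rw [Finset.card_eq_zero]
    exact Finset.eq_empty_of_forall_notMem fun i hi => h2 i hi rfl

theorem quadOf_empty_ne_none (t : St p k → St p k) : quadOf ∅ ∅ t ≠ none := by
  rw [quadOf, if_pos]
  · simp
  · have h1 : imgL t ∅ = ∅ := by ext; simp [mem_imgL]
    have h2 : imgR t ∅ ∅ = ∅ := by ext; simp [mem_imgR]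
    simp [h1, h2]

/-- The possible values of `quadOf`. -/
def quadValues (p k s₁ s₂ : ℕ) : Set (Option (Quad p k)) :=
  {o | (∀ Q, o = some Q → Q ∈ validQuads p k s₁ s₂) ∧ (o = none → ¬ (s₁ = 0 ∧ s₂ = 0))}

theorem some_mem_quadValues {s₁ s₂ : ℕ} {Q : Quad p k} :
    some Q ∈ quadValues p k s₁ s₂ ↔ Q ∈ validQuads p k s₁ s₂ := by
  refine ⟨fun h => h.1 Q rfl, fun h => ⟨?_, by simp⟩⟩
  rintro Q' h'
  rwa [← Option.some.inj h']

theorem encard_quadValues (s₁ s₂ : ℕ) (h₁ : s₁ ≤ p) (h₂ : s₂ ≤ k) :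
    (quadValues p k s₁ s₂).encard = (atomBound (p + k + 1) k s₁ s₂ : ℕ∞) := by
  rw [atomBound_eq p k s₁ s₂ h₁ h₂]
  have hsome : (some '' (validQuads p k s₁ s₂ : Set (Quad p k))).encard =
      ((validQuads p k s₁ s₂).card : ℕ∞) := by
    rw [(Option.some_injective _).encard_image, Set.encard_coe_eq_coe_finsetCard]
  split_ifs with h
  · rw [add_zero, ← hsome]
    congr 1
    ext o
    rcases o with _ | Q
    · simp [quadValues, h]
    · rw [some_mem_quadValues, (Option.some_injective _).mem_set_image, Finset.mem_coe]
  · rw [Nat.cast_add, ← hsome, Nat.cast_one, ← Set.encard_insert_of_notMem (a := none) (by simp)]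
    congr 1
    ext o
    rcases o with _ | Q
    · simp [quadValues]
      tauto
    · rw [some_mem_quadValues, Set.mem_insert_iff, (Option.some_injective _).mem_set_image,
        Finset.mem_coe]
      simp

theorem quadOf_mem_quadValues {Z₁ : Finset (Fin p)} {Z₂ : Finset (Fin k)} {t : St p k → St p k}
    (ht : IsConvexMap t) : quadOf Z₁ Z₂ t ∈ quadValues p k Z₁.card Z₂.card := by
  refine ⟨fun Q hQ => quadOf_mem ht hQ, ?_⟩
  rintro h ⟨h1, h2⟩
  rw [Finset.card_eq_zero] at h1 h2
  subst h1 h2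
  exact quadOf_empty_ne_none t h

end images

/-! ### The complexity of atoms -/

section atoms

variable {α : Type u} {p k : ℕ} {M : DFA α (St p k)}

/-- After w, a word x must be accepted from the images of the states in S and rejected from those of
the others. This is impossible if the images meet or if a state of S went to the sink; otherwise
only the two images matter. -/
theorem mem_leftQuotient_atom (hM : ConvexDFA M) (hmin : IsMinimalDFA M) {S : Set (Language α)}
    {Z₁ : Finset (Fin p)} {Z₂ : Finset (Fin k)} (h1 : ∀ i, M.acceptsFrom (some (.inl i)) ∈ S ↔ i ∈ Z₁)
    (h2 : ∀ f, M.acceptsFrom (some (.inr f)) ∈ S ↔ f ∈ Z₂) (h3 : M.acceptsFrom none ∉ S)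
    (w x : List α) :
    x ∈ (atomicIntersection M.accepts S).leftQuotient w ↔
      ∃ Q, quadOf Z₁ Z₂ (fun q => M.evalFrom q w) = some Q ∧
        ((∀ i ∈ Q.1.1, .inl i ∈ finalSet M x) ∧ ∀ f ∈ Q.2.1, .inr f ∈ finalSet M x) ∧
        ((∀ i ∈ Q.1.2, .inl i ∉ finalSet M x) ∧ ∀ f ∈ Q.2.2, .inr f ∉ finalSet M x) := by
  have hnone : ∀ v, M.evalFrom none v ∉ M.accept := by
    intro v hv
    rw [hM.evalFrom_none, hM.accept] at hv
    simp at hv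
  have key : x ∈ (atomicIntersection M.accepts S).leftQuotient w ↔
      (∀ i, M.evalFrom (M.evalFrom (some (.inl i)) w) x ∈ M.accept ↔ i ∈ Z₁) ∧
      ∀ f, M.evalFrom (M.evalFrom (some (.inr f)) w) x ∈ M.accept ↔ f ∈ Z₂ := by
    simp only [← h1, ← h2, ← DFA.evalFrom_of_append]
    change (∀ K ∈ quotients M.accepts, w ++ x ∈ K ↔ K ∈ S) ↔ _
    rw [quotients_accepts M hmin.1]
    constructor
    · intro h
      exact ⟨fun i => h _ ⟨_, rfl⟩, fun i => h _ ⟨_, rfl⟩⟩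
    · rintro ⟨ha, hb⟩ _ ⟨q, rfl⟩
      rcases q with _ | i | f
      · exact iff_of_false (hnone _) h3
      · exact ha i
      · exact hb f
  have hconv := hM.isConvexMap w
  rw [key]
  generalize ht : (fun q => M.evalFrom q w) = t at hconv
  simp only [show ∀ q, M.evalFrom q w = t q from fun q => congrFun ht q]
  have hL : ∀ {A : Finset (Fin p)} {j i}, j ∈ A → t (some (.inl j)) = some (.inl i) →
      i ∈ imgL t A := fun hj h => mem_imgL.2 ⟨_, hj, h⟩
  constructor
  · rintro ⟨ha, hb⟩
    have a1 : ∀ i ∈ imgL t Z₁, .inl i ∈ finalSet M x := by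
      intro i hi
      obtain ⟨j, hj, h⟩ := mem_imgL.1 hi
      have := (ha j).2 hj
      rwa [h] at this
    have a2 : ∀ i ∈ imgR t Z₁ Z₂, .inr i ∈ finalSet M x := by
      intro i hi
      rcases mem_imgR.1 hi with ⟨j, hj, h⟩ | ⟨j, hj, h⟩
      · have := (ha j).2 hj
        rwa [h] at this
      · have := (hb j).2 hj
        rwa [h] at this
    have a3 : ∀ i ∈ imgL t Z₁ᶜ, .inl i ∉ finalSet M x := by
      intro i hi
      obtain ⟨j, hj, h⟩ := mem_imgL.1 hi
      have := mt (ha j).1 (Finset.mem_compl.1 hj)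
      rwa [h] at this
    have a4 : ∀ i ∈ imgR t Z₁ᶜ Z₂ᶜ, .inr i ∉ finalSet M x := by
      intro i hi
      rcases mem_imgR.1 hi with ⟨j, hj, h⟩ | ⟨j, hj, h⟩
      · have := mt (ha j).1 (Finset.mem_compl.1 hj)
        rwa [h] at this
      · have := mt (hb j).1 (Finset.mem_compl.1 hj)
        rwa [h] at this
    refine ⟨_, if_pos ⟨⟨?_, ?_⟩, ?_, ?_⟩, ⟨a1, a2⟩, a3, a4⟩
    · intro i hi h
      have := (ha i).2 hi
      rw [h] at this
      exact hnone _ this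
    · intro i hi h
      have := (hb i).2 hi
      rw [h] at this
      exact hnone _ this
    · exact Finset.disjoint_left.2 fun i hi hi' => a3 i hi' (a1 i hi)
    · exact Finset.disjoint_left.2 fun i hi hi' => a4 i hi' (a2 i hi)
  · rintro ⟨Q, hQ, ⟨a1, a2⟩, a3, a4⟩
    unfold quadOf at hQ
    split_ifs at hQ with hc
    obtain rfl := (Option.some.inj hQ).symm
    simp only at a1 a2 a3 a4
    constructor
    · intro j
      by_cases hj : j ∈ Z₁
      · refine iff_of_true ?_ hj
        rcases h : t (some (.inl j)) with _ | i | f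
        · exact absurd h (hc.1.1 j hj)
        · exact a1 i (hL hj h)
        · exact a2 f (mem_imgR.2 (Or.inl ⟨j, hj, h⟩))
      · refine iff_of_false ?_ hj
        rw [← Finset.mem_compl] at hj
        rcases h : t (some (.inl j)) with _ | i | f
        · exact hnone x
        · exact a3 i (hL hj h)
        · exact a4 f (mem_imgR.2 (Or.inl ⟨j, hj, h⟩))
    · intro j
      by_cases hj : j ∈ Z₂
      · refine iff_of_true ?_ hj
        rcases h : t (some (.inr j)) with _ | i | f
        · exact absurd h (hc.1.2 j hj)
        · exact absurd h (hconv.2 j i)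
        · exact a2 f (mem_imgR.2 (Or.inr ⟨j, hj, h⟩))
      · refine iff_of_false ?_ hj
        rw [← Finset.mem_compl] at hj
        rcases h : t (some (.inr j)) with _ | i | f
        · exact hnone x
        · exact absurd h (hconv.2 j i)
        · exact a4 f (mem_imgR.2 (Or.inr ⟨j, hj, h⟩))

theorem complexity_atom_le (hM : ConvexDFA M) (hmin : IsMinimalDFA M) {S : Set (Language α)}
    {Z₁ : Finset (Fin p)} {Z₂ : Finset (Fin k)} (h1 : ∀ i, M.acceptsFrom (some (.inl i)) ∈ S ↔ i ∈ Z₁)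
    (h2 : ∀ f, M.acceptsFrom (some (.inr f)) ∈ S ↔ f ∈ Z₂) (h3 : M.acceptsFrom none ∉ S) :
    complexity (atomicIntersection M.accepts S) ≤
      (atomBound (p + k + 1) k Z₁.card Z₂.card : ℕ∞) := by
  rw [← encard_quadValues _ _ (by simpa using Finset.card_le_univ Z₁)
    (by simpa using Finset.card_le_univ Z₂)]
  refine complexity_le_of_ker (fun w => quadOf Z₁ Z₂ fun q => M.evalFrom q w) _
    (fun w => quadOf_mem_quadValues (hM.isConvexMap w)) fun w w' h => ?_
  ext x
  rw [mem_leftQuotient_atom hM hmin h1 h2 h3, mem_leftQuotient_atom hM hmin h1 h2 h3, h]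

/-- Every map of the right shape is induced by a word, so all values of `quadOf` occur; they give
different quotients because every set of states is `finalSet` of some word. -/
theorem complexity_atom_W (p k : ℕ) [NeZero p] [NeZero k] {S : Set (Language Letter)}
    {Z₁ : Finset (Fin p)} {Z₂ : Finset (Fin k)}
    (h1 : ∀ i, (W p k).acceptsFrom (some (.inl i)) ∈ S ↔ i ∈ Z₁)
    (h2 : ∀ f, (W p k).acceptsFrom (some (.inr f)) ∈ S ↔ f ∈ Z₂)
    (h3 : (W p k).acceptsFrom none ∉ S) :
    complexity (atomicIntersection (W p k).accepts S) =
      (atomBound (p + k + 1) k Z₁.card Z₂.card : ℕ∞) := by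
  have hid : fourLetters ⊆ Set.range (id : Letter → Letter) := fun x _ => ⟨x, rfl⟩
  have hM := W_convex p k
  have hmin : IsMinimalDFA (W p k) := isMinimalDFA_comap hid
  rw [← encard_quadValues _ _ (by simpa using Finset.card_le_univ Z₁)
    (by simpa using Finset.card_le_univ Z₂)]
  have hrange : Set.range (fun w => quadOf Z₁ Z₂ fun q => (W p k).evalFrom q w) =
      quadValues p k Z₁.card Z₂.card := by
    refine Set.Subset.antisymm ?_ ?_
    · rintro _ ⟨w, rfl⟩
      exact quadOf_mem_quadValues (hM.isConvexMap w)
    · rintro (_ | Q) ⟨ha, hb⟩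
      · obtain ⟨w, -, hw⟩ := realizes_of_isConvexMap (p := p) (k := k) (t := fun _ => none)
          ⟨rfl, by simp⟩
        exact ⟨w, by rw [← quadOf_const_none (hb rfl)]; simp only [hw]⟩
      · obtain ⟨t, ht, hQ⟩ := exists_quadOf_eq (ha Q rfl)
        obtain ⟨w, -, hw⟩ := realizes_of_isConvexMap ht
        exact ⟨w, by simp only [hw]; exact hQ⟩
  rw [← hrange]
  refine complexity_eq_of_ker _ fun w w' => ⟨fun h => ?_, fun h => ?_⟩
  · have hx : ∀ x, x ∈ (atomicIntersection (W p k).accepts S).leftQuotient w ↔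
        x ∈ (atomicIntersection (W p k).accepts S).leftQuotient w' := fun x => by rw [h]
    simp only [mem_leftQuotient_atom hM hmin h1 h2 h3] at hx
    -- If one quotient is non-empty and contained in another, the constraints defining the larger
    -- one are among those defining the smaller.
    have half : ∀ {o o' : Option (Quad p k)} {Q}, o = some Q →
        (o ∈ quadValues p k Z₁.card Z₂.card) →
        (∀ x, (∃ Q, o = some Q ∧
          ((∀ i ∈ Q.1.1, .inl i ∈ finalSet (W p k) x) ∧ ∀ f ∈ Q.2.1, .inr f ∈ finalSet (W p k) x) ∧
          ((∀ i ∈ Q.1.2, .inl i ∉ finalSet (W p k) x) ∧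
            ∀ f ∈ Q.2.2, .inr f ∉ finalSet (W p k) x)) →
          (∃ Q, o' = some Q ∧
          ((∀ i ∈ Q.1.1, .inl i ∈ finalSet (W p k) x) ∧ ∀ f ∈ Q.2.1, .inr f ∈ finalSet (W p k) x) ∧
          ((∀ i ∈ Q.1.2, .inl i ∉ finalSet (W p k) x) ∧
            ∀ f ∈ Q.2.2, .inr f ∉ finalSet (W p k) x))) →
        ∃ Q', o' = some Q' ∧ (Q'.1.1 ⊆ Q.1.1 ∧ Q'.2.1 ⊆ Q.2.1) ∧
          (Q'.1.2 ⊆ Q.1.2 ∧ Q'.2.2 ⊆ Q.2.2) := by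
      rintro o o' Q rfl hv himp
      have hd := (Finset.mem_filter.1 (hv.1 Q rfl)).2.1
      have hd1 := Finset.disjoint_left.1 hd.1
      have hd2 := Finset.disjoint_left.1 hd.2
      -- The extreme words for Q: x is accepted from the required states only, y from all but the
      -- forbidden ones. Membership of x bounds the required sets of Q', membership of y the
      -- forbidden ones.
      obtain ⟨x, hx⟩ := exists_finalSet_eq (p := p) (k := k) hid
        {z | (∃ i ∈ Q.1.1, z = .inl i) ∨ ∃ f ∈ Q.2.1, z = .inr f}
      obtain ⟨y, hy⟩ := exists_finalSet_eq (p := p) (k := k) hid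
        {z | ¬ ((∃ i ∈ Q.1.2, z = .inl i) ∨ ∃ f ∈ Q.2.2, z = .inr f)}
      rw [DFA.comap_id] at hx hy
      have mx : ∀ z, z ∈ finalSet (W p k) x ↔
        (∃ i ∈ Q.1.1, z = .inl i) ∨ ∃ f ∈ Q.2.1, z = .inr f := fun z => by rw [hx]; rfl
      have my : ∀ z, z ∈ finalSet (W p k) y ↔
        ¬ ((∃ i ∈ Q.1.2, z = .inl i) ∨ ∃ f ∈ Q.2.2, z = .inr f) := fun z => by rw [hy]; rfl
      have hx' := himp x ⟨Q, rfl, by simp [mx], by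
        simpa [mx] using ⟨fun i hi hi' => hd1 hi' hi, fun i hi hi' => hd2 hi' hi⟩⟩
      have hy' := himp y ⟨Q, rfl, by
        simpa [my] using ⟨fun i hi hi' => hd1 hi hi', fun i hi hi' => hd2 hi hi'⟩, by simp [my]⟩
      simp only [mx] at hx'
      simp only [my] at hy'
      obtain ⟨Q', hQ', hx', -⟩ := hx'
      obtain ⟨Q'', hQ'', -, hy'⟩ := hy'
      obtain rfl : Q' = Q'' := Option.some.inj (hQ'.symm.trans hQ'')
      refine ⟨Q', hQ', ⟨fun i hi => ?_, fun f hf => ?_⟩, fun i hi => ?_, fun f hf => ?_⟩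
      · simpa using hx'.1 i hi
      · simpa using hx'.2 f hf
      · simpa using hy'.1 i hi
      · simpa using hy'.2 f hf
    have hv : ∀ w, (quadOf Z₁ Z₂ fun q => (W p k).evalFrom q w) ∈
        quadValues p k Z₁.card Z₂.card := fun w => quadOf_mem_quadValues (hM.isConvexMap w)
    have hv1 := hv w
    have hv2 := hv w'
    generalize (quadOf Z₁ Z₂ fun q => (W p k).evalFrom q w) = o at hx hv1 ⊢
    generalize (quadOf Z₁ Z₂ fun q => (W p k).evalFrom q w') = o' at hx hv2 ⊢
    rcases ho : o with _ | Q
    · rcases ho' : o' with _ | Q'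
      · rfl
      · obtain ⟨_, h', -⟩ := half ho' hv2 fun x => (hx x).2
        rw [ho] at h'
        simp at h'
    · obtain ⟨Q', ho', ⟨s1, s2⟩, s3, s4⟩ := half ho hv1 fun x => (hx x).1
      obtain ⟨Q'', ho'', ⟨s1', s2'⟩, s3', s4'⟩ := half ho' hv2 fun x => (hx x).2
      obtain rfl : Q = Q'' := Option.some.inj (ho.symm.trans ho'')
      rw [ho']
      congr 1
      exact Prod.ext (Prod.ext (s1'.antisymm s1) (s3'.antisymm s3))
        (Prod.ext (s2'.antisymm s2) (s4'.antisymm s4))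
  · ext x
    rw [mem_leftQuotient_atom hM hmin h1 h2 h3, mem_leftQuotient_atom hM hmin h1 h2 h3, h]

end atoms

end PrefixConvex

namespace PrefixConvex

/-! ### Sets of states -/

section successors

variable {α : Type u} {p k : ℕ} {M : DFA α (St p k)}

/-- The states, other than the sink, that a word leads to from the states in `P`. -/
def image (M : DFA α (St p k)) (w : List α) (P : Set (Fin p ⊕ Fin k)) : Set (Fin p ⊕ Fin k) :=
  {z | ∃ y ∈ P, M.evalFrom (some y) w = some z}

/-- The set contains a final state. -/
def HitsFinal (P : Set (Fin p ⊕ Fin k)) : Prop := ∃ f, .inr f ∈ P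

theorem mem_image {w : List α} {P : Set (Fin p ⊕ Fin k)} {z : Fin p ⊕ Fin k} :
    z ∈ image M w P ↔ ∃ y ∈ P, M.evalFrom (some y) w = some z := Iff.rfl

theorem mem_image_singleton {x : α} {P : Set (Fin p ⊕ Fin k)} {z : Fin p ⊕ Fin k} :
    z ∈ image M [x] P ↔ ∃ y ∈ P, M.step (some y) x = some z := Iff.rfl

@[simp] theorem image_nil (P : Set (Fin p ⊕ Fin k)) : image M [] P = P := by
  ext z
  simp [mem_image]

theorem ConvexDFA.image_append (hM : ConvexDFA M) (u v : List α) (P : Set (Fin p ⊕ Fin k)) :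
    image M (u ++ v) P = image M v (image M u P) := by
  ext z
  simp only [mem_image, DFA.evalFrom_of_append]
  constructor
  · rintro ⟨y, hy, h⟩
    rcases hyu : M.evalFrom (some y) u with _ | y'
    · rw [hyu, hM.evalFrom_none] at h
      cases h
    · exact ⟨y', ⟨y, hy, hyu⟩, by rw [← h, hyu]⟩
  · rintro ⟨y', ⟨y, hy, h1⟩, h2⟩
    exact ⟨y, hy, by rw [h1, h2]⟩

end successors

/-! ### The star -/

section star

variable {α : Type u} {p k : ℕ} {M : DFA α (St p k)}

/-- The subset automaton of the star; the initial state has to be made final. -/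
def starDFA (M : DFA α (St p k)) : DFA α (Set (Fin p ⊕ Fin k)) where
  step P x := image M [x] P ∪ {z | HitsFinal (image M [x] P) ∧ some z = M.start}
  start := {z | some z = M.start}
  accept := {P | HitsFinal P}

/-- On sets with a property that is preserved and that makes the initial state present with the
final states, the subset automaton computes images. -/
theorem ConvexDFA.starDFA_evalFrom (hM : ConvexDFA M) (I : Set (Fin p ⊕ Fin k) → Prop) {A : Set α}
    (h : ∀ P, I P → ∀ x ∈ A, I ((starDFA M).step P x) ∧ (HitsFinal (image M [x] P) →
      ∀ z, some z = M.start → z ∈ image M [x] P))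
    {P : Set (Fin p ⊕ Fin k)} (hP : I P) {w : List α} (hw : ∀ x ∈ w, x ∈ A) :
    (starDFA M).evalFrom P w = image M w P := by
  induction w generalizing P with
  | nil => simp
  | cons x w ih =>
    have hx : (starDFA M).step P x = image M [x] P := by
      refine Set.union_eq_self_of_subset_right ?_
      rintro z ⟨h1, h2⟩
      exact (h P hP x (hw x (by simp))).2 h1 z h2
    rw [DFA.evalFrom_cons, ih (h P hP x (hw x (by simp))).1 fun y hy => hw y (by simp [hy]), hx,
      ← hM.image_append, List.singleton_append]

/-- A subset state records where the unfinished last factor v of w = uv may be, over all u in the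
star. -/
theorem ConvexDFA.mem_starDFA_eval (hM : ConvexDFA M) (w : List α) :
    (∀ z, z ∈ (starDFA M).eval w ↔ ∃ u v, w = u ++ v ∧ u ∈ M.accepts∗ ∧ M.eval v = some z) ∧
      (w ∈ M.accepts∗ ↔ w = [] ∨ HitsFinal ((starDFA M).eval w)) := by
  obtain ⟨i, hi⟩ := hM.start
  -- A non-empty word of the star is a word of the star followed by a word of the language.
  have key : ∀ w : List α, w ∈ M.accepts∗ ↔
      w = [] ∨ ∃ f u v, w = u ++ v ∧ u ∈ M.accepts∗ ∧ M.eval v = some (.inr f) := by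
    intro w
    conv_lhs => rw [← Language.one_add_kstar_mul_self_eq_kstar]
    rw [Language.mem_add, Language.mem_one, Language.mem_mul]
    refine or_congr Iff.rfl ?_
    constructor
    · rintro ⟨u, hu, v, hv, rfl⟩
      obtain ⟨f, hf⟩ := (hM.accept _).1 hv
      exact ⟨f, u, v, rfl, hu, hf⟩
    · rintro ⟨f, u, v, rfl, hu, hf⟩
      exact ⟨u, hu, v, (hM.accept _).2 ⟨f, hf⟩, rfl⟩
  have main : ∀ z, z ∈ (starDFA M).eval w ↔
      ∃ u v, w = u ++ v ∧ u ∈ M.accepts∗ ∧ M.eval v = some z := by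
    induction w using List.reverseRecOn with
    | nil =>
      intro z
      change some z = M.start ↔ _
      constructor
      · intro h
        exact ⟨[], [], rfl, Language.nil_mem_kstar _, h.symm⟩
      · rintro ⟨u, v, h, hu, hv⟩
        obtain ⟨rfl, rfl⟩ := List.append_eq_nil_iff.1 h.symm
        exact hv.symm
    | append_singleton w x ih =>
      have himg : ∀ z, z ∈ image M [x] ((starDFA M).eval w) ↔
          ∃ u v, w = u ++ v ∧ u ∈ M.accepts∗ ∧ M.eval (v ++ [x]) = some z := by
        intro z
        rw [mem_image_singleton]
        constructor
        · rintro ⟨y, hy, h⟩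
          obtain ⟨u, v, rfl, hu, hv⟩ := (ih y).1 hy
          exact ⟨u, v, rfl, hu, by rw [DFA.eval_append_singleton, hv, h]⟩
        · rintro ⟨u, v, rfl, hu, hv⟩
          rw [DFA.eval_append_singleton] at hv
          rcases hy : M.eval v with _ | y
          · rw [hy, hM.step_none] at hv
            cases hv
          · exact ⟨y, (ih y).2 ⟨u, v, rfl, hu, hy⟩, by rw [← hv, hy]⟩
      intro z
      rw [DFA.eval_append_singleton]
      change (z ∈ image M [x] _ ∨ (HitsFinal (image M [x] _) ∧ some z = M.start)) ↔ _
      constructor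
      · rintro (h | ⟨⟨f, hf⟩, hz⟩)
        · obtain ⟨u, v, rfl, hu, hv⟩ := (himg z).1 h
          exact ⟨u, v ++ [x], by simp, hu, hv⟩
        · obtain ⟨u, v, rfl, hu, hv⟩ := (himg _).1 hf
          exact ⟨u ++ v ++ [x], [], by simp,
            (key _).2 (Or.inr ⟨f, u, v ++ [x], by simp, hu, hv⟩), hz.symm⟩
      · rintro ⟨u, v, h, hu, hv⟩
        rcases List.eq_nil_or_concat' v with rfl | ⟨v', y, rfl⟩
        · right
          rw [List.append_nil] at h
          subst h
          obtain h | ⟨f, u, v, h, hu', hv'⟩ := (key _).1 hu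
          · simp at h
          · refine ⟨⟨f, (himg _).2 ?_⟩, hv.symm⟩
            rcases List.eq_nil_or_concat' v with rfl | ⟨v', y, rfl⟩
            -- The last factor is not empty, since the initial state is not final.
            · change M.start = _ at hv'
              rw [hi] at hv'
              simp at hv'
            · rw [← List.append_assoc] at h
              obtain ⟨rfl, h⟩ := List.append_inj' h rfl
              obtain rfl : x = y := by simpa using h
              exact ⟨u, v', rfl, hu', hv'⟩
        · left
          rw [← List.append_assoc] at h
          obtain ⟨rfl, h⟩ := List.append_inj' h rfl
          obtain rfl : x = y := by simpa using h
          exact (himg z).2 ⟨u, v', rfl, hu, hv⟩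
  refine ⟨main, (key w).trans (or_congr Iff.rfl ?_)⟩
  unfold HitsFinal
  simp only [main]

/-- The state of the subset automaton; the empty word has a state of its own. -/
noncomputable def starState (M : DFA α (St p k)) (w : List α) : Option (Set (Fin p ⊕ Fin k)) :=
  if w = [] then none else some ((starDFA M).eval w)

/-- The sets that contain the initial state if they contain a final state. -/
def starSets (i : Fin p) : Set (Set (Fin p ⊕ Fin k)) := {P | HitsFinal P → .inl i ∈ P}

/-- There are 2^(n-2) sets containing the initial state; a set without it has no final state, which
leaves 2^(p-1) sets. The empty word adds one. -/
theorem encard_starSets (i : Fin p) :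
    ((insert none (some '' (starSets i : Set (Set (Fin p ⊕ Fin k))))).encard) =
      (starBound (p + k + 1) k : ℕ∞) := by
  have hp : 1 ≤ p := by have := i.2; omega
  rw [Set.encard_insert_of_notMem (by simp), (Option.some_injective _).encard_image]
  have h : (starSets i : Set (Set (Fin p ⊕ Fin k))) =
      insert (.inl i) '' (𝒫 {.inl i}ᶜ) ∪ 𝒫 (Sum.inl '' {i}ᶜ) := by
    ext P
    constructor
    · intro hP
      by_cases hi : .inl i ∈ P
      · exact Or.inl ⟨P \ {.inl i}, fun z hz => Set.mem_compl hz.2, by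
          rw [Set.insert_sdiff_singleton, Set.insert_eq_of_mem hi]⟩
      · refine Or.inr fun z hz => ?_
        rcases z with j | f
        · exact ⟨j, fun h => hi (h ▸ hz), rfl⟩
        · exact absurd (hP ⟨f, hz⟩) hi
    · rintro (⟨Q, -, rfl⟩ | hP)
      · exact fun _ => Set.mem_insert _ _
      · rintro ⟨f, hf⟩
        obtain ⟨j, -, h⟩ := hP hf
        cases h
  have c1 : (insert (.inl i) '' (𝒫 ({.inl i}ᶜ : Set (Fin p ⊕ Fin k)))).encard =
      (2 ^ (p + k - 1) : ℕ) := by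
    rw [Set.InjOn.encard_image, ← Set.Finite.cast_ncard_eq (Set.toFinite _), Set.ncard_powerset,
      Set.ncard_compl]
    · simp
    · intro Q hQ Q' hQ' h
      have h1 : ∀ R ∈ 𝒫 ({.inl i}ᶜ : Set (Fin p ⊕ Fin k)), insert (.inl i) R \ {.inl i} = R :=
        fun R hR => Set.insert_sdiff_self_of_notMem fun h => hR h rfl
      rw [← h1 Q hQ, h, h1 Q' hQ']
  have c2 : (𝒫 (Sum.inl '' ({i}ᶜ : Set (Fin p)) : Set (Fin p ⊕ Fin k))).encard =
      (2 ^ (p - 1) : ℕ) := by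
    rw [← Set.Finite.cast_ncard_eq (Set.toFinite _), Set.ncard_powerset,
      Set.ncard_image_of_injective _ Sum.inl_injective, Set.ncard_compl]
    simp
  rw [h, Set.encard_union_eq, c1, c2]
  · rw [starBound, show p + k + 1 - 2 = p + k - 1 by omega,
      show p + k - 1 - k = p - 1 by omega]
    push_cast
    rfl
  · rw [Set.disjoint_left]
    rintro _ ⟨Q, -, rfl⟩ h
    obtain ⟨j, hj, h⟩ := h (Set.mem_insert _ _)
    exact hj (Sum.inl_injective h)

theorem ConvexDFA.mem_leftQuotient_kstar (hM : ConvexDFA M) (w x : List α) :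
    x ∈ (M.accepts∗).leftQuotient w ↔
      w ++ x = [] ∨ HitsFinal ((starDFA M).evalFrom ((starDFA M).eval w) x) := by
  rw [DFA.eval, ← DFA.evalFrom_of_append]
  exact (hM.mem_starDFA_eval (w ++ x)).2

theorem ConvexDFA.leftQuotient_kstar_eq (hM : ConvexDFA M) {w w' : List α}
    (h : starState M w = starState M w') :
    (M.accepts∗).leftQuotient w = (M.accepts∗).leftQuotient w' := by
  unfold starState at h
  by_cases hw : w = [] <;> by_cases hw' : w' = [] <;> simp only [hw, hw', if_true, if_false] at h
  · rw [hw, hw']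
  · cases h
  · cases h
  · ext x
    rw [hM.mem_leftQuotient_kstar, hM.mem_leftQuotient_kstar, Option.some.inj h]
    simp [hw, hw']

/-- When a final state is present, w is itself in the star and a new factor can begin at the initial
state. -/
theorem ConvexDFA.starState_mem (hM : ConvexDFA M) {i : Fin p} (hi : M.start = some (.inl i))
    (w : List α) : starState M w ∈ insert none (some '' (starSets i : Set (Set (Fin p ⊕ Fin k)))) := by
  unfold starState
  split_ifs with hw
  · exact Set.mem_insert _ _
  refine Set.mem_insert_of_mem _ ⟨_, fun h => ?_, rfl⟩
  rw [(hM.mem_starDFA_eval w).1]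
  exact ⟨w, [], by simp, (hM.mem_starDFA_eval w).2.2 (Or.inr h), hi⟩

theorem ConvexDFA.complexity_kstar_le (hM : ConvexDFA M) :
    complexity (M.accepts∗) ≤ (starBound (p + k + 1) k : ℕ∞) := by
  obtain ⟨i, hi⟩ := hM.start
  rw [← encard_starSets i]
  exact complexity_le_of_ker (starState M) _ (hM.starState_mem hi)
    fun w w' h => hM.leftQuotient_kstar_eq h

end star

theorem starBound_le {n k : ℕ} (hn : 3 ≤ n) (hk1 : 1 ≤ k) (hk2 : k ≤ n - 2) :
    starBound n k ≤ 2 ^ (n - 2) + 2 ^ (n - 3) + 1 ∧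
      (starBound n k = 2 ^ (n - 2) + 2 ^ (n - 3) + 1 ↔ k = 1) := by
  unfold starBound
  refine ⟨?_, ⟨fun h => ?_, fun h => ?_⟩⟩
  · have := Nat.pow_le_pow_right (n := 2) (by norm_num) (show n - 2 - k ≤ n - 3 by omega)
    omega
  · have h1 : 2 ^ (n - 2 - k) = 2 ^ (n - 3) := by omega
    have := Nat.pow_right_injective le_rfl h1
    omega
  · rw [show n - 2 - k = n - 3 by omega]

end PrefixConvex

namespace PrefixConvex

/-! ### The star of the witness -/

/-- The set of states with the given non-final and final elements. -/
def pairSet {p k : ℕ} (A : Set (Fin p)) (B : Set (Fin k)) : Set (Fin p ⊕ Fin k) :=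
  {z | Sum.elim (· ∈ A) (· ∈ B) z}

section pairSet

variable {p k : ℕ} {A : Set (Fin p)} {B : Set (Fin k)}

@[simp] theorem inl_mem_pairSet {i : Fin p} : .inl i ∈ pairSet A B ↔ i ∈ A := Iff.rfl

@[simp] theorem inr_mem_pairSet {f : Fin k} : .inr f ∈ pairSet A B ↔ f ∈ B := Iff.rfl

theorem eq_pairSet_iff {P : Set (Fin p ⊕ Fin k)} :
    P = pairSet A B ↔ (∀ i, .inl i ∈ P ↔ i ∈ A) ∧ ∀ f, .inr f ∈ P ↔ f ∈ B := by
  rw [Set.ext_iff, Sum.forall]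
  rfl

theorem exists_eq_pairSet (P : Set (Fin p ⊕ Fin k)) : ∃ A B, P = pairSet A B :=
  ⟨{i | .inl i ∈ P}, {f | .inr f ∈ P}, eq_pairSet_iff.2 ⟨fun _ => Iff.rfl, fun _ => Iff.rfl⟩⟩

end pairSet

theorem mem_image_of_realizes {α : Type u} {p k : ℕ} {M : DFA α (St p k)} {w : List α}
    {t : St p k → St p k} (h : ∀ q, M.evalFrom q w = t q) {P : Set (Fin p ⊕ Fin k)}
    {z : Fin p ⊕ Fin k} : z ∈ image M w P ↔ ∃ y ∈ P, t (some y) = some z := by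
  simp only [mem_image, h]

/-- The letters `a, b, d₁, d₂, e`. -/
def fiveLetters : Set Letter := {.a, .b, .d₁, .d₂, .e}

/-! ### Single letters and short words in the star automaton -/

section

variable {β : Type} {p k : ℕ} [NeZero p] [NeZero k] {ρ : β → Letter}

theorem inl_mem_image_d₁ {x : β} (hx : ρ x = .d₁) {P : Set (Fin p ⊕ Fin k)} {i : Fin p} :
    .inl i ∈ image ((W p k).comap ρ) [x] P ↔ ∃ j, .inl j ∈ P ∧ shiftFin p j = some i := by
  simp only [mem_image_singleton, DFA.comap_step, hx, Sum.exists]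
  simp [W, stepW]

theorem inr_mem_image_d₁ {x : β} (hx : ρ x = .d₁) {P : Set (Fin p ⊕ Fin k)} {f : Fin k} :
    .inr f ∈ image ((W p k).comap ρ) [x] P ↔ .inr f ∈ P := by
  simp only [mem_image_singleton, DFA.comap_step, hx, Sum.exists]
  simp [W, stepW]

theorem inl_mem_image_d₂ {x : β} (hx : ρ x = .d₂) {P : Set (Fin p ⊕ Fin k)} {i : Fin p} :
    .inl i ∈ image ((W p k).comap ρ) [x] P ↔ .inl i ∈ P := by
  simp only [mem_image_singleton, DFA.comap_step, hx, Sum.exists]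
  simp [W, stepW]

theorem inr_mem_image_d₂ {x : β} (hx : ρ x = .d₂) {P : Set (Fin p ⊕ Fin k)} {f : Fin k} :
    .inr f ∈ image ((W p k).comap ρ) [x] P ↔ ∃ g, .inr g ∈ P ∧ shiftFin k g = some f := by
  simp only [mem_image_singleton, DFA.comap_step, hx, Sum.exists]
  simp [W, stepW]

theorem inl_mem_image_e {x : β} (hx : ρ x = .e) {P : Set (Fin p ⊕ Fin k)} {i : Fin p} :
    .inl i ∈ image ((W p k).comap ρ) [x] P ↔ .inl i ∈ P ∧ i ≠ 0 := by
  simp only [mem_image_singleton, DFA.comap_step, hx, Sum.exists]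
  simp only [W, stepW, Option.some.injEq, reduceCtorEq, and_false, exists_false, or_false]
  constructor
  · rintro ⟨j, hj, h⟩
    split_ifs at h with h0
    obtain rfl := Sum.inl_injective h
    exact ⟨hj, h0⟩
  · rintro ⟨h, h0⟩
    exact ⟨i, h, by simp [h0]⟩

theorem inr_mem_image_e {x : β} (hx : ρ x = .e) {P : Set (Fin p ⊕ Fin k)} {f : Fin k} :
    .inr f ∈ image ((W p k).comap ρ) [x] P ↔ .inr f ∈ P ∨ .inl 0 ∈ P ∧ f = 0 := by
  simp only [mem_image_singleton, DFA.comap_step, hx, Sum.exists]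
  simp only [W, stepW, Option.some.injEq, Sum.inr.injEq, exists_eq_right]
  rw [or_comm]
  refine or_congr Iff.rfl ?_
  constructor
  · rintro ⟨j, hj, h⟩
    split_ifs at h with h0
    exact ⟨h0 ▸ hj, (Sum.inr_injective h).symm⟩
  · rintro ⟨h, rfl⟩
    exact ⟨0, h, by simp⟩

omit [NeZero p] in
theorem shiftFin_eq_some {i j : Fin p} : shiftFin p j = some i ↔ j.val + 1 = i.val := by
  unfold shiftFin
  split_ifs with h
  · simp [Fin.ext_iff]
  · have := i.2
    simp only [false_iff]
    omega

theorem inl_mem_starDFA_step {x : β} {P : Set (Fin p ⊕ Fin k)} {i : Fin p} :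
    .inl i ∈ (starDFA ((W p k).comap ρ)).step P x ↔ .inl i ∈ image ((W p k).comap ρ) [x] P ∨
      HitsFinal (image ((W p k).comap ρ) [x] P) ∧ i = 0 := by
  change _ ∨ _ ∧ some (Sum.inl i) = some (Sum.inl 0) ↔ _
  simp

theorem inr_mem_starDFA_step {x : β} {P : Set (Fin p ⊕ Fin k)} {f : Fin k} :
    .inr f ∈ (starDFA ((W p k).comap ρ)).step P x ↔ .inr f ∈ image ((W p k).comap ρ) [x] P := by
  change _ ∨ _ ∧ some (Sum.inr f) = some (Sum.inl 0) ↔ _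
  simp

/-- The letter d₁ fixes the final states, so each step restores 0 while the earlier copies are
shifted; after p steps the non-final block is full. -/
theorem starDFA_replicate_d₁ {x : β} (hx : ρ x = .d₁) {A : Set (Fin p)} {B : Set (Fin k)}
    (hB : B.Nonempty) :
    (starDFA ((W p k).comap ρ)).evalFrom (pairSet A B) (List.replicate p x) =
      pairSet Set.univ B := by
  have h : ∀ j, (∀ i : Fin p, i.val < j → .inl i ∈ (starDFA ((W p k).comap ρ)).evalFrom
      (pairSet A B) (List.replicate j x)) ∧ ∀ f, .inr f ∈ (starDFA ((W p k).comap ρ)).evalFrom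
      (pairSet A B) (List.replicate j x) ↔ f ∈ B := by
    intro j
    induction j with
    | zero => exact ⟨fun i hi => absurd hi (by omega), fun f => Iff.rfl⟩
    | succ j ih =>
      rw [List.replicate_succ', DFA.evalFrom_append_singleton]
      have h2 : ∀ f, .inr f ∈ (starDFA ((W p k).comap ρ)).step _ x ↔ f ∈ B := fun f => by
        rw [inr_mem_starDFA_step, inr_mem_image_d₁ hx]
        exact ih.2 f
      refine ⟨fun i hi => inl_mem_starDFA_step.2 ?_, h2⟩
      by_cases hi0 : i = 0
      · obtain ⟨f, hf⟩ := hB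
        exact Or.inr ⟨⟨f, inr_mem_starDFA_step.1 ((h2 f).2 hf)⟩, hi0⟩
      · have h0 : i.val ≠ 0 := fun h => hi0 (Fin.ext h)
        have := i.2
        refine Or.inl ((inl_mem_image_d₁ hx).2 ⟨⟨i - 1, by omega⟩, ih.1 _ ?_, ?_⟩)
        · change i.val - 1 < j
          omega
        · rw [shiftFin_eq_some]
          change i.val - 1 + 1 = i
          omega
  exact eq_pairSet_iff.2 ⟨fun i => ⟨fun _ => trivial, fun _ => (h p).1 i i.2⟩, (h p).2⟩

theorem starDFA_step_d₂ {x : β} (hx : ρ x = .d₂) {A : Set (Fin p)} {B : Set (Fin k)}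
    (h0 : B.Nonempty → 0 ∈ A) : (starDFA ((W p k).comap ρ)).step (pairSet A B) x =
      pairSet A {f | ∃ g ∈ B, shiftFin k g = some f} := by
  refine eq_pairSet_iff.2 ⟨fun i => ?_, fun f => ?_⟩
  · rw [inl_mem_starDFA_step, inl_mem_image_d₂ hx, inl_mem_pairSet, or_iff_left_iff_imp]
    rintro ⟨⟨f, hf⟩, rfl⟩
    obtain ⟨g, hg, -⟩ := (inr_mem_image_d₂ hx).1 hf
    exact h0 ⟨g, hg⟩
  · rw [inr_mem_starDFA_step, inr_mem_image_d₂ hx]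
    rfl

/-- Each step raises the least possible index of a final state by one. The assumption on 0 ensures
that its reinsertion changes nothing. -/
theorem starDFA_replicate_d₂ {x : β} (hx : ρ x = .d₂) {A : Set (Fin p)} {B : Set (Fin k)}
    (h0 : B.Nonempty → 0 ∈ A) :
    (starDFA ((W p k).comap ρ)).evalFrom (pairSet A B) (List.replicate k x) = pairSet A ∅ := by
  have h : ∀ j, ∃ C : Set (Fin k), (C.Nonempty → 0 ∈ A) ∧ (∀ f ∈ C, j ≤ f.val) ∧
      (starDFA ((W p k).comap ρ)).evalFrom (pairSet A B) (List.replicate j x) = pairSet A C := by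
    intro j
    induction j with
    | zero => exact ⟨B, h0, by simp, rfl⟩
    | succ j ih =>
      obtain ⟨C, hC, hj, h⟩ := ih
      refine ⟨_, ?_, ?_, by
        rw [List.replicate_succ', DFA.evalFrom_append_singleton, h, starDFA_step_d₂ hx hC]⟩
      · rintro ⟨f, g, hg, -⟩
        exact hC ⟨g, hg⟩
      · rintro f ⟨g, hg, hf⟩
        have := hj g hg
        rw [shiftFin_eq_some] at hf
        omega
  obtain ⟨C, -, hC, h⟩ := h k
  rw [h, show C = ∅ from Set.eq_empty_of_forall_notMem fun f hf => by
    have := hC f hf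
    have := f.2
    omega]

/-- The state 0 moves to the first final state and is put back at once because a final state is
present. -/
theorem starDFA_step_e {x : β} (hx : ρ x = .e) {A : Set (Fin p)} {B : Set (Fin k)}
    (h0 : 0 ∈ A) : (starDFA ((W p k).comap ρ)).step (pairSet A B) x = pairSet A (insert 0 B) := by
  refine eq_pairSet_iff.2 ⟨fun i => ?_, fun f => ?_⟩
  · rw [inl_mem_starDFA_step, inl_mem_image_e hx, inl_mem_pairSet]
    constructor
    · rintro (h | ⟨-, rfl⟩)
      · exact h.1
      · exact h0
    · intro h
      by_cases hi : i = 0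
      · exact Or.inr ⟨⟨0, (inr_mem_image_e hx).2 (Or.inr ⟨h0, rfl⟩)⟩, hi⟩
      · exact Or.inl ⟨h, hi⟩
  · rw [inr_mem_starDFA_step, inr_mem_image_e hx]
    simp only [inr_mem_pairSet, inl_mem_pairSet, Set.mem_insert_iff, h0, true_and]
    rw [or_comm]

/-- On sets of non-final states, permutations and `d₁` act without interference. -/
theorem exists_starDFA_evalFrom_inl (hρ : fiveLetters ⊆ Set.range ρ) {t : St p k → St p k}
    (ht : Realizes (W p k) {.a, .b, .d₁} t) : ∃ w, ∀ A : Set (Fin p),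
      (starDFA ((W p k).comap ρ)).evalFrom (pairSet A ∅) w =
        {z | ∃ i ∈ A, t (some (.inl i)) = some z} := by
  obtain ⟨w, hw, hwt⟩ := ht.comap (ρ := ρ) ((show ({.a, .b, .d₁} : Set Letter) ⊆ fiveLetters by
    rintro x (rfl | rfl | rfl) <;> simp [fiveLetters]).trans hρ)
  refine ⟨w, fun A => ?_⟩
  have himg : ∀ P : Set (Fin p ⊕ Fin k), ¬ HitsFinal P → ∀ x ∈ ρ ⁻¹' {.a, .b, .d₁},
      ¬ HitsFinal (image ((W p k).comap ρ) [x] P) := by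
    rintro P hP x hx ⟨f, y, hy, h⟩
    change stepW p k (some y) (ρ x) = _ at h
    rcases y with i | g
    · rcases hx with hx | hx | hx <;> rw [hx] at h <;> simp [stepW] at h
    · exact hP ⟨g, hy⟩
  rw [((W_convex p k).comap ρ).starDFA_evalFrom (fun P => ¬ HitsFinal P) (A := ρ ⁻¹' {.a, .b, .d₁})
    _ _ hw]
  · ext z
    rw [mem_image_of_realizes hwt, Sum.exists]
    simp
  · intro P hP x hx
    refine ⟨?_, fun h => absurd h (himg P hP x hx)⟩
    rintro ⟨f, hf⟩
    exact himg P hP x hx ⟨f, inr_mem_starDFA_step.1 hf⟩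
  · rintro ⟨f, hf⟩
    exact hf

/-- On sets that contain all non-final states, permutations and `d₂` act without interference. -/
theorem exists_starDFA_evalFrom_inr (hρ : fiveLetters ⊆ Set.range ρ) {t : St p k → St p k}
    (ht : Realizes (W p k) {.a, .b, .d₂} t) : ∃ w, ∀ B : Set (Fin k),
      (starDFA ((W p k).comap ρ)).evalFrom (pairSet Set.univ B) w =
        {z | ∃ y ∈ pairSet Set.univ B, t (some y) = some z} := by
  obtain ⟨w, hw, hwt⟩ := ht.comap (ρ := ρ) ((show ({.a, .b, .d₂} : Set Letter) ⊆ fiveLetters by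
    rintro x (rfl | rfl | rfl) <;> simp [fiveLetters]).trans hρ)
  refine ⟨w, fun B => ?_⟩
  have himg : ∀ P : Set (Fin p ⊕ Fin k), (∀ i, .inl i ∈ P) → ∀ x ∈ ρ ⁻¹' {.a, .b, .d₂},
      ∀ i, .inl i ∈ image ((W p k).comap ρ) [x] P := by
    rintro P hP x hx i
    obtain ⟨j, hj⟩ : ∃ j, stepW p k (some (.inl j)) (ρ x) = some (.inl i) := by
      rcases hx with hx | hx | hx <;> rw [hx]
      · exact ⟨(rotPerm p)⁻¹ i, by
          rw [stepW]
          exact congrArg (fun j => some (Sum.inl j)) ((rotPerm p).apply_symm_apply i)⟩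
      · exact ⟨(twPerm p)⁻¹ i, by
          rw [stepW]
          exact congrArg (fun j => some (Sum.inl j)) ((twPerm p).apply_symm_apply i)⟩
      · exact ⟨i, rfl⟩
    exact ⟨.inl j, hP j, hj⟩
  rw [((W_convex p k).comap ρ).starDFA_evalFrom (fun P => ∀ i, .inl i ∈ P)
    (A := ρ ⁻¹' {.a, .b, .d₂}) _ _ hw]
  · ext z
    rw [mem_image_of_realizes hwt]
    rfl
  · intro P hP x hx
    refine ⟨fun i => inl_mem_starDFA_step.2 (Or.inl (himg P hP x hx i)), fun _ z hz => ?_⟩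
    obtain rfl : z = .inl 0 := Option.some.inj hz
    exact himg P hP x hx 0
  · intro i
    trivial

/-- Some word of permutations and `d₁` removes the non-final states outside `A`. -/
theorem realizes_inl_filter (A : Set (Fin p)) [DecidablePred (· ∈ A)] :
    Realizes (W p k) {.a, .b, .d₁} fun q => match q with
      | some (.inl i) => if i ∈ A then some (.inl i) else none
      | q => q := by
  refine Realizes.of_sends (Finset.univ.image fun f : Fin p => some (Sum.inl f)) ?_ ?_
  · intro x hx hxt
    obtain ⟨f, -, rfl⟩ := Finset.mem_image.1 hx
    by_cases hf : f ∈ A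
    · simp [hf] at hxt
    · simp only [hf, if_false]
      exact ⟨by simp, realizes_inl_none (by simp) (by simp) (by simp) f⟩
  · rintro (_ | i | f) hx
    · rfl
    · simp at hx
    · rfl

theorem realizes_inr_filter (A : Set (Fin k)) [DecidablePred (· ∈ A)] :
    Realizes (W p k) {.a, .b, .d₂} fun q => match q with
      | some (.inr i) => if i ∈ A then some (.inr i) else none
      | q => q := by
  refine Realizes.of_sends (Finset.univ.image fun f : Fin k => some (Sum.inr f)) ?_ ?_
  · intro x hx hxt
    obtain ⟨f, -, rfl⟩ := Finset.mem_image.1 hx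
    by_cases hf : f ∈ A
    · simp [hf] at hxt
    · simp only [hf, if_false]
      exact ⟨by simp, realizes_inr_none (by simp) (by simp) (by simp) f⟩
  · rintro (_ | i | f) hx
    · rfl
    · rfl
    · simp at hx

/-- From {0}, e adds a final state, d₁ then fills the non-final block and d₂ clears the final one.
The non-final block is thinned to A without interference; if 0 ∈ A, the set B is built by d₂ and e.
-/
theorem starDFA_reach (hρ : fiveLetters ⊆ Set.range ρ) {P : Set (Fin p ⊕ Fin k)}
    (hP : P ∈ starSets 0) : ∃ w ≠ [], (starDFA ((W p k).comap ρ)).eval w = P := by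
  classical
  obtain ⟨x₁, hx₁⟩ := hρ (show Letter.d₁ ∈ fiveLetters by simp [fiveLetters])
  obtain ⟨x₂, hx₂⟩ := hρ (show Letter.d₂ ∈ fiveLetters by simp [fiveLetters])
  obtain ⟨y, hy⟩ := hρ (show Letter.e ∈ fiveLetters by simp [fiveLetters])
  obtain ⟨A, B, rfl⟩ := exists_eq_pairSet P
  obtain ⟨S, hS⟩ : ∃ S, S = starDFA ((W p k).comap ρ) := ⟨_, rfl⟩
  have cont : ∀ {Q R : Set (Fin p ⊕ Fin k)} (v : List β), (∃ w ≠ [], S.eval w = Q) →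
      S.evalFrom Q v = R → ∃ w ≠ [], S.eval w = R := by
    rintro Q R v ⟨w, hw, hQ⟩ h
    exact ⟨w ++ v, by simp [hw], by rw [DFA.eval, DFA.evalFrom_of_append, ← DFA.eval, hQ, h]⟩
  rw [← hS]
  have h0 : ∃ w ≠ [], S.eval w = pairSet {0} {0} := by
    refine ⟨[y], by simp, ?_⟩
    change S.step S.start y = _
    have : S.start = pairSet {0} ∅ := by
      rw [hS]
      refine eq_pairSet_iff.2 ⟨fun i => ?_, fun f => ?_⟩
      · change some _ = some (Sum.inl 0) ↔ _
        simp
      · change some _ = some (Sum.inl 0) ↔ _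
        simp
    rw [this, hS, starDFA_step_e hy (by simp)]
    simp
  have h1 : ∃ w ≠ [], S.eval w = pairSet Set.univ {0} :=
    cont _ h0 (by rw [hS]; exact starDFA_replicate_d₁ hx₁ (by simp))
  have h2 : ∃ w ≠ [], S.eval w = pairSet Set.univ ∅ :=
    cont _ h1 (by rw [hS]; exact starDFA_replicate_d₂ hx₂ fun _ => trivial)
  have h3 : ∃ w ≠ [], S.eval w = pairSet A ∅ := by
    obtain ⟨w, hw⟩ := exists_starDFA_evalFrom_inl hρ (realizes_inl_filter (k := k) A)
    refine cont w h2 ?_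
    rw [hS, hw]
    refine eq_pairSet_iff.2 ⟨fun i => ?_, fun f => ?_⟩
    · constructor
      · rintro ⟨j, -, h⟩
        by_cases hj : j ∈ A <;> simp [hj] at h
        rwa [← h]
      · intro hi
        exact ⟨i, trivial, by simp [hi]⟩
    · simp only [Set.mem_empty_iff_false, iff_false]
      rintro ⟨j, -, h⟩
      by_cases hj : j ∈ A <;> simp [hj] at h
  by_cases hA : 0 ∈ A
  -- C without its first element is the d₂-image of C shifted down, which has smaller indices; e
  -- inserts the first element if required.
  · have h4 : ∀ j, ∀ C : Set (Fin k), (∀ f ∈ C, f.val < j) →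
        ∃ w ≠ [], S.eval w = pairSet A C := by
      intro j
      induction j with
      | zero =>
        intro C hC
        rwa [Set.eq_empty_of_forall_notMem fun f hf => absurd (hC f hf) (by omega)]
      | succ j ih =>
        intro C hC
        have h5 : ∃ w ≠ [], S.eval w = pairSet A (C \ {0}) := by
          refine cont [x₂] (ih {g | ∃ f ∈ C, shiftFin k g = some f} ?_) ?_
          · rintro g ⟨f, hf, hg⟩
            have := hC f hf
            rw [shiftFin_eq_some] at hg
            omega
          · rw [DFA.evalFrom_singleton, hS, starDFA_step_d₂ hx₂ fun _ => hA]
            congr 1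
            ext f
            constructor
            · rintro ⟨g, ⟨f', hf', h⟩, h'⟩
              obtain rfl := Option.some.inj (h.symm.trans h')
              refine ⟨hf', ?_⟩
              rintro rfl
              rw [shiftFin_eq_some] at h
              simp at h
            · rintro ⟨hf, h0⟩
              have hf0 : f.val ≠ 0 := fun h => h0 (Fin.ext h)
              have h : shiftFin k ⟨f - 1, by omega⟩ = some f := by
                rw [shiftFin_eq_some]
                change f.val - 1 + 1 = f
                omega
              exact ⟨_, ⟨f, hf, h⟩, h⟩
        by_cases hC0 : 0 ∈ C
        · refine cont [y] h5 ?_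
          rw [DFA.evalFrom_singleton, hS, starDFA_step_e hy hA, Set.insert_sdiff_singleton,
            Set.insert_eq_of_mem hC0]
        · rwa [Set.sdiff_singleton_eq_self hC0] at h5
    exact h4 k B fun f _ => f.2
  · have hB : B = ∅ := Set.eq_empty_of_forall_notMem fun f hf => hA (hP ⟨f, hf⟩)
    rwa [hB]

/-- A non-final i is detected by clearing the final states, deleting all non-final states but i,
moving i to 0 and applying e. A final f is detected after filling the non-final block, where
deleting the other final states causes no interference. -/
theorem starDFA_distinguish (hρ : fiveLetters ⊆ Set.range ρ) {P P' : Set (Fin p ⊕ Fin k)}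
    (hP : P ∈ starSets 0) (hP' : P' ∈ starSets 0)
    (h : ∀ w, HitsFinal ((starDFA ((W p k).comap ρ)).evalFrom P w) ↔
      HitsFinal ((starDFA ((W p k).comap ρ)).evalFrom P' w)) : P ≤ P' := by
  classical
  obtain ⟨x₁, hx₁⟩ := hρ (show Letter.d₁ ∈ fiveLetters by simp [fiveLetters])
  obtain ⟨x₂, hx₂⟩ := hρ (show Letter.d₂ ∈ fiveLetters by simp [fiveLetters])
  obtain ⟨y, hy⟩ := hρ (show Letter.e ∈ fiveLetters by simp [fiveLetters])
  obtain ⟨A, B, rfl⟩ := exists_eq_pairSet P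
  obtain ⟨A', B', rfl⟩ := exists_eq_pairSet P'
  rintro (i | f) hz
  · have ht : Realizes (W p k) {.a, .b, .d₁} (blockPerm (Equiv.swap i 0) 1 ∘ _) :=
      (realizes_blockPerm (by simp) (by simp) _ _).comp (realizes_inl_filter (k := k) {i})
    obtain ⟨w, hw⟩ := exists_starDFA_evalFrom_inl hρ ht
    have key : ∀ (C : Set (Fin p)) (D : Set (Fin k)), (D.Nonempty → 0 ∈ C) →
        (HitsFinal ((starDFA ((W p k).comap ρ)).evalFrom (pairSet C D)
          (List.replicate k x₂ ++ w ++ [y])) ↔ i ∈ C) := by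
      intro C D hD
      rw [DFA.evalFrom_append_singleton, DFA.evalFrom_of_append, starDFA_replicate_d₂ hx₂ hD, hw]
      unfold HitsFinal
      simp only [inr_mem_starDFA_step, inr_mem_image_e hy, Set.mem_ofPred_eq]
      constructor
      · rintro ⟨f, ⟨j, hj, h⟩ | ⟨⟨j, hj, h⟩, -⟩⟩
        · by_cases hji : j = i <;> simp [hji] at h
        · by_cases hji : j = i
          · rwa [← hji]
          · simp [hji] at h
      · intro hi
        exact ⟨0, Or.inr ⟨⟨i, hi, by simp⟩, rfl⟩⟩
    exact (key A' B' fun ⟨f, hf⟩ => hP' ⟨f, hf⟩).1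
      ((h _).1 ((key A B fun ⟨f, hf⟩ => hP ⟨f, hf⟩).2 hz))
  · obtain ⟨w, hw⟩ := exists_starDFA_evalFrom_inr hρ (realizes_inr_filter (p := p) {f})
    have key : ∀ (C : Set (Fin p)) (D : Set (Fin k)), D.Nonempty →
        (HitsFinal ((starDFA ((W p k).comap ρ)).evalFrom (pairSet C D)
          (List.replicate p x₁ ++ w)) ↔ f ∈ D) := by
      intro C D hD
      rw [DFA.evalFrom_of_append, starDFA_replicate_d₁ hx₁ hD, hw]
      constructor
      · rintro ⟨g, z | z, hz, h⟩
        · simp at h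
        · by_cases hzf : z = f
          · rwa [← hzf]
          · simp [hzf] at h
      · intro hf
        exact ⟨f, .inr f, hf, by simp⟩
    -- The filling requires a final state in the second set too; the empty word provides it.
    obtain ⟨g, hg⟩ := (h []).1 ⟨f, hz⟩
    exact (key A' B' ⟨g, hg⟩).1 ((h _).1 ((key A B ⟨f, hz⟩).2 hz))

theorem complexity_kstar_comap (hρ : fiveLetters ⊆ Set.range ρ) :
    complexity (((W p k).comap ρ).accepts∗) = (starBound (p + k + 1) k : ℕ∞) := by
  obtain ⟨x₁, hx₁⟩ := hρ (show Letter.d₁ ∈ fiveLetters by simp [fiveLetters])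
  have hM := (W_convex p k).comap ρ
  have hvalid : ∀ w ≠ [], (starDFA ((W p k).comap ρ)).eval w ∈ starSets 0 := by
    intro w hw
    have := hM.starState_mem (i := 0) rfl w
    rw [starState, if_neg hw, Set.mem_insert_iff, (Option.some_injective _).mem_set_image] at this
    simpa using this
  -- A non-empty word of the star stays in the star after d₁, which fixes final states, but d₁
  -- itself is not in the star. So the empty word needs a state of its own.
  have hnil : ∀ w, w ≠ [] →
      (((W p k).comap ρ).accepts∗).leftQuotient [] ≠ (((W p k).comap ρ).accepts∗).leftQuotient w := by
    intro w hw h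
    have h1 := Set.ext_iff.1 h []
    have h2 := Set.ext_iff.1 h [x₁]
    erw [hM.mem_leftQuotient_kstar, hM.mem_leftQuotient_kstar] at h1 h2
    simp only [List.append_nil, true_or, hw, false_or, true_iff, List.nil_append,
      List.cons_ne_self, List.append_eq_nil_iff, and_false, DFA.evalFrom_nil] at h1 h2
    obtain ⟨f, hf⟩ := h1
    obtain ⟨g, hg⟩ := h2.2 ⟨f, by
      rw [DFA.evalFrom_singleton, inr_mem_starDFA_step, inr_mem_image_d₁ hx₁]
      exact hf⟩
    rw [DFA.evalFrom_singleton, inr_mem_starDFA_step, inr_mem_image_d₁ hx₁] at hg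
    have : some (Sum.inr g) = some (Sum.inl (0 : Fin p)) := hg
    simp at this
  rw [complexity_eq_of_ker (starState ((W p k).comap ρ)), ← encard_starSets (0 : Fin p)]
  · congr 1
    refine Set.Subset.antisymm (Set.range_subset_iff.2 (hM.starState_mem rfl)) ?_
    rintro _ (rfl | ⟨P, hP, rfl⟩)
    · exact ⟨[], if_pos rfl⟩
    · obtain ⟨w, hw, rfl⟩ := starDFA_reach hρ hP
      exact ⟨w, if_neg hw⟩
  · refine fun w w' => ⟨fun h => ?_, hM.leftQuotient_kstar_eq⟩
    by_cases hw : w = [] <;> by_cases hw' : w' = []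
    · rw [hw, hw']
    · subst hw
      exact absurd h (hnil w' hw')
    · subst hw'
      exact absurd h.symm (hnil w hw)
    · rw [starState, starState, if_neg hw, if_neg hw']
      have h1 : ∀ x, HitsFinal ((starDFA ((W p k).comap ρ)).evalFrom
          ((starDFA ((W p k).comap ρ)).eval w) x) ↔ HitsFinal ((starDFA ((W p k).comap ρ)).evalFrom
          ((starDFA ((W p k).comap ρ)).eval w') x) := by
        intro x
        have h2 := Set.ext_iff.1 h x
        erw [hM.mem_leftQuotient_kstar, hM.mem_leftQuotient_kstar] at h2
        simpa [hw, hw'] using h2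
      exact congrArg some (le_antisymm (starDFA_distinguish hρ (hvalid w hw) (hvalid w' hw') h1)
        (starDFA_distinguish hρ (hvalid w' hw') (hvalid w hw) fun x => (h1 x).symm))

end

end PrefixConvex

namespace PrefixConvex

/-! ### The product -/

section product

variable {α : Type u} {p j q k : ℕ} {M : DFA α (St p j)} {M' : DFA α (St q k)}

/-- The automaton of the product: it keeps track of the state of the first automaton and of the
states, other than the sink, of the second one. -/
def prodDFA (M : DFA α (St p j)) (M' : DFA α (St q k)) :
    DFA α (St p j × Set (Fin q ⊕ Fin k)) where
  step s x := (M.step s.1 x, image M' [x] s.2 ∪ {z | M.step s.1 x ∈ M.accept ∧ some z = M'.start})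
  start := (M.start, ∅)
  accept := {s | HitsFinal s.2}

theorem mem_prodDFA_step {s : St p j × Set (Fin q ⊕ Fin k)} {x : α} {z : Fin q ⊕ Fin k} :
    z ∈ ((prodDFA M M').step s x).2 ↔
      z ∈ image M' [x] s.2 ∨ M.step s.1 x ∈ M.accept ∧ some z = M'.start := Iff.rfl

theorem prodDFA_evalFrom_fst (s : St p j × Set (Fin q ⊕ Fin k)) (w : List α) :
    ((prodDFA M M').evalFrom s w).1 = M.evalFrom s.1 w := by
  induction w generalizing s with
  | nil => rfl
  | cons x w ih => rw [DFA.evalFrom_cons, DFA.evalFrom_cons, ih]; rfl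

theorem ConvexDFA.prodDFA_evalFrom_none (hM : ConvexDFA M) (hM' : ConvexDFA M')
    (P : Set (Fin q ⊕ Fin k)) (w : List α) :
    (prodDFA M M').evalFrom (none, P) w = (none, image M' w P) := by
  induction w generalizing P with
  | nil => simp
  | cons x w ih =>
    have : (prodDFA M M').step (none, P) x = (none, image M' [x] P) := by
      refine Prod.ext (hM.step_none x) (Set.ext fun z => ?_)
      rw [mem_prodDFA_step, hM.step_none, hM.accept]
      simp
    rw [DFA.evalFrom_cons, this, ih, ← hM'.image_append, List.singleton_append]

/-- The second component records the states reached by v over all factorizations w = uv with u in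
the first language. -/
theorem ConvexDFA.mem_prodDFA_eval (hM : ConvexDFA M) (hM' : ConvexDFA M') (w : List α)
    (z : Fin q ⊕ Fin k) : z ∈ ((prodDFA M M').eval w).2 ↔
      ∃ u v, w = u ++ v ∧ u ∈ M.accepts ∧ M'.eval v = some z := by
  induction w using List.reverseRecOn generalizing z with
  | nil =>
    change z ∈ (∅ : Set _) ↔ _
    simp only [Set.mem_empty_iff_false, false_iff]
    rintro ⟨u, v, h, hu, -⟩
    obtain ⟨rfl, rfl⟩ := List.append_eq_nil_iff.1 h.symm
    obtain ⟨i, hi⟩ := hM.start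
    obtain ⟨f, hf⟩ := (hM.accept _).1 hu
    have : M.start = some (.inr f) := hf
    rw [hi] at this
    simp at this
  | append_singleton w x ih =>
    have hw : ((prodDFA M M').eval w).1 = M.eval w := prodDFA_evalFrom_fst _ w
    rw [DFA.eval_append_singleton, mem_prodDFA_step, mem_image_singleton, hw,
      ← DFA.eval_append_singleton]
    constructor
    · rintro (⟨y, hy, h⟩ | ⟨h1, h2⟩)
      · obtain ⟨u, v, rfl, hu, hv⟩ := (ih y).1 hy
        exact ⟨u, v ++ [x], by simp, hu, by rw [DFA.eval_append_singleton, hv, h]⟩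
      · exact ⟨w ++ [x], [], by simp, h1, h2.symm⟩
    · rintro ⟨u, v, h, hu, hv⟩
      rcases List.eq_nil_or_concat' v with rfl | ⟨v', y, rfl⟩
      · rw [List.append_nil] at h
        subst h
        exact Or.inr ⟨hu, hv.symm⟩
      · rw [← List.append_assoc] at h
        obtain ⟨rfl, h⟩ := List.append_inj' h rfl
        obtain rfl : x = y := by simpa using h
        rw [DFA.eval_append_singleton] at hv
        rcases hy : M'.eval v' with _ | y
        · rw [hy, hM'.step_none] at hv
          cases hv
        · exact Or.inl ⟨y, (ih y).2 ⟨u, v', rfl, hu, hy⟩, by rw [← hv, hy]⟩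

theorem ConvexDFA.accepts_prodDFA (hM : ConvexDFA M) (hM' : ConvexDFA M') :
    (prodDFA M M').accepts = M.accepts * M'.accepts := by
  ext w
  rw [Language.mem_mul]
  change HitsFinal ((prodDFA M M').eval w).2 ↔ _
  unfold HitsFinal
  simp only [hM.mem_prodDFA_eval hM']
  constructor
  · rintro ⟨f, u, v, rfl, hu, hv⟩
    exact ⟨u, hu, v, (hM'.accept _).2 ⟨f, hv⟩, rfl⟩
  · rintro ⟨u, hu, v, hv, rfl⟩
    obtain ⟨f, hf⟩ := (hM'.accept _).1 hv
    exact ⟨f, u, v, rfl, hu, hf⟩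

/-- The states of the automaton of the product that can be reachable. -/
def prodStates (p j k : ℕ) {q : ℕ} (i' : Fin q) : Set (St p j × Set (Fin q ⊕ Fin k)) :=
  {s | (∀ i, s.1 = some (.inl i) → s.2 = ∅) ∧ ∀ f, s.1 = some (.inr f) → .inl i' ∈ s.2}

/-- A first component that is non-final and not the sink has never been final, so the second
automaton has not been started; a final one has just started it. -/
theorem ConvexDFA.prodDFA_step_mem (hM : ConvexDFA M) {i' : Fin q}
    (hi' : M'.start = some (.inl i')) {s : St p j × Set (Fin q ⊕ Fin k)}
    (hs : s ∈ prodStates p j k i') (x : α) : (prodDFA M M').step s x ∈ prodStates p j k i' := by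
  refine ⟨fun i h => ?_, fun f h => ?_⟩
  · have h' : M.step s.1 x = some (.inl i) := h
    refine Set.eq_empty_of_forall_notMem fun z hz => ?_
    rw [mem_prodDFA_step, h', hM.accept, mem_image_singleton] at hz
    obtain ⟨y, hy, -⟩ | ⟨⟨f, hf⟩, -⟩ := hz
    · rcases hs1 : s.1 with _ | i' | f
      · rw [hs1, hM.step_none] at h'
        cases h'
      · rw [hs.1 i' hs1] at hy
        exact hy
      · rw [hs1] at h'
        exact hM.step_inr _ _ _ h'
    · simp at hf
  · exact mem_prodDFA_step.2 (Or.inr ⟨(hM.accept _).2 ⟨f, h⟩, hi'.symm⟩)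

theorem ConvexDFA.prodDFA_evalFrom_mem (hM : ConvexDFA M) {i' : Fin q}
    (hi' : M'.start = some (.inl i')) {s : St p j × Set (Fin q ⊕ Fin k)}
    (hs : s ∈ prodStates p j k i') (w : List α) :
    (prodDFA M M').evalFrom s w ∈ prodStates p j k i' := by
  induction w generalizing s with
  | nil => exact hs
  | cons x w ih => exact ih (hM.prodDFA_step_mem hi' hs x)

theorem ConvexDFA.prodDFA_eval_mem (hM : ConvexDFA M) {i' : Fin q}
    (hi' : M'.start = some (.inl i')) (w : List α) :
    (prodDFA M M').eval w ∈ prodStates p j k i' := by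
  obtain ⟨i, hi⟩ := hM.start
  refine hM.prodDFA_evalFrom_mem hi' ⟨fun _ _ => rfl, fun f h => ?_⟩ w
  have : M.start = _ := h
  rw [hi] at this
  simp at this

theorem encard_powerset_compl_singleton {X : Type*} [Finite X] (x : X) :
    (𝒫 ({x}ᶜ : Set X)).encard = (2 ^ (Nat.card X - 1) : ℕ) := by
  rw [← Set.Finite.cast_ncard_eq (Set.toFinite _), Set.ncard_powerset, Set.ncard_compl]
  simp

/-- The three summands come from the first component: p non-final states with the empty set, j final
states with sets containing the initial state, and the sink with arbitrary sets. -/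
theorem encard_prodStates (i' : Fin q) : (prodStates p j k i').encard =
    (productBound (p + j + 1) j (q + k + 1) : ℕ∞) := by
  have hq : 1 ≤ q := by have := i'.2; omega
  have h : prodStates p j k i' =
      (Set.range fun i => (some (.inl i), ∅)) ∪
        (fun s : Fin j × Set (Fin q ⊕ Fin k) => (some (.inr s.1), insert (.inl i') s.2)) ''
          (Set.univ ×ˢ 𝒫 {.inl i'}ᶜ) ∪ Set.range fun P => (none, P) := by
    ext ⟨s, P⟩
    constructor
    · rintro ⟨h1, h2⟩
      rcases s with _ | i | f
      · exact Or.inr ⟨P, rfl⟩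
      · exact Or.inl (Or.inl ⟨i, Prod.ext rfl (h1 i rfl).symm⟩)
      · refine Or.inl (Or.inr ⟨(f, P \ {.inl i'}), ⟨trivial, fun z hz => Set.mem_compl hz.2⟩,
          Prod.ext rfl ?_⟩)
        change insert _ (P \ _) = P
        rw [Set.insert_sdiff_singleton, Set.insert_eq_of_mem (h2 f rfl)]
    · rintro ((⟨i, h⟩ | ⟨⟨f, Q⟩, -, h⟩) | ⟨Q, h⟩) <;> obtain ⟨rfl, rfl⟩ := Prod.mk.inj h
      · exact ⟨fun _ _ => rfl, by simp⟩
      · exact ⟨by simp, fun _ _ => Set.mem_insert _ _⟩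
      · exact ⟨by simp, by simp⟩
  have c1 : (Set.range fun i : Fin p => ((some (.inl i), ∅) :
      St p j × Set (Fin q ⊕ Fin k))).encard = (p : ℕ) := by
    rw [← Set.image_univ, Function.Injective.encard_image, Set.encard_univ,
      ENat.card_eq_coe_fintype_card, Fintype.card_fin]
    intro i i' h
    simpa using h
  have c2 : ((fun s : Fin j × Set (Fin q ⊕ Fin k) =>
      ((some (.inr s.1), insert (.inl i') s.2) : St p j × Set (Fin q ⊕ Fin k))) ''
          (Set.univ ×ˢ 𝒫 {.inl i'}ᶜ)).encard = (j * 2 ^ (q + k - 1) : ℕ) := by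
    rw [Set.InjOn.encard_image, Set.encard_prod, encard_powerset_compl_singleton, Set.encard_univ,
      ENat.card_eq_coe_fintype_card, Fintype.card_fin]
    · simp
    · rintro ⟨f, Q⟩ ⟨-, hQ⟩ ⟨f', Q'⟩ ⟨-, hQ'⟩ h
      have h1 : ∀ R ∈ 𝒫 ({.inl i'}ᶜ : Set (Fin q ⊕ Fin k)), insert (.inl i') R \ {.inl i'} = R :=
        fun R hR => Set.insert_sdiff_self_of_notMem fun h => hR h rfl
      simp only [Prod.mk.injEq, Option.some.injEq, Sum.inr.injEq] at h
      exact Prod.ext h.1 (by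
        change Q = Q'
        rw [← h1 Q hQ, h.2, h1 Q' hQ'])
  have c3 : (Set.range fun P : Set (Fin q ⊕ Fin k) => ((none, P) :
      St p j × Set (Fin q ⊕ Fin k))).encard = (2 ^ (q + k) : ℕ) := by
    rw [← Set.image_univ, Function.Injective.encard_image, Set.encard_univ,
      ENat.card_eq_coe_fintype_card]
    · simp
    · intro i i' h
      simpa using h
  rw [h, Set.encard_union_eq, Set.encard_union_eq, c1, c2, c3, productBound,
    show p + j + 1 - 1 - j = p by omega, show q + k + 1 - 2 = q + k - 1 by omega,
    show q + k + 1 - 1 = q + k by omega]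
  · push_cast
    rfl
  · rw [Set.disjoint_left]
    rintro _ ⟨i, rfl⟩ ⟨s, -, h⟩
    simp at h
  · rw [Set.disjoint_left]
    rintro _ (⟨i, rfl⟩ | ⟨s, -, rfl⟩) ⟨P, h⟩ <;> simp at h

theorem complexity_mul_le (hM : ConvexDFA M) (hM' : ConvexDFA M') :
    complexity (M.accepts * M'.accepts) ≤ (productBound (p + j + 1) j (q + k + 1) : ℕ∞) := by
  obtain ⟨i', hi'⟩ := hM'.start
  rw [← encard_prodStates i', ← hM.accepts_prodDFA hM']
  refine complexity_le_of_ker (prodDFA M M').eval _ (hM.prodDFA_eval_mem hi') fun w w' h => ?_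
  rw [Language.leftQuotient_accepts, Function.comp_apply, Function.comp_apply, h]

end product

/-- With d = m - 2 - j and X = 2^(n-2), the difference of the two sides is d(X - 1), and X ≥ 2. -/
theorem productBound_le {m j n : ℕ} (hn : 3 ≤ n) (hm : 3 ≤ m) (hj : j ≤ m - 2) :
    productBound m j n ≤ m * 2 ^ (n - 2) + 1 ∧
      (productBound m j n = m * 2 ^ (n - 2) + 1 ↔ j = m - 2) := by
  unfold productBound
  obtain ⟨d, rfl⟩ : ∃ d, m = j + d + 2 := ⟨m - 2 - j, by omega⟩
  obtain ⟨r, rfl⟩ : ∃ r, n = r + 3 := ⟨n - 3, by omega⟩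
  rw [show j + d + 2 - 1 - j = d + 1 by omega, show r + 3 - 2 = r + 1 by omega,
    show r + 3 - 1 = r + 1 + 1 by omega, show j + d + 2 - 2 = j + d by omega, pow_succ 2 (r + 1)]
  have h2 : 2 ≤ 2 ^ (r + 1) := by
    rw [pow_succ]
    have := Nat.one_le_two_pow (n := r)
    omega
  generalize 2 ^ (r + 1) = X at h2
  have e : (j + d + 2) * X = j * X + d * X + 2 * X := by ring
  rw [e]
  have hd : 2 * d ≤ d * X := by nlinarith
  refine ⟨by omega, fun h => ?_, fun h => ?_⟩
  · omega
  · obtain rfl : d = 0 := by omega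
    omega

end PrefixConvex

namespace PrefixConvex

/-! ### The product of the witnesses -/

section images

variable {β : Type} {p k : ℕ} [NeZero p] [NeZero k] {ρ : β → Letter}

theorem inl_mem_image_ab {x : β} {b : Bool} (hx : ρ x = ab b) {P : Set (Fin p ⊕ Fin k)}
    {i : Fin p} : .inl (gen p b i) ∈ image ((W p k).comap ρ) [x] P ↔ .inl i ∈ P := by
  simp only [mem_image_singleton, DFA.comap_step, hx, Sum.exists, W_step_ab]
  simp

theorem inr_mem_image_ab {x : β} {b : Bool} (hx : ρ x = ab b) {P : Set (Fin p ⊕ Fin k)}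
    {f : Fin k} : .inr (gen k (!b) f) ∈ image ((W p k).comap ρ) [x] P ↔ .inr f ∈ P := by
  simp only [mem_image_singleton, DFA.comap_step, hx, Sum.exists, W_step_ab]
  simp

theorem inl_mem_image_c₁ {x : β} (hx : ρ x = .c₁) {P : Set (Fin p ⊕ Fin k)} {i : Fin p} :
    .inl i ∈ image ((W p k).comap ρ) [x] P ↔ ∃ j, .inl j ∈ P ∧ mergeFin p j = i := by
  simp only [mem_image_singleton, DFA.comap_step, hx, Sum.exists]
  simp [W, stepW]

theorem inr_mem_image_c₁ {x : β} (hx : ρ x = .c₁) {P : Set (Fin p ⊕ Fin k)} {f : Fin k} :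
    .inr f ∈ image ((W p k).comap ρ) [x] P ↔ .inr f ∈ P := by
  simp only [mem_image_singleton, DFA.comap_step, hx, Sum.exists]
  simp [W, stepW]

theorem image_replicate_d₁_d₂ {x y : β} (hx : ρ x = .d₁) (hy : ρ y = .d₂)
    (P : Set (Fin p ⊕ Fin k)) :
    image ((W p k).comap ρ) (List.replicate p x ++ List.replicate k y) P = ∅ := by
  have hM := (W_convex p k).comap ρ
  have h1 : ∀ l i, .inl i ∈ image ((W p k).comap ρ) (List.replicate l x) P → l ≤ i.val := by
    intro l
    induction l with
    | zero => simp
    | succ l ih =>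
      intro i hi
      rw [List.replicate_succ', hM.image_append, inl_mem_image_d₁ hx] at hi
      obtain ⟨j, hj, hji⟩ := hi
      have := ih j hj
      rw [shiftFin_eq_some] at hji
      omega
  rw [hM.image_append]
  have h2 : ∀ l, (∀ i, .inl i ∉ image ((W p k).comap ρ) (List.replicate l y)
      (image ((W p k).comap ρ) (List.replicate p x) P)) ∧
      ∀ f, .inr f ∈ image ((W p k).comap ρ) (List.replicate l y)
        (image ((W p k).comap ρ) (List.replicate p x) P) → l ≤ f.val := by
    intro l
    induction l with
    | zero => exact ⟨fun i hi => absurd (h1 p i (by simpa using hi)) (by omega), by simp⟩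
    | succ l ih =>
      rw [List.replicate_succ', hM.image_append]
      refine ⟨fun i hi => ih.1 i ((inl_mem_image_d₂ hy).1 hi), fun f hf => ?_⟩
      obtain ⟨g, hg, hgf⟩ := (inr_mem_image_d₂ hy).1 hf
      have := ih.2 g hg
      rw [shiftFin_eq_some] at hgf
      omega
  refine Set.eq_empty_of_forall_notMem ?_
  rintro (i | f) hz
  · exact (h2 k).1 i hz
  · have := (h2 k).2 f hz
    omega

theorem evalFrom_inr_of_ne_d₂ {w : List β} (hw : ∀ x ∈ w, ρ x ≠ .d₂) (f : Fin k) :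
    ∃ f', ((W p k).comap ρ).evalFrom (some (.inr f)) w = some (.inr f') := by
  induction w generalizing f with
  | nil => exact ⟨f, rfl⟩
  | cons x w ih =>
    obtain ⟨f', h⟩ : ∃ f', ((W p k).comap ρ).step (some (.inr f)) x = some (.inr f') := by
      have := hw x (by simp)
      rw [DFA.comap_step]
      cases h : ρ x <;> simp_all [W, stepW]
    rw [DFA.evalFrom_cons, h]
    exact ih (fun y hy => hw y (by simp [hy])) f'

theorem evalFrom_inl_of_mem {w : List β} (hw : ∀ x ∈ w, ρ x = .a ∨ ρ x = .d₂) (i : Fin p) :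
    ∃ i', ((W p k).comap ρ).evalFrom (some (.inl i)) w = some (.inl i') := by
  induction w generalizing i with
  | nil => exact ⟨i, rfl⟩
  | cons x w ih =>
    obtain ⟨i', h⟩ : ∃ i', ((W p k).comap ρ).step (some (.inl i)) x = some (.inl i') := by
      rw [DFA.comap_step]
      rcases hw x (by simp) with h | h <;> rw [h] <;> simp [W, stepW]
    rw [DFA.evalFrom_cons, h]
    exact ih (fun y hy => hw y (by simp [hy])) i'

theorem evalFrom_inr_replicate_d₂ {x : β} (hx : ρ x = .d₂) (f : Fin k) :
    ((W p k).comap ρ).evalFrom (some (.inr f)) (List.replicate k x) = none := by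
  have hM := (W_convex p k).comap ρ
  have h : ∀ l g, ((W p k).comap ρ).evalFrom (some (.inr f)) (List.replicate l x) =
      some (.inr g) → l ≤ g.val := by
    intro l
    induction l with
    | zero => simp
    | succ l ih =>
      intro g hg
      rw [List.replicate_succ', DFA.evalFrom_append_singleton] at hg
      rcases h : ((W p k).comap ρ).evalFrom (some (.inr f)) (List.replicate l x) with _ | i | g'
      · rw [h, hM.step_none] at hg
        cases hg
      · exact absurd h (hM.evalFrom_inr _ _ _)
      · rw [h, DFA.comap_step, hx] at hg
        have := ih g' h
        have hg : (shiftFin k g').map Sum.inr = some (Sum.inr g : Fin p ⊕ Fin k) := hg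
        rw [Option.map_eq_some_iff] at hg
        obtain ⟨g'', h1, h2⟩ := hg
        obtain rfl := Sum.inr_injective h2
        rw [shiftFin_eq_some] at h1
        omega
  rcases h' : ((W p k).comap ρ).evalFrom (some (.inr f)) (List.replicate k x) with _ | i | g
  · rfl
  · exact absurd h' (hM.evalFrom_inr _ _ _)
  · have := h k g h'
    omega

omit [NeZero p] [NeZero k] in
theorem mergeFin_eq_self_of_ne {i : Fin p} (h : i.val ≠ 1) : mergeFin p i = i := by
  apply Fin.ext
  simp [mergeFin, send, h]

omit [NeZero k] in
theorem mergeFin_of_eq_one {i : Fin p} (h : i.val = 1) : mergeFin p i = 0 := by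
  apply Fin.ext
  have := i.2
  have hp : 2 ≤ p := by omega
  simp [mergeFin, send, h, hp]

omit [NeZero k] in
-- Reading a and then c₁ returns 0 to 0, which keeps the second component small while a acts on the
-- first.
theorem mergeFin_rot_zero : mergeFin p (rot p 0) = 0 := by
  have : (rot p 0).val = 0 ∨ (rot p 0).val = 1 := by
    have := NeZero.pos p
    simp only [rot, cyc, cycleStart, Fin.val_zero]
    split_ifs <;> omega
  rcases this with h | h
  · rw [show rot p 0 = 0 from Fin.ext h]
    exact mergeFin_eq_self_of_ne (by simp)
  · exact mergeFin_of_eq_one h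

end images

/-! ### Reachability in the product automaton -/

section witness

variable {β : Type} {p j q k : ℕ} [NeZero p] [NeZero j] [NeZero q] [NeZero k] {σ : β → Letter}

/-- A step of the automaton of the product between final states of the first factor. -/
theorem prodDFA_step_inr {f f' : Fin j} {A A' : Set (Fin q)} {B B' : Set (Fin k)} {x : β}
    (hs : stepW p j (some (.inr f)) (σ x) = some (.inr f'))
    (hA : ∀ i, i ∈ A' ↔
      i = 0 ∨ .inl i ∈ image ((W q k).comap (prodLetter ∘ σ)) [x] (pairSet A B))
    (hB : ∀ g, g ∈ B' ↔ .inr g ∈ image ((W q k).comap (prodLetter ∘ σ)) [x] (pairSet A B)) :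
    (prodDFA ((W p j).comap σ) ((W q k).comap (prodLetter ∘ σ))).step
      (some (.inr f), pairSet A B) x = (some (.inr f'), pairSet A' B') := by
  have hs' : ((W p j).comap σ).step (some (.inr f)) x = some (.inr f') := hs
  refine Prod.ext hs' ?_
  have hacc : some (.inr f') ∈ ((W p j).comap σ).accept := ⟨f', rfl⟩
  refine eq_pairSet_iff.2 ⟨fun i => ?_, fun g => ?_⟩
  · rw [mem_prodDFA_step, hs', hA, or_comm]
    refine or_congr ?_ Iff.rfl
    simp only [hacc, true_and]
    change some (Sum.inl i) = some (Sum.inl 0) ↔ _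
    simp
  · rw [mem_prodDFA_step, hB, or_iff_left]
    rintro ⟨-, h⟩
    have h : some (Sum.inr g) = some (Sum.inl (0 : Fin q)) := h
    simp at h

theorem fourLetters_subset_prod (hσ : sixLetters ⊆ Set.range σ) :
    fourLetters ⊆ Set.range (prodLetter ∘ σ) := by
  rintro x hx
  obtain ⟨y, hy⟩ : ∃ y, σ y = prodLetter x :=
    hσ (by rcases hx with rfl | rfl | rfl | rfl <;> simp [prodLetter, sixLetters])
  exact ⟨y, by rcases hx with rfl | rfl | rfl | rfl <;> simp [prodLetter, hy]⟩

theorem fourLetters_subset_six (hσ : sixLetters ⊆ Set.range σ) : fourLetters ⊆ Set.range σ := by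
  refine Set.Subset.trans ?_ hσ
  rintro x (rfl | rfl | rfl | rfl) <;> simp [sixLetters]

/-- In the second factor b and d₂ are exchanged. With the first component final, its state is
positioned by b and ac₁ while the second set stays {0}; then d₁ and c₁ build the non-final part, and
b and e the final part. Entering the sink by d₂ loses nothing, and from there the second set can be
thinned freely. -/
theorem prodDFA_reach (hσ : sixLetters ⊆ Set.range σ) {s : St p j × Set (Fin q ⊕ Fin k)}
    (hs : s ∈ prodStates p j k (0 : Fin q)) :
    ∃ w, (prodDFA ((W p j).comap σ) ((W q k).comap (prodLetter ∘ σ))).eval w = s := by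
  classical
  have hM := (W_convex p j).comap σ
  have hM' := (W_convex q k).comap (prodLetter ∘ σ)
  obtain ⟨xa, ha⟩ := hσ (show Letter.a ∈ sixLetters by simp [sixLetters])
  obtain ⟨xb, hb⟩ := hσ (show Letter.b ∈ sixLetters by simp [sixLetters])
  obtain ⟨xc, hc⟩ := hσ (show Letter.c₁ ∈ sixLetters by simp [sixLetters])
  obtain ⟨x₁, hx₁⟩ := hσ (show Letter.d₁ ∈ sixLetters by simp [sixLetters])
  obtain ⟨x₂, hx₂⟩ := hσ (show Letter.d₂ ∈ sixLetters by simp [sixLetters])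
  obtain ⟨y, hy⟩ := hσ (show Letter.e ∈ sixLetters by simp [sixLetters])
  have ha' : (prodLetter ∘ σ) xa = ab true := by simp [ha, prodLetter, ab]
  have hb' : (prodLetter ∘ σ) xb = .d₂ := by simp [hb, prodLetter]
  have hc' : (prodLetter ∘ σ) xc = .c₁ := by simp [hc, prodLetter]
  have hx₁' : (prodLetter ∘ σ) x₁ = .d₁ := by simp [hx₁, prodLetter]
  have hx₂' : (prodLetter ∘ σ) x₂ = ab false := by simp [hx₂, prodLetter, ab]
  have hy' : (prodLetter ∘ σ) y = .e := by simp [hy, prodLetter]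
  obtain ⟨N, hN⟩ : ∃ N, N = prodDFA ((W p j).comap σ) ((W q k).comap (prodLetter ∘ σ)) := ⟨_, rfl⟩
  have cont : ∀ {s t} (v : List β), (∃ w, N.eval w = s) → N.evalFrom s v = t →
      ∃ w, N.eval w = t := by
    rintro s t v ⟨w, hw⟩ h
    exact ⟨w ++ v, by rw [DFA.eval, DFA.evalFrom_of_append, ← DFA.eval, hw, h]⟩
  rw [← hN]
  have h0 : ∃ w, N.eval w = (some (.inr 0), pairSet {0} ∅) := by
    refine ⟨[y], ?_⟩
    have hstep : ((W p j).comap σ).step (some (.inl 0)) y = some (.inr 0) := by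
      rw [DFA.comap_step, hy]
      simp [W, stepW]
    change N.step N.start y = _
    rw [hN]
    refine Prod.ext hstep ?_
    have hacc : ((W p j).comap σ).step (some (.inl 0)) y ∈ ((W p j).comap σ).accept := by
      rw [hstep]
      exact ⟨0, rfl⟩
    refine eq_pairSet_iff.2 ⟨fun i => ?_, fun f => ?_⟩
    · rw [mem_prodDFA_step]
      constructor
      · rintro (⟨y, hy, -⟩ | ⟨-, h⟩)
        · exact absurd hy id
        · have h : some (Sum.inl i) = some (Sum.inl (0 : Fin q)) := h
          simpa using h
      · rintro rfl
        exact Or.inr ⟨hacc, rfl⟩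
    · rw [mem_prodDFA_step]
      simp only [Set.mem_empty_iff_false, iff_false]
      rintro (⟨y, hy, -⟩ | ⟨-, h⟩)
      · exact hy
      · have h : some (Sum.inr f) = some (Sum.inl (0 : Fin q)) := h
        simp at h
  have h1 : ∀ f, ∃ w, N.eval w = (some (.inr f), pairSet {0} ∅) := by
    have hgen : ∀ w : List Bool, ∀ f, ∃ v, N.evalFrom (some (.inr f), pairSet {0} ∅) v =
        (some (.inr (permOf j w f)), pairSet {0} ∅) := by
      intro w
      induction w with
      | nil => exact fun f => ⟨[], by simp [permOf]⟩
      | cons b w ih =>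
        intro f
        obtain ⟨v, hv⟩ : ∃ v, N.evalFrom (some (.inr f), pairSet {0} ∅) v =
            (some (.inr (gen j b f)), pairSet {0} ∅) := by
          cases b
          -- On the final states of the first factor c₁ is the identity, so ac₁ acts as the
          -- transposition; in the second factor c₁ repairs what a did to 0.
          · refine ⟨[xa, xc], ?_⟩
            rw [DFA.evalFrom_cons, DFA.evalFrom_singleton, hN,
              prodDFA_step_inr (f' := tw j f) (A' := {0, rot q 0}) (B' := ∅) (by rw [ha]; rfl)
                (fun i => ?_) fun g => ?_,
              prodDFA_step_inr (f' := tw j f) (A' := {0}) (B' := ∅) (by rw [hc]; rfl)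
                (fun i => ?_) fun g => ?_]
            · rfl
            · rw [inl_mem_image_c₁ hc']
              constructor
              · rintro rfl
                exact Or.inl rfl
              · rintro (rfl | ⟨i', rfl | rfl, rfl⟩)
                · rfl
                · exact mergeFin_eq_self_of_ne (i := (0 : Fin q)) (by simp)
                · exact mergeFin_rot_zero (p := q)
            · rw [inr_mem_image_c₁ hc']
              rfl
            · obtain ⟨i, rfl⟩ := (gen q true).surjective i
              rw [inl_mem_image_ab ha', inl_mem_pairSet, Set.mem_insert_iff]
              refine or_congr Iff.rfl ?_
              exact (gen q true).injective.eq_iff (b := 0)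
            · obtain ⟨g, rfl⟩ := (gen k false).surjective g
              exact Iff.trans (by simp) (inr_mem_image_ab ha').symm
          · refine ⟨[xb], ?_⟩
            rw [DFA.evalFrom_singleton, hN]
            refine prodDFA_step_inr (f' := rot j f) (by rw [hb]; rfl) (fun i => ?_) fun g => ?_
            · rw [inl_mem_image_d₂ hb']
              simp
            · rw [inr_mem_image_d₂ hb']
              simp
        obtain ⟨v', hv'⟩ := ih (gen j b f)
        exact ⟨v ++ v', by rw [DFA.evalFrom_of_append, hv, hv', permOf_cons]; rfl⟩
    intro f
    obtain ⟨w, hw, -⟩ := exists_permOf j 1 (Equiv.swap 0 f) 1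
    obtain ⟨v, hv⟩ := hgen w 0
    rw [hw, Equiv.swap_apply_left] at hv
    exact cont v h0 hv
  have h2 : ∀ f l, ∀ A : Set (Fin q), 0 ∈ A → (∀ i ∈ A, i.val ≤ l) →
      ∃ w, N.eval w = (some (.inr f), pairSet A ∅) := by
    intro f l
    induction l with
    | zero =>
      intro A hA hl
      rw [show A = {0} from Set.eq_singleton_iff_unique_mem.2
        ⟨hA, fun i hi => Fin.ext (Nat.le_zero.1 (hl i hi))⟩]
      exact h1 f
    | succ l ih =>
      intro A hA hl
      -- After d₁ the state 1 is always present, being the successor of 0, and 0 is started again.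
      -- If 1 is not wanted, c₁ merges it into 0.
      have hC : ∃ w, N.eval w = (some (.inr f), pairSet {i | i = 0 ∨ i.val = 1 ∨ i ∈ A} ∅) := by
        refine cont [x₁] (ih {i | i = 0 ∨ ∃ i' ∈ A, shiftFin q i = some i'} (Or.inl rfl) ?_) ?_
        · rintro i (rfl | ⟨i', hi', h⟩)
          · simp
          · have := hl i' hi'
            rw [shiftFin_eq_some] at h
            omega
        · rw [DFA.evalFrom_singleton, hN]
          refine prodDFA_step_inr (by rw [hx₁]; rfl) (fun i => ?_) fun g => ?_
          · rw [inl_mem_image_d₁ hx₁']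
            by_cases hi0 : i = 0
            · simp [hi0]
            have h0 : i.val ≠ 0 := fun h => hi0 (Fin.ext h)
            simp only [Set.mem_ofPred_eq, hi0, false_or, inl_mem_pairSet]
            constructor
            · intro h
              have hs : shiftFin q ⟨i - 1, by omega⟩ = some i := by
                rw [shiftFin_eq_some]
                change i.val - 1 + 1 = i
                omega
              refine ⟨_, ?_, hs⟩
              rcases h with h | h
              · exact Or.inl (Fin.ext (by simp [h]))
              · exact Or.inr ⟨i, h, hs⟩
            · rintro ⟨i', rfl | ⟨i'', h1, h2⟩, h⟩
              · rw [shiftFin_eq_some] at h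
                exact Or.inl (by simpa using h.symm)
              · right
                rwa [← Option.some.inj (h2.symm.trans h)]
          · rw [inr_mem_image_d₁ hx₁']
            rfl
      by_cases hA1 : ∃ i ∈ A, i.val = 1
      · obtain ⟨i₁, hi₁, h⟩ := hA1
        convert hC using 4
        congr 1
        ext i
        constructor
        · exact fun h => Or.inr (Or.inr h)
        · rintro (rfl | hi | hi)
          · exact hA
          · rwa [show i = i₁ from Fin.ext (by omega)]
          · exact hi
      · refine cont [xc] hC ?_
        rw [DFA.evalFrom_singleton, hN]
        refine prodDFA_step_inr (by rw [hc]; rfl) (fun i => ?_) fun g => ?_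
        · rw [inl_mem_image_c₁ hc']
          constructor
          · intro hi
            exact Or.inr ⟨i, Or.inr (Or.inr hi),
              mergeFin_eq_self_of_ne fun h => hA1 ⟨i, hi, h⟩⟩
          · rintro (rfl | ⟨i', rfl | hi' | hi', rfl⟩)
            · exact hA
            · rwa [mergeFin_eq_self_of_ne (by simp)]
            · rwa [mergeFin_of_eq_one hi']
            · rwa [mergeFin_eq_self_of_ne fun h => hA1 ⟨_, hi', h⟩]
        · rw [inr_mem_image_c₁ hc']
          rfl
  have h3 : ∀ A : Set (Fin q), 0 ∈ A → ∀ l f, ∀ B : Set (Fin k), (∀ g ∈ B, g.val < l) →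
      ∃ w, N.eval w = (some (.inr f), pairSet A B) := by
    intro A hA l
    induction l with
    | zero =>
      intro f B hB
      rw [Set.eq_empty_of_forall_notMem fun g hg => absurd (hB g hg) (by omega)]
      exact h2 f q A hA fun i _ => i.2.le
    | succ l ih =>
      intro f B hB
      -- The letter b shifts the final states of the second factor and rotates those of the first,
      -- whence the inverse rotation of f; then e inserts the first final state from 0 ∈ A.
      have h5 : ∃ w, N.eval w = (some (.inr f), pairSet A (B \ {0})) := by
        refine cont [xb] (ih ((rotPerm j)⁻¹ f) {g | ∃ f ∈ B, shiftFin k g = some f} ?_) ?_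
        · rintro g ⟨f, hf, hg⟩
          have := hB f hf
          rw [shiftFin_eq_some] at hg
          omega
        · rw [DFA.evalFrom_singleton, hN]
          refine prodDFA_step_inr ?_ (fun i => ?_) fun f => ?_
          · rw [hb]
            exact congrArg (fun f => some (Sum.inr f)) ((rotPerm j).apply_symm_apply f)
          · rw [inl_mem_image_d₂ hb', inl_mem_pairSet]
            constructor
            · exact Or.inr
            · rintro (rfl | h)
              · exact hA
              · exact h
          · rw [inr_mem_image_d₂ hb']
            constructor
            · rintro ⟨hf, h0⟩
              have hf0 : f.val ≠ 0 := fun h => h0 (Fin.ext h)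
              have h : shiftFin k ⟨f - 1, by omega⟩ = some f := by
                rw [shiftFin_eq_some]
                change f.val - 1 + 1 = f
                omega
              exact ⟨_, ⟨f, hf, h⟩, h⟩
            · rintro ⟨g, ⟨f', hf', h⟩, h'⟩
              obtain rfl := Option.some.inj (h.symm.trans h')
              refine ⟨hf', ?_⟩
              rintro rfl
              rw [shiftFin_eq_some] at h
              simp at h
      by_cases hB0 : 0 ∈ B
      · refine cont [y] h5 ?_
        rw [DFA.evalFrom_singleton, hN]
        refine prodDFA_step_inr (by rw [hy]; rfl) (fun i => ?_) fun f => ?_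
        · rw [inl_mem_image_e hy', inl_mem_pairSet]
          by_cases hi : i = 0
          · simp [hi, hA]
          · simp [hi]
        · rw [inr_mem_image_e hy', inr_mem_pairSet, inl_mem_pairSet]
          by_cases hf : f = 0
          · simp [hf, hA, hB0]
          · simp [hf]
      · rwa [Set.sdiff_singleton_eq_self hB0] at h5
  obtain ⟨s, P⟩ := s
  obtain ⟨A, B, rfl⟩ := exists_eq_pairSet P
  rcases s with _ | i | f
  · obtain ⟨γ, l, hγ⟩ := exists_perm_shiftFin j
    have h4 : ∃ w, N.eval w = (none, pairSet Set.univ B) := by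
      -- Here d₂ takes the last final state l to the sink and acts as b on the second set, whose
      -- final part is therefore prepared as a preimage.
      refine cont [x₂] (h3 Set.univ trivial k l {g | gen k true g ∈ B} fun g _ => g.2) ?_
      rw [DFA.evalFrom_singleton, hN]
      have hstep : ((W p j).comap σ).step (some (.inr l)) x₂ = none := by
        rw [DFA.comap_step, hx₂]
        simp [W, stepW, hγ]
      refine Prod.ext hstep ?_
      have hacc : ((W p j).comap σ).step (some (.inr l)) x₂ ∉ ((W p j).comap σ).accept := by
        rw [hstep]
        rintro ⟨f, hf⟩
        cases hf
      refine eq_pairSet_iff.2 ⟨fun i => ?_, fun g => ?_⟩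
      · obtain ⟨i, rfl⟩ := (gen q false).surjective i
        rw [mem_prodDFA_step, or_iff_left fun h => hacc h.1, inl_mem_image_ab hx₂']
        simp
      · obtain ⟨g, rfl⟩ := (gen k true).surjective g
        rw [mem_prodDFA_step, or_iff_left fun h => hacc h.1]
        exact inr_mem_image_ab hx₂'
    obtain ⟨w, -, hw⟩ := (realizes_inl_filter (k := k) A).comap (ρ := prodLetter ∘ σ) (by
      rintro x hx
      obtain ⟨y, hy⟩ : ∃ y, σ y = prodLetter x :=
        hσ (by rcases hx with rfl | rfl | rfl <;> simp [prodLetter, sixLetters])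
      exact ⟨y, by rcases hx with rfl | rfl | rfl <;> simp [prodLetter, hy]⟩)
    refine cont w h4 ?_
    rw [hN, hM.prodDFA_evalFrom_none hM']
    refine Prod.ext rfl (eq_pairSet_iff.2 ⟨fun i => ?_, fun f => ?_⟩)
    · rw [mem_image_of_realizes hw]
      constructor
      · rintro ⟨i' | f', -, h⟩
        · by_cases hj : i' ∈ A <;> simp [hj] at h
          rwa [← h]
        · simp at h
      · intro hi
        exact ⟨.inl i, trivial, by simp [hi]⟩
    · rw [mem_image_of_realizes hw]
      constructor
      · rintro ⟨i' | f', hz, h⟩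
        · by_cases hj : i' ∈ A <;> simp [hj] at h
        · obtain rfl : f' = f := by simpa using h
          exact hz
      · intro hf
        exact ⟨.inr f, hf, rfl⟩
  · obtain ⟨w, hw⟩ := exists_evalFrom_inl (p := p) (k := j) (fourLetters_subset_six hσ) 0
      (some (.inl i))
    refine ⟨w, ?_⟩
    have h4 : (N.eval w).1 = some (.inl i) := by
      rw [hN]
      exact (prodDFA_evalFrom_fst _ w).trans hw
    have h5 := (hM.prodDFA_eval_mem (M' := (W q k).comap (prodLetter ∘ σ)) (i' := 0) rfl w).1 i
      (by rw [← hN]; exact h4)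
    exact Prod.ext h4 ((hN ▸ h5).trans (hs.1 i rfl).symm)
  · exact h3 A (hs.2 f rfl) k f B fun g _ => g.2

end witness

end PrefixConvex

namespace PrefixConvex

/-! ### Inequivalence of the states of the product automaton -/

section witness

variable {β : Type} {p j q k : ℕ} [NeZero p] [NeZero j] [NeZero q] [NeZero k] {σ : β → Letter}

/-- The automaton of the product of the witnesses. -/
abbrev witnessProd (p j q k : ℕ) [NeZero p] [NeZero j] [NeZero q] [NeZero k] (σ : β → Letter) :
    DFA β (St p j × Set (Fin q ⊕ Fin k)) :=
  prodDFA ((W p j).comap σ) ((W q k).comap (prodLetter ∘ σ))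

theorem acceptsFrom_evalFrom_eq {α : Type u} {τ : Type*} {N : DFA α τ} {s t : τ}
    (h : N.acceptsFrom s = N.acceptsFrom t) (w : List α) :
    N.acceptsFrom (N.evalFrom s w) = N.acceptsFrom (N.evalFrom t w) := by
  rw [← leftQuotient_acceptsFrom, ← leftQuotient_acceptsFrom, h]

/-- The letter e makes 0 final, whereas one step from the empty set can only produce the initial
state, which is not final. -/
theorem acceptsFrom_witnessProd_empty_ne (hσ : sixLetters ⊆ Set.range σ)
    {s s' : St p j} {P : Set (Fin q ⊕ Fin k)} (hP : .inl 0 ∈ P) :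
    (witnessProd p j q k σ).acceptsFrom (s, P) ≠ (witnessProd p j q k σ).acceptsFrom (s', ∅) := by
  obtain ⟨y, hy⟩ := hσ (show Letter.e ∈ sixLetters by simp [sixLetters])
  have hy' : (prodLetter ∘ σ) y = .e := by simp [hy, prodLetter]
  intro h
  have h1 : [y] ∈ (witnessProd p j q k σ).acceptsFrom (s, P) :=
    ⟨0, Or.inl ((inr_mem_image_e hy').2 (Or.inr ⟨hP, rfl⟩))⟩
  rw [h] at h1
  obtain ⟨f, hf⟩ := h1
  obtain ⟨z, hz, -⟩ | ⟨-, h2⟩ := mem_prodDFA_step.1 hf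
  · exact hz
  · have h2 : some (Sum.inr f) = some (Sum.inl (0 : Fin q)) := h2
    simp at h2

/-- A word over d₁ and b acts on the second set by d₁ and d₂ and empties it when the first component
is the sink. A final first component stays final without d₂, so the initial state is still present
there. -/
theorem acceptsFrom_witnessProd_inr_ne_none (hσ : sixLetters ⊆ Set.range σ) {f : Fin j}
    {P P' : Set (Fin q ⊕ Fin k)} (hP : .inl 0 ∈ P) :
    (witnessProd p j q k σ).acceptsFrom (some (.inr f), P) ≠
      (witnessProd p j q k σ).acceptsFrom (none, P') := by
  obtain ⟨xb, hb⟩ := hσ (show Letter.b ∈ sixLetters by simp [sixLetters])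
  obtain ⟨x₁, hx₁⟩ := hσ (show Letter.d₁ ∈ sixLetters by simp [sixLetters])
  have hM := (W_convex p j).comap σ
  have hM' := (W_convex q k).comap (prodLetter ∘ σ)
  intro h
  obtain ⟨w, hw⟩ : ∃ w, w = List.replicate q x₁ ++ List.replicate k xb := ⟨_, rfl⟩
  have h1 := acceptsFrom_evalFrom_eq h w
  have h2 : (witnessProd p j q k σ).evalFrom (none, P') w = (none, ∅) := by
    rw [hM.prodDFA_evalFrom_none hM', hw, image_replicate_d₁_d₂ (by simp [hx₁, prodLetter])
      (by simp [hb, prodLetter])]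
  obtain ⟨f', hf'⟩ := evalFrom_inr_of_ne_d₂ (p := p) (ρ := σ) (w := w) (by
    intro x hx
    rw [hw, List.mem_append, List.mem_replicate, List.mem_replicate] at hx
    rcases hx with ⟨-, rfl⟩ | ⟨-, rfl⟩
    · simp [hx₁]
    · simp [hb]) f
  have h3 := (hM.prodDFA_evalFrom_mem (M' := (W q k).comap (prodLetter ∘ σ)) (i' := 0) rfl
    (s := (some (.inr f), P)) ⟨by simp, fun _ _ => hP⟩ w).2 f'
    ((prodDFA_evalFrom_fst _ w).trans hf')
  rw [h2] at h1
  exact acceptsFrom_witnessProd_empty_ne hσ h3 h1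

/-- After `d₂`, all non-final states but `0` and `1` are unaffected by the first factor. -/
theorem prodDFA_replicate_d₂ {x : β} (hx : σ x = .d₂) (l : ℕ)
    (s : St p j × Set (Fin q ⊕ Fin k)) :
    (∀ i : Fin q, 2 ≤ i.val →
      (.inl i ∈ ((witnessProd p j q k σ).evalFrom s (List.replicate l x)).2 ↔ .inl i ∈ s.2)) ∧
    ∀ g, .inr ((gen k true ^ l) g) ∈
      ((witnessProd p j q k σ).evalFrom s (List.replicate l x)).2 ↔ .inr g ∈ s.2 := by
  have hx' : (prodLetter ∘ σ) x = ab false := by simp [hx, prodLetter, ab]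
  induction l with
  | zero => simp
  | succ l ih =>
    rw [List.replicate_succ', DFA.evalFrom_append_singleton]
    refine ⟨fun i hi => ?_, fun g => ?_⟩
    · have htw : gen q false i = i := by
        change tw q i = i
        apply Fin.ext
        simp only [tw, cyc]
        split_ifs <;> omega
      have h1 : .inl i ∈ image ((W q k).comap (prodLetter ∘ σ)) [x]
          ((witnessProd p j q k σ).evalFrom s (List.replicate l x)).2 ↔
          .inl i ∈ ((witnessProd p j q k σ).evalFrom s (List.replicate l x)).2 := by
        conv_lhs => rw [← htw]
        exact inl_mem_image_ab hx'
      rw [mem_prodDFA_step, h1, ih.1 i hi, or_iff_left]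
      rintro ⟨-, h⟩
      have h : some (Sum.inl i) = some (Sum.inl 0) := h
      obtain rfl : i = 0 := by simpa using h
      simp at hi
    · rw [mem_prodDFA_step, pow_succ', Equiv.Perm.mul_apply]
      have h1 := inr_mem_image_ab hx' (f := (gen k true ^ l) g)
        (P := ((witnessProd p j q k σ).evalFrom s (List.replicate l x)).2)
      rw [Bool.not_false] at h1
      rw [h1, ih.2 g, or_iff_left]
      rintro ⟨-, h⟩
      have h : some (Sum.inr _) = some (Sum.inl (0 : Fin q)) := h
      simp at h

/-- At the sink the second factor runs undisturbed, and a word accepted from exactly z tests for z.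
-/
theorem acceptsFrom_witnessProd_none_inj (hσ : sixLetters ⊆ Set.range σ)
    {P P' : Set (Fin q ⊕ Fin k)} (h : (witnessProd p j q k σ).acceptsFrom (none, P) =
      (witnessProd p j q k σ).acceptsFrom (none, P')) : P = P' := by
  have hM := (W_convex p j).comap σ
  have hM' := (W_convex q k).comap (prodLetter ∘ σ)
  ext z
  obtain ⟨w, hw⟩ := exists_word_final (p := q) (k := k) (fourLetters_subset_prod hσ) {z}
  have key : ∀ Q, w ∈ (witnessProd p j q k σ).acceptsFrom (none, Q) ↔ z ∈ Q := by
    intro Q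
    rw [DFA.mem_acceptsFrom, hM.prodDFA_evalFrom_none hM']
    constructor
    · rintro ⟨f, y, hy, h⟩
      have := (hw y).1 ⟨f, h⟩
      rw [Set.mem_singleton_iff] at this
      exact this ▸ hy
    · intro hz
      obtain ⟨f, hf⟩ := (hw z).2 rfl
      exact ⟨f, z, hz, hf⟩
  rw [← key P, h, key P']

/-- Powers of d₂ lead the first component to the sink. They permute the second set up to restarts at
0, which can obscure only 0 and 1. Both sets contain 0, so only 1 needs a separate argument. -/
theorem acceptsFrom_witnessProd_inr_inj (hσ : sixLetters ⊆ Set.range σ) {f : Fin j}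
    {P P' : Set (Fin q ⊕ Fin k)} (hP : .inl 0 ∈ P) (hP' : .inl 0 ∈ P')
    (h : (witnessProd p j q k σ).acceptsFrom (some (.inr f), P) =
      (witnessProd p j q k σ).acceptsFrom (some (.inr f), P')) : P = P' := by
  obtain ⟨xa, ha⟩ := hσ (show Letter.a ∈ sixLetters by simp [sixLetters])
  obtain ⟨xb, hb⟩ := hσ (show Letter.b ∈ sixLetters by simp [sixLetters])
  obtain ⟨x₁, hx₁⟩ := hσ (show Letter.d₁ ∈ sixLetters by simp [sixLetters])
  obtain ⟨x₂, hx₂⟩ := hσ (show Letter.d₂ ∈ sixLetters by simp [sixLetters])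
  have ha' : (prodLetter ∘ σ) xa = ab true := by simp [ha, prodLetter, ab]
  have hb' : (prodLetter ∘ σ) xb = .d₂ := by simp [hb, prodLetter]
  have hx₁' : (prodLetter ∘ σ) x₁ = .d₁ := by simp [hx₁, prodLetter]
  have hx₂' : (prodLetter ∘ σ) x₂ = ab false := by simp [hx₂, prodLetter, ab]
  have agree : ∀ {Q Q' : Set (Fin q ⊕ Fin k)},
      (witnessProd p j q k σ).acceptsFrom (some (.inr f), Q) =
        (witnessProd p j q k σ).acceptsFrom (some (.inr f), Q') →
      (∀ i : Fin q, 2 ≤ i.val → (.inl i ∈ Q ↔ .inl i ∈ Q')) ∧ ∀ g, .inr g ∈ Q ↔ .inr g ∈ Q' := by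
    intro Q Q' hQ
    have h1 := acceptsFrom_evalFrom_eq hQ (List.replicate j x₂)
    have hfst : ∀ R : Set (Fin q ⊕ Fin k),
        (witnessProd p j q k σ).evalFrom (some (.inr f), R) (List.replicate j x₂) =
        (none, ((witnessProd p j q k σ).evalFrom (some (.inr f), R) (List.replicate j x₂)).2) :=
      fun R => Prod.ext ((prodDFA_evalFrom_fst _ _).trans (evalFrom_inr_replicate_d₂ hx₂ f)) rfl
    rw [hfst Q, hfst Q'] at h1
    have h2 := acceptsFrom_witnessProd_none_inj hσ h1
    have a := prodDFA_replicate_d₂ hx₂ j (p := p) ((some (.inr f), Q) : St p j × Set (Fin q ⊕ Fin k))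
    have a' := prodDFA_replicate_d₂ hx₂ j (p := p)
      ((some (.inr f), Q') : St p j × Set (Fin q ⊕ Fin k))
    rw [← h2] at a'
    exact ⟨fun i hi => (a.1 i hi).symm.trans (a'.1 i hi),
      fun g => (a.2 g).symm.trans (a'.2 g)⟩
  have hone : ∀ i : Fin q, i.val = 1 → (.inl i ∈ P ↔ .inl i ∈ P') := by
    intro i hi
    -- If a state 2 exists, d₁ moves 1 to it and keeps the first component final, so the preceding
    -- test applies.
    by_cases hq : 3 ≤ q
    · have hstep : ∀ R : Set (Fin q ⊕ Fin k),
          (witnessProd p j q k σ).step (some (.inr f), R) x₁ =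
            (some (.inr f), ((witnessProd p j q k σ).step (some (.inr f), R) x₁).2) := by
        intro R
        refine Prod.ext ?_ rfl
        change ((W p j).comap σ).step _ _ = _
        rw [DFA.comap_step, hx₁]
        rfl
      have h1 := acceptsFrom_evalFrom_eq h [x₁]
      rw [DFA.evalFrom_singleton, DFA.evalFrom_singleton, hstep P, hstep P'] at h1
      have h2 := (agree h1).1 ⟨2, hq⟩ le_rfl
      have key : ∀ R : Set (Fin q ⊕ Fin k), .inl ⟨2, hq⟩ ∈
          ((witnessProd p j q k σ).step (some (.inr f), R) x₁).2 ↔ .inl i ∈ R := by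
        intro R
        rw [mem_prodDFA_step, or_iff_left, inl_mem_image_d₁ hx₁']
        · constructor
          · rintro ⟨i', hi', h⟩
            rw [shiftFin_eq_some] at h
            rwa [show i = i' from Fin.ext (by simp at h; omega)]
          · intro hi'
            exact ⟨i, hi', by rw [shiftFin_eq_some, hi]⟩
        · rintro ⟨-, h⟩
          have h : some (Sum.inl (⟨2, hq⟩ : Fin q)) = some (Sum.inl 0) := h
          have h := congrArg Fin.val (Sum.inl_injective (Option.some.inj h))
          simp at h
      rwa [key, key] at h2
    · obtain rfl : q = 2 := by
        have := i.2
        omega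
      have h0 : gen 2 false 0 = i := Fin.ext (by rw [hi]; rfl)
      -- For q = 2 the letters a and b fix the non-final states of the second factor. They bring f
      -- to the last final state; a single d₂ then reaches the sink without a restart and swaps 0
      -- and 1.
      have hrot : ∀ i, gen 2 true i = i := by
        intro i
        fin_cases i <;> rfl
      have hw : ∀ w : List Bool, ∀ f, ∃ v, ∀ R : Set (Fin 2 ⊕ Fin k), .inl 0 ∈ R →
          ((witnessProd p j 2 k σ).evalFrom (some (.inr f), R) v).1 =
            some (.inr (permOf j w f)) ∧
          ∀ i, .inl i ∈ ((witnessProd p j 2 k σ).evalFrom (some (.inr f), R) v).2 ↔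
            .inl i ∈ R := by
        intro w
        induction w with
        | nil => exact fun f => ⟨[], fun R _ => ⟨by simp [permOf], by simp⟩⟩
        | cons b w ih =>
          intro f
          obtain ⟨x, hx⟩ : ∃ x, ∀ R : Set (Fin 2 ⊕ Fin k), .inl 0 ∈ R →
              ((witnessProd p j 2 k σ).step (some (.inr f), R) x).1 =
                some (.inr (gen j b f)) ∧
              ∀ i, .inl i ∈ ((witnessProd p j 2 k σ).step (some (.inr f), R) x).2 ↔
                .inl i ∈ R := by
            have aux : ∀ x, (∀ (R : Set (Fin 2 ⊕ Fin k)) i,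
                .inl i ∈ image ((W 2 k).comap (prodLetter ∘ σ)) [x] R ↔ .inl i ∈ R) →
                ∀ R : Set (Fin 2 ⊕ Fin k), .inl 0 ∈ R → ∀ i,
                .inl i ∈ ((witnessProd p j 2 k σ).step (some (.inr f), R) x).2 ↔ .inl i ∈ R := by
              intro x hx R hR i
              rw [mem_prodDFA_step, hx, or_iff_left_iff_imp]
              rintro ⟨-, h⟩
              have h : some (Sum.inl i) = some (Sum.inl 0) := h
              obtain rfl : i = 0 := by simpa using h
              exact hR
            cases b
            · refine ⟨xa, fun R hR => ⟨?_, aux xa (fun R i => ?_) R hR⟩⟩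
              · change stepW p j _ (σ xa) = _
                rw [ha]
                rfl
              · have := inl_mem_image_ab ha' (P := R) (i := i)
                rwa [hrot] at this
            · refine ⟨xb, fun R hR => ⟨?_, aux xb (fun R i => inl_mem_image_d₂ hb') R hR⟩⟩
              change stepW p j _ (σ xb) = _
              rw [hb]
              rfl
          obtain ⟨v, hv⟩ := ih (gen j b f)
          refine ⟨x :: v, fun R hR => ?_⟩
          obtain ⟨h1, h2⟩ := hx R hR
          have h3 := hv ((witnessProd p j 2 k σ).step (some (.inr f), R) x).2 ((h2 0).2 hR)
          rw [DFA.evalFrom_cons, ← Prod.eta ((witnessProd p j 2 k σ).step (some (.inr f), R) x), h1,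
            permOf_cons]
          exact ⟨h3.1, fun i => (h3.2 i).trans (h2 i)⟩
      obtain ⟨γ, l, hγ⟩ := exists_perm_shiftFin j
      obtain ⟨w, hwl, -⟩ := exists_permOf j 1 (Equiv.swap f l) 1
      obtain ⟨v, hv⟩ := hw w f
      rw [hwl, Equiv.swap_apply_left] at hv
      have key : ∀ R : Set (Fin 2 ⊕ Fin k), .inl 0 ∈ R →
          ((witnessProd p j 2 k σ).evalFrom (some (.inr f), R) (v ++ [x₂])).1 = none ∧
          (.inl 0 ∈ ((witnessProd p j 2 k σ).evalFrom (some (.inr f), R) (v ++ [x₂])).2 ↔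
            .inl i ∈ R) := by
        intro R hR
        have hstep : ((W p j).comap σ).step (some (.inr l)) x₂ = none := by
          rw [DFA.comap_step, hx₂]
          simp [W, stepW, hγ]
        rw [DFA.evalFrom_append_singleton]
        refine ⟨?_, ?_⟩
        · change ((W p j).comap σ).step _ x₂ = none
          rw [(hv R hR).1, hstep]
        · rw [mem_prodDFA_step, (hv R hR).1, hstep, ← (hv R hR).2, or_iff_left]
          · have := inl_mem_image_ab hx₂' (i := i)
              (P := ((witnessProd p j 2 k σ).evalFrom (some (.inr f), R) v).2)
            rwa [← h0, show gen 2 false (gen 2 false 0) = 0 from rfl, h0] at this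
          · rintro ⟨⟨f, hf⟩, -⟩
            cases hf
      have h1 := acceptsFrom_evalFrom_eq h (v ++ [x₂])
      rw [← Prod.eta ((witnessProd p j 2 k σ).evalFrom (some (.inr f), P) (v ++ [x₂])),
        ← Prod.eta ((witnessProd p j 2 k σ).evalFrom (some (.inr f), P') (v ++ [x₂])),
        (key P hP).1, (key P' hP').1] at h1
      rw [← (key P hP).2, acceptsFrom_witnessProd_none_inj hσ h1, (key P' hP').2]
  ext z
  rcases z with i | g
  · by_cases hi0 : i.val = 0
    · rw [show i = 0 from Fin.ext hi0]
      simp [hP, hP']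
    · by_cases hi1 : i.val = 1
      · exact hone i hi1
      · exact (agree h).1 i (by omega)
  · exact (agree h).2 g

/-- Different first components are first brought to a situation in which one second set contains 0
and the other is empty, or in which one first component is final and the other the sink. Equal ones
are covered by the two injectivity lemmas. -/
theorem acceptsFrom_witnessProd_inj (hσ : sixLetters ⊆ Set.range σ)
    {s t : St p j × Set (Fin q ⊕ Fin k)} (hs : s ∈ prodStates p j k (0 : Fin q))
    (ht : t ∈ prodStates p j k (0 : Fin q))
    (h : (witnessProd p j q k σ).acceptsFrom s = (witnessProd p j q k σ).acceptsFrom t) :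
    s = t := by
  have hM := (W_convex p j).comap σ
  have hM' := (W_convex q k).comap (prodLetter ∘ σ)
  have hfour := fourLetters_subset_six hσ
  have hinl : ∀ i : Fin p, ∃ w, ((W p j).comap σ).evalFrom (some (.inl i)) w = some (.inr 0) ∧
      ∀ s, s ≠ some (.inl i) → ((W p j).comap σ).evalFrom s w = s := by
    intro i
    obtain ⟨w, -, hw⟩ := (realizes_inl_inr (p := p) (k := j) (A := fourLetters)
      (by simp [fourLetters]) (by simp [fourLetters]) (by simp [fourLetters]) i 0).comap hfour
    exact ⟨w, by rw [hw, Function.update_self], fun s hs => by rw [hw, Function.update_of_ne hs]; rfl⟩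
  have mem : ∀ {s : St p j × Set (Fin q ⊕ Fin k)}, s ∈ prodStates p j k (0 : Fin q) → ∀ w,
      (witnessProd p j q k σ).evalFrom s w ∈ prodStates p j k (0 : Fin q) :=
    fun hs w => hM.prodDFA_evalFrom_mem rfl hs w
  have case1 : ∀ {i : Fin p} {s' : St p j}, s' ≠ some (.inl i) →
      (witnessProd p j q k σ).acceptsFrom (some (.inl i), ∅) =
        (witnessProd p j q k σ).acceptsFrom (s', ∅) →
      (s', ∅) ∈ prodStates p j k (0 : Fin q) → s' = none ∨ (∃ i', s' = some (.inl i')) → False := by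
    intro i s' hne h hs' hcase
    obtain ⟨w, hw, hw'⟩ := hinl i
    have h1 := acceptsFrom_evalFrom_eq h w
    have h2 : (witnessProd p j q k σ).evalFrom (s', ∅) w = (s', ∅) := by
      refine Prod.ext ((prodDFA_evalFrom_fst _ w).trans (hw' s' hne)) ?_
      rcases hcase with rfl | ⟨i', rfl⟩
      · rw [hM.prodDFA_evalFrom_none hM']
        exact Set.eq_empty_of_forall_notMem fun z ⟨y, hy, _⟩ => hy
      · exact (mem hs' w).1 i' ((prodDFA_evalFrom_fst _ w).trans (hw' _ hne))
    rw [h2] at h1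
    exact acceptsFrom_witnessProd_empty_ne hσ
      ((mem (s := (some (.inl i), ∅)) ⟨fun _ _ => rfl, by simp⟩ w).2 0
        ((prodDFA_evalFrom_fst _ w).trans hw)) h1
  -- A non-final element of P is moved to 0 by letters that are a, b in the second factor; they are
  -- a, d₂ in the first, where they keep the state non-final and the set empty. A final element of P
  -- is detected by the empty word.
  have case2 : ∀ {i : Fin p} {P : Set (Fin q ⊕ Fin k)},
      (witnessProd p j q k σ).acceptsFrom (some (.inl i), ∅) ≠
        (witnessProd p j q k σ).acceptsFrom (none, P) := by
    intro i P h
    rcases P.eq_empty_or_nonempty with rfl | ⟨z, hz⟩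
    · exact case1 (by simp) h ⟨by simp, by simp⟩ (Or.inl rfl)
    · rcases z with r | g
      · obtain ⟨w, hwA, hw⟩ := (realizes_blockPerm (p := q) (k := k) (A := {.a, .b}) (by simp)
          (by simp) (Equiv.swap r 0) 1).comap (ρ := prodLetter ∘ σ) (by
            refine Set.Subset.trans ?_ (fourLetters_subset_prod hσ)
            rintro x (rfl | rfl) <;> simp [fourLetters])
        have h1 := acceptsFrom_evalFrom_eq h w
        obtain ⟨i', hi'⟩ := evalFrom_inl_of_mem (p := p) (k := j) (ρ := σ) (w := w) (by
          intro x hx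
          have hx := hwA x hx
          simp only [Set.mem_preimage, Function.comp_apply] at hx
          cases h : σ x <;> rw [h] at hx <;> simp_all [prodLetter]) i
        have h2 : (witnessProd p j q k σ).evalFrom (some (.inl i), ∅) w = (some (.inl i'), ∅) := by
          have h3 : ((witnessProd p j q k σ).evalFrom (some (.inl i), ∅) w).1 = some (.inl i') :=
            (prodDFA_evalFrom_fst _ w).trans hi'
          exact Prod.ext h3 ((mem (s := (some (.inl i), ∅)) ⟨fun _ _ => rfl, by simp⟩ w).1 i' h3)
        rw [h2, hM.prodDFA_evalFrom_none hM'] at h1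
        refine acceptsFrom_witnessProd_empty_ne hσ ?_ h1.symm
        exact ⟨_, hz, by simp [hw]⟩
      · have h1 : [] ∈ (witnessProd p j q k σ).acceptsFrom (none, P) := ⟨g, hz⟩
        rw [← h] at h1
        obtain ⟨f, hf⟩ := h1
        exact hf
  -- Some word sends f' to the sink and fixes f.
  have case3 : ∀ {f f' : Fin j} {P P' : Set (Fin q ⊕ Fin k)}, .inl 0 ∈ P → f ≠ f' →
      (witnessProd p j q k σ).acceptsFrom (some (.inr f), P) ≠
        (witnessProd p j q k σ).acceptsFrom (some (.inr f'), P') := by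
    intro f f' P P' hP hne h
    obtain ⟨w, -, hw⟩ := (realizes_inr_none (p := p) (k := j) (A := fourLetters)
      (by simp [fourLetters]) (by simp [fourLetters]) (by simp [fourLetters]) f').comap hfour
    have h1 := acceptsFrom_evalFrom_eq h w
    have h2 : ((witnessProd p j q k σ).evalFrom (some (.inr f), P) w).1 = some (.inr f) := by
      rw [prodDFA_evalFrom_fst, hw, Function.update_of_ne (by simpa using hne)]
      rfl
    have h3 : ((witnessProd p j q k σ).evalFrom (some (.inr f'), P') w).1 = none := by
      rw [prodDFA_evalFrom_fst, hw, Function.update_self]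
    rw [← Prod.eta ((witnessProd p j q k σ).evalFrom (some (.inr f), P) w),
      ← Prod.eta ((witnessProd p j q k σ).evalFrom (some (.inr f'), P') w), h2, h3] at h1
    exact acceptsFrom_witnessProd_inr_ne_none hσ
      ((mem (s := (some (.inr f), P)) ⟨by simp, fun _ _ => hP⟩ w).2 f h2) h1
  obtain ⟨s, P⟩ := s
  obtain ⟨t, P'⟩ := t
  rcases s with _ | i | f
  · rcases t with _ | i' | f'
    · rw [acceptsFrom_witnessProd_none_inj hσ h]
    · obtain rfl : P' = ∅ := ht.1 i' rfl
      exact absurd h.symm case2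
    · exact absurd h.symm (acceptsFrom_witnessProd_inr_ne_none hσ (ht.2 f' rfl))
  · obtain rfl : P = ∅ := hs.1 i rfl
    rcases t with _ | i' | f'
    · exact absurd h case2
    · obtain rfl : P' = ∅ := ht.1 i' rfl
      by_contra hne
      exact case1 (fun h' => hne (by rw [h'])) h ht (Or.inr ⟨i', rfl⟩)
    · exact absurd h.symm (acceptsFrom_witnessProd_empty_ne hσ (ht.2 f' rfl))
  · rcases t with _ | i' | f'
    · exact absurd h (acceptsFrom_witnessProd_inr_ne_none hσ (hs.2 f rfl))
    · obtain rfl : P' = ∅ := ht.1 i' rfl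
      exact absurd h (acceptsFrom_witnessProd_empty_ne hσ (hs.2 f rfl))
    · obtain rfl : f = f' := by
        by_contra hne
        exact case3 (hs.2 f rfl) hne h
      exact Prod.ext rfl (acceptsFrom_witnessProd_inr_inj hσ (hs.2 f rfl) (ht.2 f rfl) h)

theorem complexity_mul_comap (hσ : sixLetters ⊆ Set.range σ) :
    complexity (((W p j).comap σ).accepts * ((W q k).comap (prodLetter ∘ σ)).accepts) =
      (productBound (p + j + 1) j (q + k + 1) : ℕ∞) := by
  have hM := (W_convex p j).comap σ
  have hM' := (W_convex q k).comap (prodLetter ∘ σ)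
  have hmem : ∀ w, (witnessProd p j q k σ).eval w ∈ prodStates p j k (0 : Fin q) :=
    hM.prodDFA_eval_mem rfl
  rw [← hM.accepts_prodDFA hM', complexity_eq_of_ker (witnessProd p j q k σ).eval,
    ← encard_prodStates (0 : Fin q)]
  · congr 1
    exact Set.Subset.antisymm (Set.range_subset_iff.2 hmem) fun s hs => prodDFA_reach hσ hs
  · intro w w'
    rw [Language.leftQuotient_accepts, Function.comp_apply, Function.comp_apply]
    exact ⟨acceptsFrom_witnessProd_inj hσ (hmem w) (hmem w'), fun h => by rw [h]⟩

end witness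

end PrefixConvex

namespace PrefixConvex

/-! ### Boolean operations -/

section boolean

variable {α : Type u} {p j q k : ℕ} {M : DFA α (St p j)} {M' : DFA α (St q k)}

open Classical in
theorem mem_boolOp {f : Bool → Bool → Bool} {K L : Language α} {w : List α} :
    w ∈ boolOp f K L ↔ f (decide (w ∈ K)) (decide (w ∈ L)) = true := Iff.rfl

theorem leftQuotient_boolOp (f : Bool → Bool → Bool) (K L : Language α) (w : List α) :
    (boolOp f K L).leftQuotient w = boolOp f (K.leftQuotient w) (L.leftQuotient w) := rfl

open Classical in
theorem apply_eq_of_boolOp_eq {f : Bool → Bool → Bool} {K L K' L' : Language α}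
    (h : boolOp f K L = boolOp f K' L') (w : List α) :
    f (decide (w ∈ K)) (decide (w ∈ L)) = f (decide (w ∈ K')) (decide (w ∈ L')) :=
  Bool.eq_iff_iff.2 (Set.ext_iff.1 h w)

/-- The pairs of states in which the value of the boolean function is constant are identified. -/
def collapse (f : Bool → Bool → Bool) (s : St p j × St q k) : St p j × St q k :=
  if (s.1 = none ∧ f false true = f false false) ∨ (s.2 = none ∧ f true false = f false false) then
    (none, none)
  else s

/-- The language accepted from a pair of states. -/
noncomputable def boolOpFrom (f : Bool → Bool → Bool) (M : DFA α (St p j)) (M' : DFA α (St q k))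
    (s : St p j × St q k) : Language α :=
  boolOp f (M.acceptsFrom s.1) (M'.acceptsFrom s.2)

theorem leftQuotient_boolOp_accepts (f : Bool → Bool → Bool) (w : List α) :
    (boolOp f M.accepts M'.accepts).leftQuotient w = boolOpFrom f M M' (M.eval w, M'.eval w) := by
  rw [leftQuotient_boolOp, Language.leftQuotient_accepts, Language.leftQuotient_accepts]
  rfl

/-- From a sink nothing is accepted; if the other argument then has no influence on f, the language
is the same as from the pair of sinks. -/
theorem ConvexDFA.boolOpFrom_collapse (hM : ConvexDFA M) (hM' : ConvexDFA M')
    (f : Bool → Bool → Bool) (s : St p j × St q k) :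
    boolOpFrom f M M' (collapse f s) = boolOpFrom f M M' s := by
  classical
  unfold collapse
  split_ifs with h
  · obtain ⟨s, t⟩ := s
    ext w
    have hbot : w ∉ (⊥ : Language α) := id
    simp only [boolOpFrom, mem_boolOp, hM.acceptsFrom_none, hM'.acceptsFrom_none, hbot,
      decide_false]
    rcases h with ⟨rfl, h⟩ | ⟨rfl, h⟩
    · rw [hM.acceptsFrom_none]
      by_cases hw : w ∈ M'.acceptsFrom t <;> simp [hbot, hw, h]
    · rw [hM'.acceptsFrom_none]
      by_cases hw : w ∈ M.acceptsFrom s <;> simp [hbot, hw, h]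
  · rfl

theorem ConvexDFA.complexity_boolOp_le (hM : ConvexDFA M) (hM' : ConvexDFA M')
    (f : Bool → Bool → Bool) : complexity (boolOp f M.accepts M'.accepts) ≤
      (Set.range (collapse f : St p j × St q k → _)).encard := by
  refine complexity_le_of_ker (fun w => collapse f (M.eval w, M'.eval w)) _
    (fun w => ⟨_, rfl⟩) fun w w' h => ?_
  rw [leftQuotient_boolOp_accepts, leftQuotient_boolOp_accepts, ← hM.boolOpFrom_collapse hM', h,
    hM.boolOpFrom_collapse hM']

end boolean

/-! ### Words with a prescribed effect in one automaton -/

section generic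

variable {β : Type} {p k : ℕ} [NeZero p] [NeZero k] {ρ : β → Letter}

theorem evalFrom_replicate_eq_self {α τ : Type*} {N : DFA α τ} {s : τ} {x : α}
    (h : N.step s x = s) (l : ℕ) : N.evalFrom s (List.replicate l x) = s := by
  induction l with
  | zero => rfl
  | succ l ih => rw [List.replicate_succ, DFA.evalFrom_cons, h, ih]

theorem evalFrom_replicate_d₁ {x : β} (hx : ρ x = .d₁) (i : Fin p) :
    ((W p k).comap ρ).evalFrom (some (.inl 0)) (List.replicate i x) = some (.inl i) := by
  obtain ⟨i, hi⟩ := i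
  induction i with
  | zero => rfl
  | succ i ih =>
    change ((W p k).comap ρ).evalFrom _ (List.replicate (i + 1) x) = _
    rw [List.replicate_succ', DFA.evalFrom_append_singleton]
    erw [ih (by omega)]
    rw [DFA.comap_step, hx]
    simp [W, stepW, shiftFin, hi]

theorem evalFrom_replicate_d₂ {x : β} (hx : ρ x = .d₂) (i : Fin k) :
    ((W p k).comap ρ).evalFrom (some (.inr 0)) (List.replicate i x) = some (.inr i) := by
  obtain ⟨i, hi⟩ := i
  induction i with
  | zero => rfl
  | succ i ih =>
    change ((W p k).comap ρ).evalFrom _ (List.replicate (i + 1) x) = _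
    rw [List.replicate_succ', DFA.evalFrom_append_singleton]
    erw [ih (by omega)]
    rw [DFA.comap_step, hx]
    simp [W, stepW, shiftFin, hi]

theorem exists_evalFrom_replicate_d₁ {x : β} (hx : ρ x = .d₁) {s : St p k}
    (hs : ∀ f, s ≠ some (.inr f)) :
    ∃ l, ((W p k).comap ρ).evalFrom (some (.inl 0)) (List.replicate l x) = s := by
  rcases s with _ | i | f
  · obtain ⟨γ, l, hγ⟩ := exists_perm_shiftFin p
    refine ⟨l + 1, ?_⟩
    rw [List.replicate_succ', DFA.evalFrom_append_singleton, evalFrom_replicate_d₁ hx,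
      DFA.comap_step, hx]
    simp [W, stepW, hγ]
  · exact ⟨i, evalFrom_replicate_d₁ hx i⟩
  · exact absurd rfl (hs f)

theorem evalFrom_ab {g : Bool → β} (hg : ∀ b, ρ (g b) = ab b) (w : List Bool) (s : St p k) :
    ((W p k).comap ρ).evalFrom s (w.map g) =
      blockPerm (permOf p w) (permOf k (w.map not)) s :=
  evalFrom_blockPerm (fun b q => by rw [DFA.comap_step, hg, W_step_ab]) w s

/-- Some word over `a, b, d₂, e` leads to the sink from all states. -/
theorem exists_word_none (hρ : fourLetters ⊆ Set.range ρ) :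
    ∃ w, (∀ x ∈ w, ρ x ∈ fourLetters) ∧ ∀ s, ((W p k).comap ρ).evalFrom s w = none := by
  have ha : Letter.a ∈ fourLetters := by simp [fourLetters]
  have hb : Letter.b ∈ fourLetters := by simp [fourLetters]
  have hd : Letter.d₂ ∈ fourLetters := by simp [fourLetters]
  have he : Letter.e ∈ fourLetters := by simp [fourLetters]
  have h1 : Realizes (W p k) fourLetters fun q => match q with
      | some (.inl _) => some (.inr 0)
      | q => q := by
    refine Realizes.of_sends (Finset.univ.image fun f : Fin p => some (Sum.inl f)) ?_ ?_
    · intro x hx hxt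
      obtain ⟨f, -, rfl⟩ := Finset.mem_image.1 hx
      exact ⟨by simp, realizes_inl_inr ha hb he f 0⟩
    · rintro (_ | i | f) hx
      · rfl
      · simp at hx
      · rfl
  have h2 : Realizes (W p k) fourLetters fun q => match q with
      | some (.inr _) => none
      | q => q := by
    refine Realizes.of_sends (Finset.univ.image fun f : Fin k => some (Sum.inr f)) ?_ ?_
    · intro x hx hxt
      obtain ⟨f, -, rfl⟩ := Finset.mem_image.1 hx
      exact ⟨by simp, realizes_inr_none ha hb hd f⟩
    · rintro (_ | i | f) hx
      · rfl
      · rfl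
      · simp at hx
  obtain ⟨w, hwA, hw⟩ := (h2.comp h1).comap hρ
  refine ⟨w, hwA, fun s => ?_⟩
  rw [hw]
  rcases s with _ | i | f <;> rfl

end generic

/-! ### Reachability and inequivalence of pairs of states -/

section witness

variable {β : Type} {p j q k : ℕ} [NeZero p] [NeZero j] [NeZero q] [NeZero k] {σ : β → Letter}

theorem boolLetter_boolLetter : boolLetter ∘ (boolLetter ∘ σ) = σ := by
  funext x
  simp only [Function.comp_apply]
  cases σ x <;> rfl

theorem sixLetters_subset_bool (hσ : sixLetters ⊆ Set.range σ) :
    sixLetters ⊆ Set.range (boolLetter ∘ σ) := by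
  rintro x hx
  obtain ⟨y, hy⟩ : ∃ y, σ y = boolLetter x :=
    hσ (by rcases hx with rfl | rfl | rfl | rfl | rfl | rfl <;> simp [boolLetter, sixLetters])
  exact ⟨y, by
    rcases hx with rfl | rfl | rfl | rfl | rfl | rfl <;> simp [boolLetter, hy]⟩

theorem exists_ab_letters (hσ : sixLetters ⊆ Set.range σ) :
    ∃ g : Bool → β, (∀ b, σ (g b) = ab b) ∧ ∀ b, (boolLetter ∘ σ) (g b) = ab b := by
  have h : ∀ b, ∃ x, σ x = ab b := fun b => hσ (by cases b <;> simp [ab, sixLetters])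
  choose g hg using h
  exact ⟨g, hg, fun b => by rw [Function.comp_apply, hg]; cases b <;> rfl⟩

/-- The second component is moved by d₂, its d₁, while the first waits at 0. Then e makes the first
final and acts as c₁ on the second, which must be at 0 or the sink to be left alone; a word over a
and b finally places both independently. -/
theorem exists_eval_inr_pair (hσ : sixLetters ⊆ Set.range σ) (f : Fin j) {s' : St q k}
    (hs' : ∀ g, s' ≠ some (.inr g)) : ∃ w, ((W p j).comap σ).eval w = some (.inr f) ∧
      ((W q k).comap (boolLetter ∘ σ)).eval w = s' := by
  obtain ⟨x₂, hx₂⟩ := hσ (show Letter.d₂ ∈ sixLetters by simp [sixLetters])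
  obtain ⟨y, hy⟩ := hσ (show Letter.e ∈ sixLetters by simp [sixLetters])
  obtain ⟨g, hg, hg'⟩ := exists_ab_letters hσ
  obtain ⟨t', ht', i', hi'⟩ : ∃ t' : St q k, (∀ g, t' ≠ some (.inr g)) ∧ ∃ i' : Fin q,
      (∀ ρ, blockPerm (Equiv.swap 0 i') ρ t' = s') ∧ stepW q k t' .c₁ = t' := by
    rcases s' with _ | i' | g
    · exact ⟨none, by simp, 0, by simp, rfl⟩
    · refine ⟨some (.inl 0), by simp, i', by simp, ?_⟩
      rw [stepW, mergeFin_eq_self_of_ne (by simp)]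
    · exact absurd rfl (hs' g)
  obtain ⟨l, hl⟩ := exists_evalFrom_replicate_d₁ (ρ := boolLetter ∘ σ) (k := k) (x := x₂)
    (by simp [hx₂, boolLetter]) ht'
  obtain ⟨w, hw, hw'⟩ := exists_permOf q j (Equiv.swap 0 i') (Equiv.swap 0 f)
  refine ⟨List.replicate l x₂ ++ [y] ++ w.map g, ?_, ?_⟩
  · rw [DFA.eval, DFA.evalFrom_of_append, DFA.evalFrom_append_singleton, evalFrom_ab hg, hw']
    change blockPerm _ _ (DFA.step _ (DFA.evalFrom _ (some (.inl 0)) _) y) = _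
    rw [evalFrom_replicate_eq_self, DFA.comap_step, hy]
    · simp [W, stepW]
    · rw [DFA.comap_step, hx₂]
      rfl
  · rw [DFA.eval, DFA.evalFrom_of_append, DFA.evalFrom_append_singleton, evalFrom_ab hg', hw]
    erw [hl]
    rw [DFA.comap_step, Function.comp_apply, hy]
    change blockPerm _ _ (stepW q k t' .c₁) = _
    rw [hi'.2, hi'.1]

/-- All pairs of states are reachable. -/
theorem exists_eval_pair (hσ : sixLetters ⊆ Set.range σ) (s : St p j) (s' : St q k) :
    ∃ w, ((W p j).comap σ).eval w = s ∧ ((W q k).comap (boolLetter ∘ σ)).eval w = s' := by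
  obtain ⟨xc, hc⟩ := hσ (show Letter.c₁ ∈ sixLetters by simp [sixLetters])
  obtain ⟨x₁, hx₁⟩ := hσ (show Letter.d₁ ∈ sixLetters by simp [sixLetters])
  obtain ⟨x₂, hx₂⟩ := hσ (show Letter.d₂ ∈ sixLetters by simp [sixLetters])
  obtain ⟨y, hy⟩ := hσ (show Letter.e ∈ sixLetters by simp [sixLetters])
  have hx₁' : (boolLetter ∘ σ) x₁ = .d₂ := by simp [hx₁, boolLetter]
  have hx₂' : (boolLetter ∘ σ) x₂ = .d₁ := by simp [hx₂, boolLetter]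
  by_cases hs : ∀ f, s ≠ some (.inr f) <;> by_cases hs' : ∀ f, s' ≠ some (.inr f)
  -- Outside the final states d₁ moves only the first component and d₂ only the second.
  · obtain ⟨l, hl⟩ := exists_evalFrom_replicate_d₁ (ρ := σ) hx₁ hs
    obtain ⟨l', hl'⟩ := exists_evalFrom_replicate_d₁ (ρ := boolLetter ∘ σ) hx₂' hs'
    refine ⟨List.replicate l x₁ ++ List.replicate l' x₂, ?_, ?_⟩
    · rw [DFA.eval, DFA.evalFrom_of_append]
      erw [hl]
      refine evalFrom_replicate_eq_self ?_ _
      rw [DFA.comap_step, hx₂]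
      rcases s with _ | i | f
      · rfl
      · rfl
      · exact absurd rfl (hs f)
    · rw [DFA.eval, DFA.evalFrom_of_append, evalFrom_replicate_eq_self (x := x₁)]
      · exact hl'
      · rw [DFA.comap_step, hx₁']
        rfl
  · push Not at hs'
    obtain ⟨f, rfl⟩ := hs'
    -- The renaming is an involution, so the two automata may exchange roles.
    obtain ⟨w, hw, hw'⟩ := exists_eval_inr_pair (p := q) (j := k) (q := p) (k := j)
      (sixLetters_subset_bool hσ) f hs
    rw [boolLetter_boolLetter] at hw'
    exact ⟨w, hw', hw⟩
  · push Not at hs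
    obtain ⟨f, rfl⟩ := hs
    exact exists_eval_inr_pair hσ f hs'
  · push Not at hs hs'
    obtain ⟨f, rfl⟩ := hs
    obtain ⟨f', rfl⟩ := hs'
    -- From the first final state and the state 0, the letter c₁, acting as e on the second
    -- component, makes both final; then d₂ advances only the first and d₁ only the second.
    obtain ⟨w, hw, hw'⟩ := exists_eval_inr_pair (p := p) (j := j) (q := q) (k := k) hσ 0
      (s' := some (.inl 0)) (by simp)
    refine ⟨w ++ [xc] ++ List.replicate f x₂ ++ List.replicate f' x₁, ?_, ?_⟩
    · rw [DFA.eval, DFA.evalFrom_of_append, DFA.evalFrom_of_append, DFA.evalFrom_append_singleton,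
        ← DFA.eval, hw, DFA.comap_step, hc]
      erw [evalFrom_replicate_d₂ hx₂]
      refine evalFrom_replicate_eq_self ?_ _
      rw [DFA.comap_step, hx₁]
      rfl
    · rw [DFA.eval, DFA.evalFrom_of_append, DFA.evalFrom_of_append, DFA.evalFrom_append_singleton,
        ← DFA.eval, hw', DFA.comap_step, Function.comp_apply, hc]
      have : (W q k).step (some (.inl 0)) (boolLetter .c₁) = some (.inr 0) := by
        simp [W, boolLetter, stepW]
      rw [this, evalFrom_replicate_eq_self (x := x₂), evalFrom_replicate_d₂ hx₁']
      rw [DFA.comap_step, hx₂']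
      rfl

/-- Some word leads to the sink from all states of the second automaton, and to different states
from two different states of the first one. -/
theorem exists_evalFrom_ne (hσ : sixLetters ⊆ Set.range σ) {s t : St p j} (hst : s ≠ t) :
    ∃ w, ((W p j).comap σ).evalFrom s w ≠ ((W p j).comap σ).evalFrom t w ∧
      ∀ s', ((W q k).comap (boolLetter ∘ σ)).evalFrom s' w = none := by
  wlog hs : s ≠ none generalizing s t
  · obtain ⟨w, hw, hw'⟩ := this hst.symm (by
      rintro rfl
      exact hst (by simpa using hs))
    exact ⟨w, hw.symm, hw'⟩
  have hM := (W_convex p j).comap σ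
  have hM' := (W_convex q k).comap (boolLetter ∘ σ)
  obtain ⟨z, rfl⟩ := Option.ne_none_iff_exists'.1 hs
  obtain ⟨u, hu⟩ := exists_word_final (p := p) (k := j) (fourLetters_subset_six hσ) {z}
  obtain ⟨v, hvA, hv⟩ := exists_word_none (p := q) (k := k)
    (fourLetters_subset_six (sixLetters_subset_bool hσ))
  refine ⟨u ++ v, ?_, fun s' => by rw [DFA.evalFrom_of_append, hv]⟩
  rw [DFA.evalFrom_of_append, DFA.evalFrom_of_append]
  obtain ⟨f, hf⟩ := (hu z).2 rfl
  have ht : ((W p j).comap σ).evalFrom t u ≠ some (.inr f) := by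
    intro h
    rcases t with _ | z'
    · rw [hM.evalFrom_none] at h
      cases h
    · exact hst (by rw [(hu z').1 ⟨f, h⟩])
  rw [hf]
  -- The letters of v are a, b, c₁, d₁ in the first automaton. They permute its final states and
  -- bring no other state among them, so a final state stays different from t'.
  generalize ((W p j).comap σ).evalFrom t u = t' at ht
  clear hf hv
  induction v generalizing f t' with
  | nil => exact ht.symm
  | cons x v ih =>
    obtain ⟨f', hf', hne⟩ : ∃ f', ((W p j).comap σ).step (some (.inr f)) x = some (.inr f') ∧
        ((W p j).comap σ).step t' x ≠ some (.inr f') := by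
      have hx := hvA x (by simp)
      rw [DFA.comap_step, DFA.comap_step]
      rw [Function.comp_apply] at hx
      have hab : ∀ b, ∃ f', (W p j).step (some (.inr f)) (ab b) = some (.inr f') ∧
          (W p j).step t' (ab b) ≠ some (.inr f') := by
        intro b
        refine ⟨gen j (!b) f, by rw [W_step_ab]; rfl, fun h => ht ?_⟩
        rw [W_step_ab, ← blockPerm_inr (gen p b)] at h
        exact (blockPerm _ _).injective h
      cases h : σ x
      · exact hab true
      · exact hab false
      · refine ⟨f, rfl, ?_⟩
        rcases t' with _ | i | g <;> simp_all [W, stepW]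
      · rw [h] at hx
        simp [boolLetter, fourLetters] at hx
      · refine ⟨f, rfl, ?_⟩
        rcases t' with _ | i | g <;> simp_all [W, stepW]
      · rw [h] at hx
        simp [boolLetter, fourLetters] at hx
      · rw [h] at hx
        simp [boolLetter, fourLetters] at hx
    rw [DFA.evalFrom_cons, DFA.evalFrom_cons, hf']
    exact ih (fun y hy => hvA y (by simp [hy])) f' _ hne

/-- Some word makes both automata accept from the given states, but not from another one. -/
theorem exists_evalFrom_final (hσ : sixLetters ⊆ Set.range σ) {s t : St p j} {s' : St q k}
    (hst : s ≠ t) (hs : s ≠ none) (hs' : s' ≠ none) :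
    ∃ w, w ∈ ((W p j).comap σ).acceptsFrom s ∧ w ∉ ((W p j).comap σ).acceptsFrom t ∧
      w ∈ ((W q k).comap (boolLetter ∘ σ)).acceptsFrom s' := by
  have hM := (W_convex p j).comap σ
  have hM' := (W_convex q k).comap (boolLetter ∘ σ)
  obtain ⟨xc, hc⟩ := hσ (show Letter.c₁ ∈ sixLetters by simp [sixLetters])
  obtain ⟨y, hy⟩ := hσ (show Letter.e ∈ sixLetters by simp [sixLetters])
  obtain ⟨g, hg, hg'⟩ := exists_ab_letters hσ
  -- A separating word over a, b, d₂, e reads as a, b, d₁, c₁ in the second automaton, where it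
  -- cannot leave the final states.
  have hfinal : ∀ (s t : St p j) (f' : Fin k), s ≠ t → s ≠ none →
      ∃ w, w ∈ ((W p j).comap σ).acceptsFrom s ∧ w ∉ ((W p j).comap σ).acceptsFrom t ∧
        w ∈ ((W q k).comap (boolLetter ∘ σ)).acceptsFrom (some (.inr f')) := by
    intro s t f' hst hs
    obtain ⟨z, rfl⟩ := Option.ne_none_iff_exists'.1 hs
    obtain ⟨w, hwA, hw⟩ :=
      exists_fourLetters_word_final (p := p) (k := j) (fourLetters_subset_six hσ) {z}
    simp only [DFA.mem_acceptsFrom, hM.accept, hM'.accept]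
    refine ⟨w, (hw z).2 rfl, ?_, ?_⟩
    · rcases t with _ | z'
      · rw [hM.evalFrom_none]
        simp
      · exact fun h => hst (by rw [(hw z').1 h])
    · refine evalFrom_inr_of_ne_d₂ (fun x hx => ?_) f'
      have := hwA x hx
      rw [Function.comp_apply]
      cases h : σ x <;> rw [h] at this <;> simp_all [fourLetters, boolLetter]
  have hcons : ∀ (s t : St p j) (s' : St q k) (u : List β),
      (∃ w, w ∈ ((W p j).comap σ).acceptsFrom (((W p j).comap σ).evalFrom s u) ∧
        w ∉ ((W p j).comap σ).acceptsFrom (((W p j).comap σ).evalFrom t u) ∧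
        w ∈ ((W q k).comap (boolLetter ∘ σ)).acceptsFrom
          (((W q k).comap (boolLetter ∘ σ)).evalFrom s' u)) →
      ∃ w, w ∈ ((W p j).comap σ).acceptsFrom s ∧ w ∉ ((W p j).comap σ).acceptsFrom t ∧
        w ∈ ((W q k).comap (boolLetter ∘ σ)).acceptsFrom s' := by
    rintro s t s' u ⟨w, h⟩
    simp only [DFA.mem_acceptsFrom, ← DFA.evalFrom_of_append] at h
    exact ⟨u ++ w, h⟩
  -- The letter c₁ makes the second component final, but may merge two non-final states of the
  -- first; hence the condition that s and t are not both such states.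
  have hmixed : ∀ (s t : St p j) (i' : Fin q), s ≠ t → s ≠ none →
      (∀ i i₂, s = some (.inl i) → t ≠ some (.inl i₂)) →
      ∃ w, w ∈ ((W p j).comap σ).acceptsFrom s ∧ w ∉ ((W p j).comap σ).acceptsFrom t ∧
        w ∈ ((W q k).comap (boolLetter ∘ σ)).acceptsFrom (some (.inl i')) := by
    intro s t i' hst hs hmix
    obtain ⟨w, hw, -⟩ := exists_permOf q 1 (Equiv.swap i' 0) 1
    refine hcons _ _ _ (w.map g ++ [xc]) ?_
    simp only [DFA.evalFrom_append_singleton, evalFrom_ab hg, evalFrom_ab hg', DFA.comap_step, hc,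
      Function.comp_apply, hw]
    have : (W q k).step (blockPerm (Equiv.swap i' 0) (permOf k (w.map not)) (some (.inl i')))
        (boolLetter .c₁) = some (.inr 0) := by
      simp [W, boolLetter, stepW]
    rw [this]
    apply hfinal
    · rcases s with _ | i | f <;> rcases t with _ | i₂ | f₂ <;> simp_all [W, stepW]
    · rcases s with _ | i | f <;> simp_all [W, stepW]
  rcases s' with _ | i' | f'
  · exact absurd rfl hs'
  -- Two non-final states are first made different in kind: after moving s to 0, the letter e makes
  -- only s final.
  · by_cases hE : ∃ i i₂, s = some (.inl i) ∧ t = some (.inl i₂)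
    · obtain ⟨i, i₂, rfl, rfl⟩ := hE
      obtain ⟨w, hw, -⟩ := exists_permOf p 1 (Equiv.swap i 0) 1
      refine hcons _ _ _ (w.map g ++ [y]) ?_
      have hne : Equiv.swap i 0 i₂ ≠ 0 := by
        intro h
        have : Equiv.swap i 0 i₂ = Equiv.swap i 0 i := by rw [h, Equiv.swap_apply_left]
        exact hst (by rw [(Equiv.swap i 0).injective this])
      simp only [DFA.evalFrom_append_singleton, evalFrom_ab hg, evalFrom_ab hg', DFA.comap_step, hy,
        Function.comp_apply, hw]
      have h1 : (W p j).step (blockPerm (Equiv.swap i 0) (permOf j (w.map not)) (some (.inl i)))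
          .e = some (.inr 0) := by
        simp [W, stepW]
      have h2 : (W p j).step (blockPerm (Equiv.swap i 0) (permOf j (w.map not)) (some (.inl i₂)))
          .e = some (.inl (Equiv.swap i 0 i₂)) := by
        simp [W, stepW, hne]
      have h3 : (W q k).step (blockPerm (permOf q w) (permOf k (w.map not)) (some (.inl i')))
          (boolLetter .e) = some (.inl (mergeFin q (permOf q w i'))) := rfl
      rw [h1, h2, h3]
      exact hmixed _ _ _ (by simp) (by simp) (by simp)
    · refine hmixed s t i' hst hs fun i i₂ h1 h2 => hE ⟨i, i₂, h1, h2⟩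
  · exact hfinal s t f' hst hs

/-- The pairs of states that are not identified are not equivalent. -/
theorem collapse_eq_of_boolOpFrom_eq (hσ : sixLetters ⊆ Set.range σ) {f : Bool → Bool → Bool}
    (hf : IsProperBool f) {s t : St p j × St q k}
    (h : boolOpFrom f ((W p j).comap σ) ((W q k).comap (boolLetter ∘ σ)) s =
      boolOpFrom f ((W p j).comap σ) ((W q k).comap (boolLetter ∘ σ)) t) :
    collapse f s = collapse f t := by
  classical
  have hσ' := sixLetters_subset_bool hσ
  have hM := (W_convex p j).comap σ
  have hM' := (W_convex q k).comap (boolLetter ∘ σ)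
  have hmin := isMinimalDFA_comap (p := p) (k := j) (fourLetters_subset_six hσ)
  have hmin' := isMinimalDFA_comap (p := q) (k := k) (fourLetters_subset_six hσ')
  have key := apply_eq_of_boolOp_eq h
  obtain ⟨s, s'⟩ := s
  obtain ⟨t, t'⟩ := t
  simp only at key
  -- With the second automaton sent to the sink, f determines acceptance in the first, where the
  -- states are still different.
  have fst : f true false ≠ f false false → s = t := by
    intro hne
    by_contra hst
    obtain ⟨u, hu, hu'⟩ := exists_evalFrom_ne (q := q) (k := k) hσ hst
    refine hu (hmin.2 _ _ (Set.ext fun w => ?_))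
    have h1 := key (u ++ w)
    have hno : ∀ r, u ++ w ∉ ((W q k).comap (boolLetter ∘ σ)).acceptsFrom r := by
      intro r
      rw [DFA.mem_acceptsFrom, DFA.evalFrom_of_append, hu', hM'.evalFrom_none, hM'.accept]
      simp
    simp only [hno, decide_false] at h1
    have h2 : ∀ r, u ++ w ∈ ((W p j).comap σ).acceptsFrom r ↔
        w ∈ ((W p j).comap σ).acceptsFrom (((W p j).comap σ).evalFrom r u) := by
      intro r
      rw [DFA.mem_acceptsFrom, DFA.mem_acceptsFrom, DFA.evalFrom_of_append]
    erw [← h2, ← h2]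
    by_cases a : u ++ w ∈ ((W p j).comap σ).acceptsFrom s <;>
      by_cases b : u ++ w ∈ ((W p j).comap σ).acceptsFrom t <;>
      simp only [a, b, decide_true, decide_false] at h1 ⊢
    · exact (hne h1).elim
    · exact (hne h1.symm).elim
  have snd : f false true ≠ f false false → s' = t' := by
    intro hne
    by_contra hst
    obtain ⟨u, hu, hu'⟩ := exists_evalFrom_ne (q := p) (k := j) hσ' hst
    rw [boolLetter_boolLetter] at hu'
    refine hu (hmin'.2 _ _ (Set.ext fun w => ?_))
    have h1 := key (u ++ w)
    have hno : ∀ r, u ++ w ∉ ((W p j).comap σ).acceptsFrom r := by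
      intro r
      rw [DFA.mem_acceptsFrom, DFA.evalFrom_of_append, hu', hM.evalFrom_none, hM.accept]
      simp
    simp only [hno, decide_false] at h1
    have h2 : ∀ r, u ++ w ∈ ((W q k).comap (boolLetter ∘ σ)).acceptsFrom r ↔
        w ∈ ((W q k).comap (boolLetter ∘ σ)).acceptsFrom
          (((W q k).comap (boolLetter ∘ σ)).evalFrom r u) := by
      intro r
      rw [DFA.mem_acceptsFrom, DFA.mem_acceptsFrom, DFA.evalFrom_of_append]
    erw [← h2, ← h2]
    by_cases a : u ++ w ∈ ((W q k).comap (boolLetter ∘ σ)).acceptsFrom s' <;>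
      by_cases b : u ++ w ∈ ((W q k).comap (boolLetter ∘ σ)).acceptsFrom t' <;>
      simp only [a, b, decide_true, decide_false] at h1 ⊢
    · exact (hne h1).elim
    · exact (hne h1.symm).elim
  -- Here f is the conjunction up to negation, so a word accepted from both a and a', but not from
  -- one of the other two states, distinguishes the pairs.
  have final : ∀ {a b : St p j} {a' b' : St q k}, (∀ w,
      f (decide (w ∈ ((W p j).comap σ).acceptsFrom a))
        (decide (w ∈ ((W q k).comap (boolLetter ∘ σ)).acceptsFrom a')) =
      f (decide (w ∈ ((W p j).comap σ).acceptsFrom b))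
        (decide (w ∈ ((W q k).comap (boolLetter ∘ σ)).acceptsFrom b'))) →
      a ≠ none → a' ≠ none → f true false = f false false → f false true = f false false →
      a = b ∧ a' = b' := by
    intro a b a' b' hab ha ha' h1 h2
    have h3 : f true true ≠ f false false := by
      intro h3
      obtain ⟨y, hy⟩ := hf.1
      cases y
      · exact hy h1
      · exact hy (h3.trans h2.symm)
    constructor
    · by_contra hne
      obtain ⟨w, hw1, hw2, hw3⟩ := exists_evalFrom_final hσ hne ha ha'
      have := hab w
      simp only [hw1, hw2, hw3, decide_true, decide_false] at this
      by_cases hw4 : w ∈ ((W q k).comap (boolLetter ∘ σ)).acceptsFrom b' <;>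
        simp only [hw4, decide_true, decide_false] at this
      · exact h3 (this.trans h2)
      · exact h3 this
    · by_contra hne
      obtain ⟨w, hw1, hw2, hw3⟩ := exists_evalFrom_final (q := p) (k := j) hσ' hne ha' ha
      rw [boolLetter_boolLetter] at hw3
      have := hab w
      simp only [hw1, hw2, hw3, decide_true, decide_false] at this
      by_cases hw4 : w ∈ ((W p j).comap σ).acceptsFrom b <;>
        simp only [hw4, decide_true, decide_false] at this
      · exact h3 (this.trans h1)
      · exact h3 this
  by_cases h1 : f true false = f false false <;> by_cases h2 : f false true = f false false
  · by_cases hs : s = none ∨ s' = none <;> by_cases ht : t = none ∨ t' = none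
    · simp [collapse, h1, h2, hs, ht]
    · push Not at ht
      obtain ⟨rfl, rfl⟩ := final (fun w => (key w).symm) ht.1 ht.2 h1 h2
      rfl
    · push Not at hs
      obtain ⟨rfl, rfl⟩ := final key hs.1 hs.2 h1 h2
      rfl
    · push Not at hs
      obtain ⟨rfl, rfl⟩ := final key hs.1 hs.2 h1 h2
      rfl
  · obtain rfl := snd h2
    by_cases hs' : s' = none
    · simp [collapse, h1, hs']
    -- Since f does not depend on its first argument when the second is false, properness forces
    -- dependence when it is true; words accepted from s' therefore test the first component.
    · have h3 : f true true ≠ f false true := by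
        intro h3
        obtain ⟨y, hy⟩ := hf.1
        cases y
        · exact hy h1
        · exact hy h3
      have aux : ∀ {a b : St p j}, (∀ w,
          f (decide (w ∈ ((W p j).comap σ).acceptsFrom a))
            (decide (w ∈ ((W q k).comap (boolLetter ∘ σ)).acceptsFrom s')) =
          f (decide (w ∈ ((W p j).comap σ).acceptsFrom b))
            (decide (w ∈ ((W q k).comap (boolLetter ∘ σ)).acceptsFrom s'))) →
          a ≠ none → a = b := by
        intro a b hab ha
        by_contra hne
        obtain ⟨w, hw1, hw2, hw3⟩ := exists_evalFrom_final hσ hne ha hs'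
        have := hab w
        simp only [hw1, hw2, hw3, decide_true, decide_false] at this
        exact h3 this
      by_cases hs : s = none
      · by_cases ht : t = none
        · rw [hs, ht]
        · rw [aux (fun w => (key w).symm) ht]
      · rw [aux key hs]
  · obtain rfl := fst h1
    by_cases hs : s = none
    · simp [collapse, h2, hs]
    · have h3 : f true true ≠ f true false := by
        intro h3
        obtain ⟨x, hx⟩ := hf.2
        cases x
        · exact hx h2
        · exact hx h3
      have aux : ∀ {a b : St q k}, (∀ w,
          f (decide (w ∈ ((W p j).comap σ).acceptsFrom s))
            (decide (w ∈ ((W q k).comap (boolLetter ∘ σ)).acceptsFrom a)) =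
          f (decide (w ∈ ((W p j).comap σ).acceptsFrom s))
            (decide (w ∈ ((W q k).comap (boolLetter ∘ σ)).acceptsFrom b))) →
          a ≠ none → a = b := by
        intro a b hab ha
        by_contra hne
        obtain ⟨w, hw1, hw2, hw3⟩ := exists_evalFrom_final (q := p) (k := j) hσ' hne ha hs
        rw [boolLetter_boolLetter] at hw3
        have := hab w
        simp only [hw1, hw2, hw3, decide_true, decide_false] at this
        exact h3 this
      by_cases hs' : s' = none
      · by_cases ht : t' = none
        · rw [hs', ht]
        · rw [aux (fun w => (key w).symm) ht]
      · rw [aux key hs']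
  · rw [fst h1, snd h2]

theorem complexity_boolOp_comap (hσ : sixLetters ⊆ Set.range σ) {f : Bool → Bool → Bool}
    (hf : IsProperBool f) :
    complexity (boolOp f ((W p j).comap σ).accepts ((W q k).comap (boolLetter ∘ σ)).accepts) =
      (Set.range (collapse f : St p j × St q k → _)).encard := by
  have hM := (W_convex p j).comap σ
  have hM' := (W_convex q k).comap (boolLetter ∘ σ)
  rw [complexity_eq_of_ker fun w => collapse f
    (((W p j).comap σ).eval w, ((W q k).comap (boolLetter ∘ σ)).eval w)]
  · congr 1
    refine Set.Subset.antisymm (Set.range_subset_iff.2 fun w => ⟨_, rfl⟩) ?_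
    rintro _ ⟨⟨s, s'⟩, rfl⟩
    obtain ⟨w, rfl, rfl⟩ := exists_eval_pair hσ s s'
    exact ⟨w, rfl⟩
  · intro w w'
    rw [leftQuotient_boolOp_accepts, leftQuotient_boolOp_accepts]
    refine ⟨collapse_eq_of_boolOpFrom_eq hσ hf, fun h => ?_⟩
    rw [← hM.boolOpFrom_collapse hM', h, hM.boolOpFrom_collapse hM']

end witness

/-! ### The numbers of classes of pairs of states -/

section counts

variable {p j q k : ℕ} {f : Bool → Bool → Bool}

theorem encard_range_collapse_of_ne (h1 : f true false ≠ f false false)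
    (h2 : f false true ≠ f false false) :
    (Set.range (collapse f : St p j × St q k → _)).encard =
      ((p + j + 1) * (q + k + 1) : ℕ) := by
  have : (collapse f : St p j × St q k → _) = id := by
    funext s
    simp [collapse, h1, h2]
  rw [this, Set.range_id, Set.encard_univ, ENat.card_eq_coe_fintype_card]
  simp

/-- All pairs with the first component at the sink form one class, which gives (m - 1)n + 1. -/
theorem encard_range_collapse_of_left (h1 : f true false ≠ f false false)
    (h2 : f false true = f false false) :
    (Set.range (collapse f : St p j × St q k → _)).encard =
      ((p + j + 1) * (q + k + 1) - (q + k + 1 - 1) : ℕ) := by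
  have h : Set.range (collapse f : St p j × St q k → _) =
      insert (none, none) ({none}ᶜ ×ˢ Set.univ) := by
    ext ⟨s, t⟩
    simp only [Set.mem_range, collapse, h1, h2, and_true, and_false, or_false, Set.mem_insert_iff,
      Set.mem_prod, Set.mem_compl_iff, Set.mem_singleton_iff, Set.mem_univ]
    constructor
    · rintro ⟨⟨a, b⟩, h⟩
      split_ifs at h with ha
      · exact Or.inl h.symm
      · obtain ⟨rfl, rfl⟩ := Prod.mk.inj h
        exact Or.inr ha
    · rintro (h | h)
      · exact ⟨(none, none), by simp [h]⟩
      · exact ⟨(s, t), by simp [h]⟩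
  rw [h, Set.encard_insert_of_notMem (by simp), ← Set.Finite.cast_ncard_eq (Set.toFinite _),
    Set.ncard_prod, Set.ncard_compl]
  simp only [Nat.card_eq_fintype_card, Fintype.card_option, Fintype.card_sum, Fintype.card_fin,
    Set.ncard_singleton, Set.ncard_univ, Nat.add_sub_cancel]
  have e : (p + j) * (q + k + 1) + 1 = (p + j + 1) * (q + k + 1) - (q + k) := by
    rw [Nat.add_mul (p + j)]
    omega
  rw [← e]
  rfl

theorem encard_range_collapse_of_eq (h1 : f true false = f false false)
    (h2 : f false true = f false false) :
    (Set.range (collapse f : St p j × St q k → _)).encard =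
      ((p + j + 1) * (q + k + 1) - ((p + j + 1) + (q + k + 1) - 2) : ℕ) := by
  have h : Set.range (collapse f : St p j × St q k → _) =
      insert (none, none) ({none}ᶜ ×ˢ {none}ᶜ) := by
    ext ⟨s, t⟩
    simp only [Set.mem_range, collapse, h1, h2, and_true, Set.mem_insert_iff,
      Set.mem_prod, Set.mem_compl_iff, Set.mem_singleton_iff]
    constructor
    · rintro ⟨⟨a, b⟩, h⟩
      split_ifs at h with ha
      · exact Or.inl h.symm
      · obtain ⟨rfl, rfl⟩ := Prod.mk.inj h
        exact Or.inr (not_or.1 ha)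
    · rintro (h | h)
      · exact ⟨(none, none), by simp [h]⟩
      · exact ⟨(s, t), by simp [h]⟩
  rw [h, Set.encard_insert_of_notMem (by simp), ← Set.Finite.cast_ncard_eq (Set.toFinite _),
    Set.ncard_prod, Set.ncard_compl, Set.ncard_compl]
  simp only [Nat.card_eq_fintype_card, Fintype.card_option, Fintype.card_sum, Fintype.card_fin,
    Set.ncard_singleton, Nat.add_sub_cancel]
  have e : (p + j) * (q + k) + 1 =
      (p + j + 1) * (q + k + 1) - (p + j + 1 + (q + k + 1) - 2) := by
    rw [Nat.add_mul (p + j) 1, Nat.mul_add (p + j) (q + k) 1]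
    omega
  rw [← e]
  rfl

end counts

/-! ### The named boolean operations -/

section boolOpNames

variable {α : Type u} (K L : Language α)

theorem boolOp_or : boolOp (fun x y => x || y) K L = K ⊔ L := by
  classical
  ext w
  rw [mem_boolOp]
  change _ ↔ w ∈ K ∨ w ∈ L
  simp

theorem boolOp_xor : boolOp xor K L = symmDiff K L := by
  classical
  ext w
  rw [mem_boolOp]
  change _ ↔ (w ∈ K ∧ w ∉ L) ∨ (w ∈ L ∧ w ∉ K)
  by_cases h1 : w ∈ K <;> by_cases h2 : w ∈ L <;> simp [h1, h2]

theorem boolOp_sdiff : boolOp (fun x y => x && !y) K L = K \ L := by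
  classical
  ext w
  rw [mem_boolOp]
  change _ ↔ w ∈ K ∧ w ∉ L
  simp

theorem boolOp_and : boolOp (fun x y => x && y) K L = K ⊓ L := by
  classical
  ext w
  rw [mem_boolOp]
  change _ ↔ w ∈ K ∧ w ∈ L
  simp

end boolOpNames

end PrefixConvex

namespace PrefixConvex

/-! ### Transfer to the witness automata -/

section transfer

/-- A word of an atom belongs to all members of S, and none belongs to ∅. -/
theorem bot_notMem_of_atomicIntersection_ne_bot {α : Type u} {K : Language α} {S : Set (Language α)}
    (hK : ⊥ ∈ quotients K) (h : atomicIntersection K S ≠ ⊥) : ⊥ ∉ S := by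
  intro hS
  refine h (Set.eq_empty_of_forall_notMem fun x hx => ?_)
  exact (hx ⊥ hK).2 hS

theorem complexity_atomicIntersection_le {α : Type u} {p k : ℕ} {M : DFA α (St p k)}
    (hM : ConvexDFA M) (hmin : IsMinimalDFA M) (hbot : ⊥ ∈ quotients M.accepts)
    {S : Set (Language α)} (hS : S ⊆ quotients M.accepts)
    (h : atomicIntersection M.accepts S ≠ ⊥) :
    complexity (atomicIntersection M.accepts S) ≤
      (atomBound (p + k + 1) k {Q ∈ S | [] ∉ Q}.ncard {Q ∈ S | [] ∈ Q}.ncard : ℕ∞) := by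
  classical
  have h3 := bot_notMem_of_atomicIntersection_ne_bot hbot h
  rw [quotients_accepts M hmin.1] at hS
  have hinj : Function.Injective M.acceptsFrom := hmin.2
  have e1 : {Q ∈ S | [] ∉ Q} = ((Finset.univ.filter fun i : Fin p =>
      M.acceptsFrom (some (.inl i)) ∈ S).image fun i => M.acceptsFrom (some (.inl i)) : Set _) := by
    ext Q
    simp only [Finset.coe_filter, Finset.mem_univ, true_and, Finset.coe_image, Set.mem_image,
      Set.mem_ofPred_eq]
    constructor
    · rintro ⟨hQ, hQ'⟩
      obtain ⟨q, rfl⟩ := hS hQ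
      rw [hM.nil_mem_acceptsFrom] at hQ'
      rcases q with _ | i | f
      · rw [hM.acceptsFrom_none] at hQ
        exact absurd hQ h3
      · exact ⟨i, hQ, rfl⟩
      · exact absurd ⟨f, rfl⟩ hQ'
    · rintro ⟨i, hi, rfl⟩
      exact ⟨hi, by rw [hM.nil_mem_acceptsFrom]; simp⟩
  have e2 : {Q ∈ S | [] ∈ Q} = ((Finset.univ.filter fun i : Fin k =>
      M.acceptsFrom (some (.inr i)) ∈ S).image fun i => M.acceptsFrom (some (.inr i)) : Set _) := by
    ext Q
    simp only [Finset.coe_filter, Finset.mem_univ, true_and, Finset.coe_image, Set.mem_image,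
      Set.mem_ofPred_eq]
    constructor
    · rintro ⟨hQ, hQ'⟩
      obtain ⟨q, rfl⟩ := hS hQ
      rw [hM.nil_mem_acceptsFrom] at hQ'
      obtain ⟨f, rfl⟩ := hQ'
      exact ⟨f, hQ, rfl⟩
    · rintro ⟨i, hi, rfl⟩
      exact ⟨hi, by rw [hM.nil_mem_acceptsFrom]; exact ⟨i, rfl⟩⟩
  rw [e1, e2, Set.ncard_coe_finset, Set.ncard_coe_finset,
    Finset.card_image_of_injective _ fun i i' hii => by simpa using hinj hii,
    Finset.card_image_of_injective _ fun i i' hii => by simpa using hinj hii]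
  refine complexity_atom_le hM hmin (by simp) (by simp) ?_
  rwa [hM.acceptsFrom_none]

variable {p k : ℕ} [NeZero p] [NeZero k] (hn : 3 ≤ p + k + 1)

theorem acceptsFrom_D (s : St p k) :
    (D (p + k + 1) k hn).acceptsFrom (stEquiv p k s) = (W p k).acceptsFrom s := by
  ext w
  rw [D_eq_reindex, DFA.mem_acceptsFrom, DFA.mem_acceptsFrom, DFA.evalFrom_reindex,
    Equiv.symm_apply_apply]
  change (stEquiv p k).symm (stEquiv p k _) ∈ (W p k).accept ↔ _
  rw [Equiv.symm_apply_apply]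

theorem isMinimalDFA_W : IsMinimalDFA (W p k) :=
  isMinimalDFA_comap (p := p) (k := k) (ρ := id) fun x _ => ⟨x, rfl⟩

theorem isMinimalDFA_D : IsMinimalDFA (D (p + k + 1) k hn) := by
  have hmin := isMinimalDFA_W (p := p) (k := k)
  refine ⟨fun q => ?_, fun q r h => ?_⟩
  · obtain ⟨w, hw⟩ := hmin.1 ((stEquiv p k).symm q)
    refine ⟨w, ?_⟩
    rw [D_eq_reindex, DFA.eval_reindex, hw, Equiv.apply_symm_apply]
  · obtain ⟨s, rfl⟩ := (stEquiv p k).surjective q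
    obtain ⟨t, rfl⟩ := (stEquiv p k).surjective r
    rw [acceptsFrom_D, acceptsFrom_D] at h
    rw [hmin.2 _ _ h]

/-- Translates a set of numbered states into its parts in the two blocks; the sink is excluded
because its language is empty. -/
theorem complexity_atom_L {S : Finset (Fin (p + k + 1))}
    (h : atomicIntersection (L (p + k + 1) k hn)
      ((D (p + k + 1) k hn).acceptsFrom '' (S : Set (Fin (p + k + 1)))) ≠ ⊥) :
    S ⊆ E (p + k + 1) k ∪ F (p + k + 1) k ∧
      complexity (atomicIntersection (L (p + k + 1) k hn)
        ((D (p + k + 1) k hn).acceptsFrom '' (S : Set (Fin (p + k + 1))))) =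
        (atomBound (p + k + 1) k (S ∩ E (p + k + 1) k).card (S ∩ F (p + k + 1) k).card : ℕ∞) := by
  have hmin := isMinimalDFA_W (p := p) (k := k)
  have hM := W_convex p k
  rw [accepts_D] at h ⊢
  have hmem : ∀ s, (W p k).acceptsFrom s ∈
      (D (p + k + 1) k hn).acceptsFrom '' (S : Set (Fin (p + k + 1))) ↔ toFin p k s ∈ S := by
    intro s
    rw [← acceptsFrom_D hn]
    exact Function.Injective.mem_set_image (isMinimalDFA_D hn).2
  have hbot : (W p k).acceptsFrom none ∉
      (D (p + k + 1) k hn).acceptsFrom '' (S : Set (Fin (p + k + 1))) := by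
    rw [hM.acceptsFrom_none]
    refine bot_notMem_of_atomicIntersection_ne_bot ?_ h
    rw [quotients_accepts _ hmin.1]
    exact ⟨none, hM.acceptsFrom_none⟩
  constructor
  · intro x hx
    obtain ⟨s, rfl⟩ := (stEquiv p k).surjective x
    rw [stEquiv_apply] at hx ⊢
    rcases s with _ | i | f
    · exact absurd ((hmem none).2 hx) hbot
    · refine Finset.mem_union_left _ (Finset.mem_filter.2 ⟨Finset.mem_univ _, ?_⟩)
      change i.val < _
      have := i.2
      omega
    · refine Finset.mem_union_right _ (Finset.mem_filter.2 ⟨Finset.mem_univ _, ?_⟩)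
      change _ ≤ p + f.val ∧ p + f.val < _
      have := f.2
      omega
  · have e1 : S ∩ E (p + k + 1) k = (Finset.univ.filter fun i : Fin p =>
        toFin p k (some (.inl i)) ∈ S).image fun i => toFin p k (some (.inl i)) := by
      ext x
      simp only [Finset.mem_inter, E, Finset.mem_filter, Finset.mem_univ, true_and,
        Finset.mem_image]
      constructor
      · rintro ⟨hx, hx'⟩
        have hxp : x.val < p := by omega
        have : toFin p k (some (.inl ⟨x, hxp⟩)) = x := rfl
        exact ⟨⟨x, hxp⟩, by rwa [this], this⟩
      · rintro ⟨i, hi, rfl⟩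
        refine ⟨hi, ?_⟩
        change i.val < _
        have := i.2
        omega
    have e2 : S ∩ F (p + k + 1) k = (Finset.univ.filter fun i : Fin k =>
        toFin p k (some (.inr i)) ∈ S).image fun i => toFin p k (some (.inr i)) := by
      ext x
      simp only [Finset.mem_inter, F, Finset.mem_filter, Finset.mem_univ, true_and,
        Finset.mem_image]
      constructor
      · rintro ⟨hx, hx'⟩
        have : toFin p k (some (.inr ⟨x - p, by omega⟩)) = x := by
          apply Fin.ext
          change p + (x.val - p) = x
          omega
        exact ⟨_, by rwa [this], this⟩
      · rintro ⟨i, hi, rfl⟩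
        refine ⟨hi, ?_⟩
        change _ ≤ p + i.val ∧ p + i.val < _
        have := i.2
        omega
    have hinj := (toFin_bijective p k).1
    rw [e1, e2, Finset.card_image_of_injective _ fun i i' hii => by simpa using hinj hii,
      Finset.card_image_of_injective _ fun i i' hii => by simpa using hinj hii]
    exact complexity_atom_W p k (by simp [hmem]) (by simp [hmem]) hbot

end transfer

end PrefixConvex

open PrefixConvex in
theorem theorem10 (n k : ℕ) (hn : 3 ≤ n) (hk1 : 1 ≤ k) (hk2 : k ≤ n - 2) :
    -- the automaton and its language
    IsMinimalDFA (D n k hn) ∧ KProperOfComplexity n k (L n k hn) ∧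
    -- 1. the syntactic semigroup
    (ENat.card (SyntacticSemigroup (L n k hn)) = (semigroupBound n k : ℕ∞) ∧
      (∀ (α : Type u) (K : Language α), KProperOfComplexity n k K →
        ENat.card (SyntacticSemigroup K) ≤ (semigroupBound n k : ℕ∞)) ∧
      semigroupBound n k ≤ n * (n - 1) ^ (n - 2) ∧
      (semigroupBound n k = n * (n - 1) ^ (n - 2) ↔ k = n - 2)) ∧
    -- at least seven letters are required
    (2 ≤ k → k ≤ n - 3 → ∀ (α : Type u) (K : Language α), KProperOfComplexity n k K →
      ENat.card (SyntacticSemigroup K) = (semigroupBound n k : ℕ∞) → 7 ≤ ENat.card α) ∧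
    -- 2. quotients
    (KProperOfComplexity n k (L₄ n k hn) ∧
      (∀ Q ∈ quotients (L₄ n k hn), Q ≠ ⊥ → [] ∉ Q → complexity Q = n) ∧
      (∀ Q ∈ quotients (L₄ n k hn), [] ∈ Q → complexity Q = (k + 1 : ℕ)) ∧
      (⊥ ∈ quotients (L₄ n k hn) ∧
        complexity (⊥ : Language ({.a, .b, .d₂, .e} : Set Letter)) = 1) ∧
      ∀ (α : Type u) (K : Language α), KProperOfComplexity n k K →
        (∀ Q ∈ quotients K, Q ≠ ⊥ → [] ∉ Q → complexity Q ≤ n) ∧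
        (∀ Q ∈ quotients K, [] ∈ Q → complexity Q ≤ (k + 1 : ℕ)) ∧
        (⊥ ∈ quotients K ∧ complexity (⊥ : Language α) = 1)) ∧
    -- 3. reversal and the number of atoms
    (complexity (L₄ n k hn).reverse = (2 ^ (n - 1) : ℕ) ∧
      (atoms (L₄ n k hn)).encard = (2 ^ (n - 1) : ℕ) ∧
      ∀ (α : Type u) (K : Language α), KProperOfComplexity n k K →
        complexity K.reverse ≤ (2 ^ (n - 1) : ℕ) ∧ (atoms K).encard ≤ (2 ^ (n - 1) : ℕ)) ∧
    -- 4. the complexity of atoms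
    ((∀ S : Finset (Fin n),
        atomicIntersection (L n k hn) ((D n k hn).acceptsFrom '' (S : Set (Fin n))) ≠ ⊥ →
        S ⊆ E n k ∪ F n k ∧
        complexity (atomicIntersection (L n k hn)
            ((D n k hn).acceptsFrom '' (S : Set (Fin n)))) =
          (atomBound n k (S ∩ E n k).card (S ∩ F n k).card : ℕ∞)) ∧
      ∀ (α : Type u) (K : Language α), KProperOfComplexity n k K →
        ∀ S ⊆ quotients K, atomicIntersection K S ≠ ⊥ →
          complexity (atomicIntersection K S) ≤
            (atomBound n k {Q ∈ S | [] ∉ Q}.ncard {Q ∈ S | [] ∈ Q}.ncard : ℕ∞)) ∧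
    -- 5. star
    (KProperOfComplexity n k (L₅ n k hn) ∧
      complexity (KStar.kstar (L₅ n k hn)) = (starBound n k : ℕ∞) ∧
      (∀ (α : Type u) (K : Language α), KProperOfComplexity n k K →
        complexity (KStar.kstar K) ≤ (starBound n k : ℕ∞)) ∧
      starBound n k ≤ 2 ^ (n - 2) + 2 ^ (n - 3) + 1 ∧
      (starBound n k = 2 ^ (n - 2) + 2 ^ (n - 3) + 1 ↔ k = 1)) ∧
    ∀ (m j : ℕ) (hm : 3 ≤ m), 1 ≤ j → j ≤ m - 2 →
      -- 6. product
      (KProperOfComplexity m j (L₆ m j hm) ∧ KProperOfComplexity n k (L₆prod n k hn) ∧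
        complexity (L₆ m j hm * L₆prod n k hn) = (productBound m j n : ℕ∞) ∧
        (∀ (α : Type u) (K K' : Language α),
          KProperOfComplexity m j K → KProperOfComplexity n k K' →
          complexity (K * K') ≤ (productBound m j n : ℕ∞)) ∧
        productBound m j n ≤ m * 2 ^ (n - 2) + 1 ∧
        (productBound m j n = m * 2 ^ (n - 2) + 1 ↔ j = m - 2)) ∧
      -- 7. boolean operations
      (KProperOfComplexity n k (L₆bool n k hn) ∧
        (∀ f : Bool → Bool → Bool, IsProperBool f →
          ∀ (α : Type u) (K K' : Language α),
            KProperOfComplexity m j K → KProperOfComplexity n k K' →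
            complexity (boolOp f K K') ≤ complexity (boolOp f (L₆ m j hm) (L₆bool n k hn))) ∧
        complexity (L₆ m j hm ⊔ L₆bool n k hn) = (m * n : ℕ) ∧
        complexity (symmDiff (L₆ m j hm) (L₆bool n k hn)) = (m * n : ℕ) ∧
        complexity (L₆ m j hm \ L₆bool n k hn) = (m * n - (n - 1) : ℕ) ∧
        complexity (L₆ m j hm ⊓ L₆bool n k hn) = (m * n - (m + n - 2) : ℕ)) := by
  -- The number p = n - 1 - k of non-final states other than the sink is made the parameter, which
  -- removes the truncated subtractions.
  obtain ⟨p, hp, rfl⟩ : ∃ p, 1 ≤ p ∧ n = p + k + 1 := ⟨n - 1 - k, by omega, by omega⟩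
  have : NeZero p := ⟨by omega⟩
  have : NeZero k := ⟨by omega⟩
  have hfour : fourLetters ⊆
      Set.range fun x : ({.a, .b, .d₂, .e} : Set Letter) => x.1 := by
    rw [Subtype.range_coe]
    rfl
  have hfive : fiveLetters ⊆
      Set.range fun x : ({.a, .b, .d₁, .d₂, .e} : Set Letter) => x.1 := by
    rw [Subtype.range_coe]
    rfl
  have hfour' : fourLetters ⊆ fiveLetters := by
    rintro x (rfl | rfl | rfl | rfl) <;> simp [fiveLetters]
  have hsix : sixLetters ⊆ Set.range fun x : sixLetters => x.1 := by
    rw [Subtype.range_coe]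
  have hLW : KProperOfComplexity (p + k + 1) k (W p k).accepts :=
    kProperOfComplexity_comap (ρ := id) fun x _ => ⟨x, rfl⟩
  refine ⟨isMinimalDFA_D hn, ?_, ⟨?_, ?_, semigroupBound_le hn hk1 hk2⟩, ?_, ?_, ?_, ?_, ?_, ?_⟩
  · rwa [accepts_D]
  · rw [accepts_D]
    exact card_syntacticSemigroup_W p k
  · intro α K hK
    obtain ⟨M, hM, -, rfl⟩ := exists_convexDFA hK
    obtain ⟨h1, h2⟩ := card_syntacticSemigroup_le hM
    rw [← encard_isConvexMap]
    exact h1.trans (Set.encard_le_encard h2)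
  · intro hk hk' α K hK hc
    obtain ⟨M, hM, -, rfl⟩ := exists_convexDFA hK
    exact seven_le_card (by omega) hk hM hc
  · rw [L₄_eq]
    have hP := kProperOfComplexity_comap (p := p) (k := k) hfour
    obtain ⟨h1, h2⟩ := complexity_quotient_comap (p := p) (k := k) hfour
    refine ⟨hP, h1, h2, ⟨bot_mem_quotients hP.1.1, complexity_bot⟩, fun α K hK => ?_⟩
    have hbot := bot_mem_quotients hK.1.1
    obtain ⟨M, hM, hmin, rfl⟩ := exists_convexDFA hK
    obtain ⟨h3, h4⟩ := complexity_quotient hM hmin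
    exact ⟨fun Q hQ _ _ => h3 Q hQ, h4, hbot, complexity_bot⟩
  · rw [L₄_eq, show p + k + 1 - 1 = p + k by omega]
    have hM := (W_convex p k).comap fun x : ({.a, .b, .d₂, .e} : Set Letter) => x.1
    have hmin := isMinimalDFA_comap (p := p) (k := k) hfour
    refine ⟨?_, ?_, fun α K hK => ?_⟩
    · rw [complexity_reverse hM hmin, encard_range_finalSet hfour]
    · rw [encard_atoms hM hmin, encard_range_finalSet hfour]
    · obtain ⟨M, hM, hmin, rfl⟩ := exists_convexDFA hK
      rw [complexity_reverse hM hmin, encard_atoms hM hmin]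
      exact ⟨encard_range_finalSet_le M, encard_range_finalSet_le M⟩
  · refine ⟨fun S hS => complexity_atom_L hn hS, fun α K hK S hS h => ?_⟩
    have hbot := bot_mem_quotients hK.1.1
    obtain ⟨M, hM, hmin, rfl⟩ := exists_convexDFA hK
    exact complexity_atomicIntersection_le hM hmin hbot hS h
  · rw [L₅_eq]
    refine ⟨kProperOfComplexity_comap (hfour'.trans hfive), complexity_kstar_comap hfive,
      fun α K hK => ?_, starBound_le hn hk1 hk2⟩
    obtain ⟨M, hM, -, rfl⟩ := exists_convexDFA hK
    exact hM.complexity_kstar_le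
  · intro m j hm hj1 hj2
    -- The first language now has q non-final states besides the sink and the second has p, the
    -- reverse of the naming in the lemmas on two languages.
    obtain ⟨q, hq, rfl⟩ : ∃ q, 1 ≤ q ∧ m = q + j + 1 := ⟨m - 1 - j, by omega, by omega⟩
    have : NeZero q := ⟨by omega⟩
    have : NeZero j := ⟨by omega⟩
    rw [L₆_eq, L₆prod_eq, L₆bool_eq]
    have hbool : ∀ f, IsProperBool f → complexity (boolOp f
        ((W q j).comap fun x : sixLetters => x.1).accepts
        ((W p k).comap fun x : sixLetters => boolLetter x.1).accepts) =
        (Set.range (collapse f : St q j × St p k → _)).encard :=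
      fun f hf => complexity_boolOp_comap hsix hf
    refine ⟨⟨kProperOfComplexity_comap (fourLetters_subset_six hsix),
      kProperOfComplexity_comap (fourLetters_subset_prod hsix), complexity_mul_comap hsix,
      fun α K K' hK hK' => ?_, productBound_le hn hm hj2⟩,
      kProperOfComplexity_comap (fourLetters_subset_six (sixLetters_subset_bool hsix)),
      fun f hf α K K' hK hK' => ?_, ?_, ?_, ?_, ?_⟩
    · obtain ⟨M, hM, -, rfl⟩ := exists_convexDFA hK
      obtain ⟨M', hM', -, rfl⟩ := exists_convexDFA hK'
      exact complexity_mul_le hM hM'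
    · obtain ⟨M, hM, -, rfl⟩ := exists_convexDFA hK
      obtain ⟨M', hM', -, rfl⟩ := exists_convexDFA hK'
      rw [hbool f hf]
      exact hM.complexity_boolOp_le hM' f
    · rw [← boolOp_or, hbool _ ⟨⟨false, by simp⟩, ⟨false, by simp⟩⟩,
        encard_range_collapse_of_ne (by simp) (by simp)]
    · rw [← boolOp_xor, hbool _ ⟨⟨false, by simp⟩, ⟨false, by simp⟩⟩,
        encard_range_collapse_of_ne (by simp) (by simp)]
    · rw [← boolOp_sdiff, hbool _ ⟨⟨false, by simp⟩, ⟨true, by simp⟩⟩,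
        encard_range_collapse_of_left (by simp) (by simp)]
    · rw [← boolOp_and, hbool _ ⟨⟨true, by simp⟩, ⟨true, by simp⟩⟩,
        encard_range_collapse_of_eq (by simp) (by simp)]
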